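/- Consider an open single-class system. While $n\ge 0$ individuals are present, new individuals arrive as a Poisson process of rate $\alpha(n)\ge 0$, and the total workload is reduced at rate $\beta(n)$, where $\beta(n)\ge 0$ and $\beta(n)>0$ if and only if $n>0$. Arriving individuals bring workloads that are i.i.d. with a distribution $\mu$ on $[0,\infty)$ of mean $1$, independent of the arrival process; an individual departs when its workload is reduced to zero. Under processor sharing, when $n>0$ individuals are present, the workload of each is reduced at rate $\beta(n)/n$. Let $X(t)$ be the unordered family of the residual workloads of the individuals present at time $t$; it takes values in $S=\bigcup_{n\ge 0}S_n$, where $S_n$ is the quotient of $[0,\infty)^n$ by permutation of the coordinates. Let $\bar\mu$ be the stationary residual-life distribution of $\mu$, whose distribution function is $G(x)=1-\int_x^\infty \mu((y,\infty))\,dy$, and for a probability distribution $\pi$ on $\mathbb Z_+$ let $\bar\mu_\pi=\sum_{n\ge0}\pi(n)\bar\mu_n$, where $\bar\mu_n$ is the distribution on $S_n$ of $n$ independent residual workloads with distribution $\bar\mu$. Suppose that the probability distribution $\pi$ on $\mathbb Z_+$ satisfies the balance equations $\pi(n+1)\beta(n+1)=\pi(n)\alpha(n)$ for all $n\ge 0$,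 and that $\sum_{n\ge0}\pi(n)\alpha(n)<\infty$. Then $\bar\mu_\pi$ is stationary for the process $(X(t))_{t\ge0}$: if $X(0)$ has distribution $\bar\mu_\pi$, then almost surely only finitely many events (arrivals and workload completions) occur in bounded time, and $X(t)$ has distribution $\bar\mu_\pi$ for every $t\ge0$. In particular, $\pi$ is stationary for the number of individuals in the system: under this initial distribution, the number present at every time $t\ge 0$ has distribution $\pi$, whatever the distribution $\mu$ of mean $1$ (insensitivity). The same holds for the last-in-first-out preemptive-resume discipline, in which, when $n>0$ individuals are present, the workload of the last to arrive is reduced at rate $\beta(n)$ and those of the others are not reduced, the state is the tuple of residual workloads in order of arrival, in $\bigcup_{n\ge 0}[0,\infty)^n$, and $\bar\mu_n$ is the product of $n$ copies of $\bar\mu$ on $[0,\infty)^n$. -/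

import Mathlib

open MeasureTheory ProbabilityTheory Filter Topology
open scoped NNReal ENNReal

noncomputable section

namespace Insensitivity

/-! ### Workloads -/

/-- The exponential distribution with mean one, on `ℝ≥0`. -/
def expUnit : Measure ℝ≥0 := (expMeasure 1).map Real.toNNReal

/-- The stationary residual-life distribution of the renewal process with inter-event
distribution `μ` of mean one: it has density `y ↦ μ (y, ∞)` with respect to Lebesgue measure. -/
def residual (μ : Measure ℝ≥0) : Measure ℝ≥0 :=
  ((volume.restrict (Set.Ioi (0 : ℝ))).withDensity fun y => μ {w | y < w}).map Real.toNNReal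

/-- The tail form of the distribution function of `residual μ`. -/
theorem residual_Ioi (μ : Measure ℝ≥0) (x : ℝ≥0) :
    residual μ (Set.Ioi x) = ∫⁻ y in Set.Ioi (x : ℝ), μ {w | y < w} := by
  have hpre : Real.toNNReal ⁻¹' Set.Ioi x = Set.Ioi (x : ℝ) := by
    ext y
    simp [Real.lt_toNNReal_iff_coe_lt]
  rw [residual, Measure.map_apply measurable_real_toNNReal measurableSet_Ioi, hpre,
    withDensity_apply _ measurableSet_Ioi, Measure.restrict_restrict measurableSet_Ioi,
    Set.inter_eq_self_of_subset_left (Set.Ioi_subset_Ioi x.coe_nonneg)]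

/-- If `μ` has mean one then `residual μ` has total mass one. -/
theorem isProbabilityMeasure_residual (μ : Measure ℝ≥0)
    (hμ : ∫⁻ w, (w : ℝ≥0∞) ∂μ = 1) : IsProbabilityMeasure (residual μ) := by
  constructor
  have h := lintegral_eq_lintegral_meas_lt μ (f := fun w : ℝ≥0 => (w : ℝ))
    (Eventually.of_forall fun w => w.2) (by fun_prop)
  simp only [ENNReal.ofReal_coe_nnreal] at h
  rw [residual, Measure.map_apply measurable_real_toNNReal MeasurableSet.univ, Set.preimage_univ,
    withDensity_apply _ MeasurableSet.univ, Measure.restrict_univ, ← h, hμ]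

/-- The distribution function `G(x) = 1 - ∫_x^∞ (1 - F(y)) dy` of the residual-life distribution,
where `1 - F(y) = μ (y, ∞)`. -/
theorem residual_Iic (μ : Measure ℝ≥0) (hμ : ∫⁻ w, (w : ℝ≥0∞) ∂μ = 1) (x : ℝ≥0) :
    residual μ (Set.Iic x) = 1 - ∫⁻ y in Set.Ioi (x : ℝ), μ {w | y < w} := by
  have := isProbabilityMeasure_residual μ hμ
  rw [← residual_Ioi, ← Set.compl_Ioi, prob_compl_eq_one_sub measurableSet_Ioi]

/-! ### Service disciplines and the associated jump process -/

/-- The data describing how a single-class system with states in `S` is served: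
the number of individuals present; the time until the next completion of a workload if there is
no arrival (`⊤` if there is none); the state after service for a time `t` not exceeding that time;
the removal of individuals with completed workload; the addition of an individual
bringing a given workload. -/
structure Discipline (S : Type*) where
  number : S → ℕ
  completion : S → ℝ≥0∞
  serve : ℝ≥0 → S → S
  depart : S → S
  arrive : ℝ≥0 → S → S

namespace Discipline

variable {S : Type*} (D : Discipline S) (α : ℕ → ℝ≥0)

/-- The time until the next arrival in state `x` if there is no earlier completion, where `e` is a
unit exponential variable: it is exponential with rate `α n` when there are `n` individuals. -/
def arrivalTime (x : S) (e : ℝ≥0) : ℝ≥0∞ :=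
  if α (D.number x) = 0 then ⊤ else ((e / α (D.number x) : ℝ≥0) : ℝ≥0∞)

/-- The time until the next event (arrival or completion) from state `x`. -/
def holdingTime (x : S) (e : ℝ≥0) : ℝ≥0∞ := min (D.arrivalTime α x e) (D.completion x)

/-- The state just after the next event, `u.1` being a unit exponential variable driving the
arrival time and `u.2` the workload brought if the event is an arrival. (If the holding time is
infinite, the value is never used.) -/
def nextState (x : S) (u : ℝ≥0 × ℝ≥0) : S :=
  if D.completion x ≤ D.arrivalTime α x u.1 then
    D.depart (D.serve (D.completion x).toNNReal x)
  else
    D.arrive u.2 (D.serve (D.arrivalTime α x u.1).toNNReal x)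

/-- The state just after the `k`-th event, from the initial state `x`. -/
def eventState (x : S) (u : ℕ → ℝ≥0 × ℝ≥0) : ℕ → S
  | 0 => x
  | k + 1 => D.nextState α (eventState x u k) (u k)

/-- The time of the `k`-th event, from the initial state `x` (time `0` for `k = 0`). -/
def eventTime (x : S) (u : ℕ → ℝ≥0 × ℝ≥0) : ℕ → ℝ≥0∞
  | 0 => 0
  | k + 1 => eventTime x u k + D.holdingTime α (D.eventState α x u k) (u k).1

/-- The number of events in `[0, t]`: the least `k` such that `t` is before the `(k+1)`-st event
(meaningful if there are finitely many events in `[0, t]`). -/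
def eventCount (x : S) (u : ℕ → ℝ≥0 × ℝ≥0) (t : ℝ≥0) : ℕ :=
  sInf {k : ℕ | (t : ℝ≥0∞) < D.eventTime α x u (k + 1)}

/-- The state `X(t)` at time `t`, from the initial state `x`
(meaningful if there are finitely many events in `[0, t]`). -/
def state (x : S) (u : ℕ → ℝ≥0 × ℝ≥0) (t : ℝ≥0) : S :=
  D.serve ((t : ℝ≥0∞) - D.eventTime α x u (D.eventCount α x u t)).toNNReal
    (D.eventState α x u (D.eventCount α x u t))

end Discipline

/-- The joint law of the initial state, with distribution `ν`, and of the driving sequence of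
independent pairs (unit exponential, workload with distribution `μ`), independent of it. -/
def drivingLaw {S : Type*} [MeasurableSpace S] (μ : Measure ℝ≥0) (ν : Measure S) :
    Measure (S × (ℕ → ℝ≥0 × ℝ≥0)) :=
  ν.prod (Measure.infinitePi fun _ : ℕ => expUnit.prod μ)

/-- `ν` is a stationary distribution of the process with discipline `D`, arrival rates `α` and
workload distribution `μ`: if `X(0)` has distribution `ν`, then almost surely the
process is defined for all times (only finitely many events in bounded time), and `X(t)` has
distribution `ν` for every `t ≥ 0`. -/
def IsStationary {S : Type*} [MeasurableSpace S] (D : Discipline S) (α : ℕ → ℝ≥0)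
    (μ : Measure ℝ≥0) (ν : Measure S) : Prop :=
  (∀ᵐ p ∂drivingLaw μ ν, Tendsto (D.eventTime α p.1 p.2) atTop (𝓝 ⊤)) ∧
    ∀ t : ℝ≥0, HasLaw (fun p => D.state α p.1 p.2 t) ν (drivingLaw μ ν)

/-! ### Processor sharing -/

/-- The set of residual workloads of `n` individuals, given by an `n`-tuple up to permutation. -/
def unordered (n : ℕ) (v : Fin n → ℝ≥0) : Multiset ℝ≥0 := Finset.univ.val.map v

/-- The σ-algebra on finite unordered families of workloads: `A` is measurable iff, for each `n`,
the set of `n`-tuples whose unordered family lies in `A` is Borel. -/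
instance : MeasurableSpace (Multiset ℝ≥0) :=
  ⨅ n, MeasurableSpace.map (unordered n) inferInstance

/-- Processor sharing: when there are `n > 0` individuals, each residual workload is reduced at
rate `β n / n`. The state is the unordered family of residual workloads. -/
def processorSharing (β : ℕ → ℝ≥0) : Discipline (Multiset ℝ≥0) where
  number x := x.card
  completion x := (x.map fun r => ((r / (β x.card / x.card) : ℝ≥0) : ℝ≥0∞)).inf
  serve t x := x.map fun r => r - t * (β x.card / x.card)
  depart x := x.filter fun r => 0 < r
  arrive w x := w ::ₘ x

/-- The distribution with `n` individuals with probability `π n`, their residual workloads being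
then (as an unordered family) independent with distribution `residual μ`. -/
def unorderedLaw (μ : Measure ℝ≥0) (π : PMF ℕ) : Measure (Multiset ℝ≥0) :=
  Measure.sum fun n => π n • (Measure.pi fun _ : Fin n => residual μ).map (unordered n)

/-! ### Last in, first out, preemptive resume -/

/-- Last in, first out, preemptive resume: the state is the number `n` of individuals with the
tuple of residual workloads in order of arrival, and for `n > 0` only the last residual workload is
reduced, at rate `β n`. -/
def lifo (β : ℕ → ℝ≥0) : Discipline (Σ n : ℕ, Fin n → ℝ≥0) where
  number x := x.1
  completion
    | ⟨0, _⟩ => ⊤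
    | ⟨n + 1, v⟩ => ((v (Fin.last n) / β (n + 1) : ℝ≥0) : ℝ≥0∞)
  serve
    | _, ⟨0, v⟩ => ⟨0, v⟩
    | t, ⟨n + 1, v⟩ =>
      ⟨n + 1, Function.update v (Fin.last n) (v (Fin.last n) - t * β (n + 1))⟩
  depart
    | ⟨0, v⟩ => ⟨0, v⟩
    | ⟨n + 1, v⟩ => ⟨n, fun i => v i.castSucc⟩
  arrive w x := ⟨x.1 + 1, Fin.snoc (α := fun _ => ℝ≥0) x.2 w⟩

/-- The distribution with `n` individuals with probability `π n`, their residual workloads being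
then (as an ordered tuple) independent with distribution `residual μ`. -/
def orderedLaw (μ : Measure ℝ≥0) (π : PMF ℕ) : Measure (Σ n : ℕ, Fin n → ℝ≥0) :=
  Measure.sum fun n => π n • (Measure.pi fun _ : Fin n => residual μ).map (Sigma.mk n)

end Insensitivity

end

/-! Let ρ n be the law of n independent residual workloads, and ν = ∑ π n • ρ n. In equilibrium the
states just after events should have a constant intensity η. Departures leaving n individuals occur
at rate π (n+1) β (n+1) = π n α n and leave the law ρ n. Arrivals raising the number to n occur at
rate π (n-1) α (n-1) = π n β n and add to ρ (n-1) a workload with law μ. This gives η = ∑ π n •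
`eventLaw` n.

Two identities connect ν and η. `EventBalance`: an event after time 0 is either the first one or the
successor of another. `LastEventDecomposition`: at time t, either no event has occurred or there was
a last one. In `EventBalance.isStationary`, iterating the first identity bounds the expected sum of
a nonnegative function over the events by its integral against η and time; the remainder is dropped.
Applied to the indicator of s ≤ N, this excludes explosion by Borel–Cantelli. Applied to the event
that s precedes t, that no event separates them and that the state at t is in A, it gives P(X(t) ∈
A) ≤ ν A by the second identity. Two probability measures so ordered are equal.

Both identities are proved level by level (`LevelBalance.step_balance`, `LevelBalance.lastEvent`)
and summed by means of the balance equations (`tsum_balance`). `LevelBalance` concerns service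
alone: arrivals at rate β n from ρ (n-1) make up for the service of ρ n, and completions then occur
at rate β n and leave ρ (n-1). Arrivals that end a stay at level n, at rate α n, are compensated by
restarts from ρ n at the same rate.

Level balance is verified for service at rate one (`LevelBalance.of_unit_rate`). For `lifo` it is
renewal theory for the last workload: `residual_service` and `residual_completions`. For
`processorSharing`, service makes the residual law decrease by μ itself, so by the product rule the
n-fold law decreases by n terms in each of which one residual workload is replaced by a fresh one
(`decreasesAt_multisetLaw`); first completions are treated in `lintegral_multisetLaw_completions`.
Insensitivity appears because μ enters only through its residual law being a probability measure. -/

noncomputable section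

namespace Insensitivity

/-! ### Lebesgue measure on the half-line -/

/-- The indicator of `a < b`. -/
def ltI (a b : ℝ≥0∞) : ℝ≥0∞ := if a < b then 1 else 0

/-- The indicator of `a ≤ b`. -/
def leI (a b : ℝ≥0∞) : ℝ≥0∞ := if a ≤ b then 1 else 0

theorem ltI_of_lt {a b : ℝ≥0∞} (h : a < b) : ltI a b = 1 := if_pos h

theorem ltI_of_le {a b : ℝ≥0∞} (h : b ≤ a) : ltI a b = 0 := if_neg (not_lt.2 h)

theorem leI_of_le {a b : ℝ≥0∞} (h : a ≤ b) : leI a b = 1 := if_pos h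

theorem leI_of_lt {a b : ℝ≥0∞} (h : b < a) : leI a b = 0 := if_neg (not_le.2 h)

theorem ltI_add_leI (a b : ℝ≥0∞) : ltI a b + leI b a = 1 := by
  rcases lt_or_ge a b with h | h
  · rw [ltI_of_lt h, leI_of_lt h, add_zero]
  · rw [ltI_of_le h, leI_of_le h, zero_add]

theorem ltI_mul_congr {a b x y : ℝ≥0∞} (h : a < b → x = y) : ltI a b * x = ltI a b * y := by
  rcases lt_or_ge a b with h' | h'
  · rw [h h']
  · rw [ltI_of_le h', zero_mul, zero_mul]

theorem ltI_min (a b c : ℝ≥0∞) : ltI a (min b c) = ltI a b * ltI a c := by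
  rcases lt_or_ge a b with h | h <;> rcases lt_or_ge a c with h' | h' <;>
    simp [ltI, h, h', not_lt.2]

@[fun_prop]
theorem measurable_ltI {X : Type*} [MeasurableSpace X] {f g : X → ℝ≥0∞}
    (hf : Measurable f) (hg : Measurable g) : Measurable fun x => ltI (f x) (g x) :=
  Measurable.ite (measurableSet_lt hf hg) measurable_const measurable_const

@[fun_prop]
theorem measurable_leI {X : Type*} [MeasurableSpace X] {f g : X → ℝ≥0∞}
    (hf : Measurable f) (hg : Measurable g) : Measurable fun x => leI (f x) (g x) :=
  Measurable.ite (measurableSet_le hf hg) measurable_const measurable_const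

/-- Lebesgue measure on `ℝ≥0`. -/
def lam : Measure ℝ≥0 := (volume.restrict (Set.Ioi (0 : ℝ))).map Real.toNNReal

instance : SFinite lam := by unfold lam; infer_instance

theorem lintegral_lam {f : ℝ≥0 → ℝ≥0∞} (hf : Measurable f) :
    ∫⁻ s, f s ∂lam = ∫⁻ x in Set.Ioi (0 : ℝ), f x.toNNReal := by
  rw [lam, lintegral_map hf measurable_real_toNNReal]

theorem lintegral_lam_eq_indicator {f : ℝ≥0 → ℝ≥0∞} (hf : Measurable f) :
    ∫⁻ s, f s ∂lam = ∫⁻ x : ℝ, ltI 0 (ENNReal.ofReal x) * f x.toNNReal := by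
  rw [lintegral_lam hf, ← lintegral_indicator measurableSet_Ioi]
  congr 1
  ext x
  by_cases hx : 0 < x
  · simp [hx, ltI]
  · simp [hx, ltI]

/-- Translation. -/
theorem lintegral_lam_add {f : ℝ≥0 → ℝ≥0∞} (hf : Measurable f) (u : ℝ≥0) :
    ∫⁻ s, f (s + u) ∂lam = ∫⁻ s, ltI u s * f s ∂lam := by
  rw [lintegral_lam_eq_indicator (by fun_prop), lintegral_lam_eq_indicator (by fun_prop),
    ← lintegral_add_right_eq_self
      (fun x : ℝ => ltI 0 (ENNReal.ofReal x) * (ltI u x.toNNReal * f x.toNNReal)) (u : ℝ)]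
  congr 1
  ext x
  by_cases hx : 0 < x
  · have h1 : (x + u).toNNReal = x.toNNReal + u := by
      rw [Real.toNNReal_add hx.le u.coe_nonneg, Real.toNNReal_coe]
    have h2 : (0 : ℝ) < x + u := by positivity
    rw [h1, ltI_of_lt (by simpa using hx), ltI_of_lt (by simpa using h2), ltI_of_lt]
    · simp
    · have : 0 < x.toNNReal := by simpa using hx
      exact_mod_cast lt_add_of_pos_left u this
  · rw [ltI_of_le (a := 0) (b := ENNReal.ofReal x) (by simpa using hx), ltI_of_le (a := (u : ℝ≥0∞))]
    · simp
    · have : (x + u).toNNReal ≤ u := by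
        rw [Real.toNNReal_le_iff_le_coe]; linarith
      exact_mod_cast this

/-- Reflection. -/
theorem lintegral_lam_sub {f : ℝ≥0 → ℝ≥0∞} (hf : Measurable f) (t : ℝ≥0) :
    ∫⁻ s, ltI s t * f (t - s) ∂lam = ∫⁻ s, ltI s t * f s ∂lam := by
  rw [lintegral_lam_eq_indicator (by fun_prop), lintegral_lam_eq_indicator (by fun_prop),
    ← lintegral_sub_left_eq_self
      (fun x : ℝ => ltI 0 (ENNReal.ofReal x) * (ltI x.toNNReal t * f x.toNNReal)) (t : ℝ)]
  congr 1
  ext x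
  have key : ltI 0 (ENNReal.ofReal x) * ltI x.toNNReal t
      = ltI 0 (ENNReal.ofReal (t - x)) * ltI (t - x).toNNReal t := by
    have e1 : ∀ y : ℝ, ltI 0 (ENNReal.ofReal y) = if 0 < y then 1 else 0 := by simp [ltI]
    have e2 : ∀ y : ℝ, 0 < y → ltI y.toNNReal t = if y < t then 1 else 0 := by
      intro y hy
      simp [ltI, Real.toNNReal_lt_iff_lt_coe hy.le]
    have e3 : ∀ y : ℝ, ltI 0 (ENNReal.ofReal y) * ltI y.toNNReal t
        = if 0 < y ∧ y < t then 1 else 0 := by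
      intro y
      by_cases hy : 0 < y
      · rw [e1, e2 y hy]; simp [hy]
      · rw [e1]; simp [hy]
    rw [e3, e3]
    congr 1
    simp only [sub_pos, sub_lt_self_iff, eq_iff_iff]
    tauto
  rw [← mul_assoc, ← mul_assoc, key]
  have : (t - x).toNNReal = t - x.toNNReal ∨ ltI 0 (ENNReal.ofReal x) * ltI x.toNNReal t = 0 := by
    by_cases hx : 0 < x
    · left
      rw [NNReal.sub_def, Real.coe_toNNReal x hx.le]
    · right
      rw [ltI_of_le (by simpa using hx), zero_mul]
  rcases this with h | h
  · rw [h]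
  · rw [← key, h, zero_mul, zero_mul]

/-- Scaling. -/
theorem lintegral_lam_mul {f : ℝ≥0 → ℝ≥0∞} (hf : Measurable f) {b : ℝ≥0} (hb : 0 < b) :
    b * ∫⁻ s, f (b * s) ∂lam = ∫⁻ s, f s ∂lam := by
  have hb' : (b : ℝ) ≠ 0 := by exact_mod_cast hb.ne'
  rw [lintegral_lam_eq_indicator (by fun_prop), lintegral_lam_eq_indicator (by fun_prop)]
  conv_rhs => rw [← Real.smul_map_volume_mul_left hb']
  rw [lintegral_smul_measure, lintegral_map (by fun_prop) (by fun_prop)]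
  have h0 : ENNReal.ofReal |(b : ℝ)| = b := by
    rw [abs_of_nonneg b.coe_nonneg]; exact ENNReal.ofReal_coe_nnreal
  rw [h0, smul_eq_mul]
  congr 2
  ext x
  have h1 : (b * x).toNNReal = b * x.toNNReal := by
    rw [Real.toNNReal_mul b.coe_nonneg, Real.toNNReal_coe]
  have h2 : ltI 0 (ENNReal.ofReal (b * x)) = ltI 0 (ENNReal.ofReal x) := by
    simp [ltI, hb]
  rw [h1, h2]

instance : NullSingletonClass lam := by
  refine ⟨fun x => ?_⟩
  rw [lam, Measure.map_apply measurable_real_toNNReal (measurableSet_singleton x)]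
  rw [Measure.restrict_apply (measurable_real_toNNReal (measurableSet_singleton x))]
  refine measure_mono_null (t := {(x : ℝ)}) ?_ (by simp)
  rintro y ⟨hy, hy0⟩
  simp only [Set.mem_preimage, Set.mem_singleton_iff] at hy ⊢
  rw [← hy, Real.coe_toNNReal y (le_of_lt hy0)]

theorem lintegral_lam_ltI (t : ℝ≥0) : ∫⁻ s, ltI s t ∂lam = t := by
  have h : Measurable fun s : ℝ≥0 => ltI s t := by fun_prop
  rw [lintegral_lam h]
  have : ∀ x ∈ Set.Ioi (0 : ℝ), ltI x.toNNReal t = (Set.Iio (t : ℝ)).indicator 1 x := by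
    intro x hx
    simp [ltI, Set.indicator, Real.toNNReal_lt_iff_lt_coe (le_of_lt hx)]
  rw [setLIntegral_congr_fun measurableSet_Ioi this, lintegral_indicator_one measurableSet_Iio,
    Measure.restrict_apply measurableSet_Iio, Set.inter_comm, Set.Ioi_inter_Iio, Real.volume_Ioo]
  simp

/-- The change of variables `(s, h) ↦ (s + h, h)`. -/
theorem lintegral_lam_lam_add {F : ℝ≥0 → ℝ≥0 → ℝ≥0∞} (hF : Measurable (Function.uncurry F)) :
    ∫⁻ s, ∫⁻ h, F (s + h) h ∂lam ∂lam = ∫⁻ t, ∫⁻ h, ltI h t * F t h ∂lam ∂lam := by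
  rw [lintegral_lintegral_swap (f := fun s h => F (s + h) h) (by fun_prop),
    lintegral_lintegral_swap (f := fun (t h : ℝ≥0) => ltI h t * F t h) (by fun_prop)]
  congr 1
  ext h
  exact lintegral_lam_add (f := fun s => F s h) (by fun_prop) h

/-- The tail of a measure. -/
def tail (μ : Measure ℝ≥0) (y : ℝ≥0) : ℝ≥0∞ := μ (Set.Ioi y)

@[fun_prop]
theorem measurable_tail (μ : Measure ℝ≥0) [SFinite μ] : Measurable (tail μ) :=
  measurable_measure_prodMk_left (ν := μ) (s := {p : ℝ≥0 × ℝ≥0 | p.1 < p.2})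
    (measurableSet_lt measurable_fst measurable_snd)

theorem lintegral_ltI (μ : Measure ℝ≥0) (y : ℝ≥0) :
    ∫⁻ w, ltI y w ∂μ = tail μ y := by
  rw [tail, ← lintegral_indicator_one measurableSet_Ioi]
  congr 1
  ext w
  simp [ltI, Set.indicator]

theorem lintegral_residual (μ : Measure ℝ≥0) [SFinite μ] {f : ℝ≥0 → ℝ≥0∞} (hf : Measurable f) :
    ∫⁻ r, f r ∂residual μ = ∫⁻ y, tail μ y * f y ∂lam := by
  rw [residual, lintegral_map hf measurable_real_toNNReal, lintegral_lam (by fun_prop)]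
  have h1 : ∀ y ∈ Set.Ioi (0 : ℝ), μ {w | y < w} = tail μ y.toNNReal := by
    intro y hy
    rw [tail]
    congr 1
    ext w
    simp [Real.toNNReal_lt_iff_lt_coe (le_of_lt hy)]
  have h2 : (volume.restrict (Set.Ioi (0 : ℝ))).withDensity (fun y => μ {w | y < w})
      = (volume.restrict (Set.Ioi (0 : ℝ))).withDensity (fun y => tail μ y.toNNReal) :=
    withDensity_congr_ae ((ae_restrict_iff' measurableSet_Ioi).2 (Eventually.of_forall h1))
  rw [h2, lintegral_withDensity_eq_lintegral_mul _ (by fun_prop) (by fun_prop)]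
  rfl

instance (μ : Measure ℝ≥0) [SFinite μ] : NullSingletonClass (residual μ) := by
  refine ⟨fun x => ?_⟩
  rw [← lintegral_indicator_one (measurableSet_singleton x),
    lintegral_residual μ (measurable_one.indicator (measurableSet_singleton x)),
    lintegral_eq_zero_iff']
  · have : ∀ᵐ y ∂lam, y ≠ x := by simp [ae_iff, measure_singleton]
    filter_upwards [this] with y hy
    simp [hy]
  · exact ((measurable_tail μ).mul
      (measurable_one.indicator (measurableSet_singleton x))).aemeasurable

/-- The tail of the exponential distribution with rate one. -/
def expTail (x : ℝ≥0) : ℝ≥0∞ := ENNReal.ofReal (Real.exp (-x))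

@[fun_prop]
theorem measurable_expTail : Measurable expTail := by
  unfold expTail; fun_prop

instance : IsProbabilityMeasure expUnit := by
  have := isProbabilityMeasure_expMeasure (r := 1) one_pos
  exact Measure.isProbabilityMeasure_map (by fun_prop)

theorem lintegral_expUnit {f : ℝ≥0 → ℝ≥0∞} (hf : Measurable f) :
    ∫⁻ e, f e ∂expUnit = ∫⁻ s, expTail s * f s ∂lam := by
  have hpdf : Measurable (gammaPDF 1 1) := (measurable_gammaPDFReal 1 1).ennreal_ofReal
  rw [expUnit, lintegral_map hf measurable_real_toNNReal, lintegral_lam (by fun_prop),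
    expMeasure, gammaMeasure, lintegral_withDensity_eq_lintegral_mul _ hpdf (by fun_prop),
    ← lintegral_indicator measurableSet_Ioi]
  have hne : ∀ᵐ y : ℝ, y ≠ 0 := by simp [ae_iff, measure_singleton]
  refine lintegral_congr_ae ?_
  filter_upwards [hne] with x hx
  rcases lt_or_gt_of_ne hx with h | h
  · have : gammaPDF 1 1 x = 0 := by simp [gammaPDF, gammaPDFReal, not_le.2 h]
    simp [this, not_lt.2 h.le]
  · have : gammaPDF 1 1 x = ENNReal.ofReal (Real.exp (-x)) := by
      simp [gammaPDF, gammaPDFReal, h.le]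
    simp [this, h, h.le, expTail]

theorem tail_expUnit (x : ℝ≥0) : tail expUnit x = expTail x := by
  have := isProbabilityMeasure_expMeasure (r := 1) one_pos
  have hpre : Real.toNNReal ⁻¹' Set.Ioi x = (Set.Iic (x : ℝ))ᶜ := by
    ext y
    simp [Real.lt_toNNReal_iff_coe_lt]
  have h := cdf_expMeasure_eq (r := 1) one_pos (x : ℝ)
  rw [cdf_eq_real, if_pos x.coe_nonneg] at h
  rw [tail, expUnit, Measure.map_apply measurable_real_toNNReal measurableSet_Ioi, hpre,
    ← ofReal_measureReal, probReal_compl_eq_one_sub measurableSet_Iic, h, expTail]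
  simp

theorem lintegral_expUnit_div {f : ℝ≥0 → ℝ≥0∞} (hf : Measurable f) {a : ℝ≥0} (ha : a ≠ 0) :
    ∫⁻ e, f (e / a) ∂expUnit = ∫⁻ h, a * expTail (a * h) * f h ∂lam := by
  rw [lintegral_expUnit (by fun_prop), ← lintegral_lam_mul (by fun_prop) (pos_iff_ne_zero.2 ha),
    ← lintegral_const_mul _ (by fun_prop)]
  congr 1
  ext h
  rw [mul_div_cancel_left₀ h ha, mul_assoc]

/-- Averaging, over an independent random time `w` truncated at `t`, the identity
`C = A t + ∫₀ᵗ B`. -/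
theorem average_truncated (m : Measure ℝ≥0) [IsProbabilityMeasure m] {A B : ℝ≥0 → ℝ≥0∞}
    (hA : Measurable A) (hB : Measurable B) {C : ℝ≥0∞}
    (h : ∀ t : ℝ≥0, C = A t + ∫⁻ s, ltI s t * B s ∂lam) (t : ℝ≥0) :
    C = tail m t * A t + ∫⁻ w, leI w t * A w ∂m
      + ∫⁻ s, ltI s t * (tail m s * B s) ∂lam := by
  -- The identity is used at the random time `min w t`; its left side is constant and `m` has mass
  -- one.
  have h1 : C = ∫⁻ w, (A (min w t) + ∫⁻ s, ltI s (min w t : ℝ≥0) * B s ∂lam) ∂m := by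
    simp_rw [← h]
    simp
  rw [h1, lintegral_add_left (by fun_prop)]
  congr 1
  · have : ∀ w : ℝ≥0, A (min w t) = ltI t w * A t + leI w t * A w := by
      intro w
      rcases lt_or_ge t w with hw | hw
      · rw [min_eq_right hw.le, ltI_of_lt (by exact_mod_cast hw),
          leI_of_lt (by exact_mod_cast hw)]; simp
      · rw [min_eq_left hw, ltI_of_le (by exact_mod_cast hw),
          leI_of_le (by exact_mod_cast hw)]; simp
    simp_rw [this]
    rw [lintegral_add_left (by fun_prop), lintegral_mul_const _ (by fun_prop), lintegral_ltI]
  · rw [lintegral_lintegral_swap (by fun_prop)]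
    congr 1
    ext s
    rw [lintegral_mul_const _ (by fun_prop), ← lintegral_ltI, ← mul_assoc,
      ← lintegral_const_mul _ (by fun_prop)]
    congr 2
    ext w
    rw [ENNReal.coe_min, ltI_min, mul_comm]

/-- Averaging the identity `C = A t + ∫₀ᵗ B` over an exponential time with rate `a`
truncated at `t`. -/
theorem average_exponential (a : ℝ≥0) {A B : ℝ≥0 → ℝ≥0∞}
    (hA : Measurable A) (hB : Measurable B) {C : ℝ≥0∞}
    (h : ∀ t : ℝ≥0, C = A t + ∫⁻ s, ltI s t * B s ∂lam) (t : ℝ≥0) :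
    C = expTail (a * t) * A t
      + ∫⁻ s, ltI s t * (expTail (a * s) * (a * A s + B s)) ∂lam := by
  -- A clock of rate 0 never rings, whereas `e / 0` would be 0.
  rcases eq_or_ne a 0 with rfl | ha
  · simpa [expTail] using h t
  · have hdiv : Measurable fun e : ℝ≥0 => e / a := by fun_prop
    have hpre : ∀ s : ℝ≥0, tail (expUnit.map fun e => e / a) s = expTail (a * s) := by
      intro s
      rw [tail, Measure.map_apply hdiv measurableSet_Ioi, ← tail_expUnit, tail]
      congr 1
      ext e
      simp [lt_div_iff₀ (pos_iff_ne_zero.2 ha), mul_comm]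
    have : IsProbabilityMeasure (expUnit.map fun e => e / a) :=
      Measure.isProbabilityMeasure_map hdiv.aemeasurable
    have key := average_truncated (expUnit.map fun e => e / a) hA hB h t
    simp_rw [hpre] at key
    rw [lintegral_map (by fun_prop) hdiv,
      lintegral_expUnit_div (f := fun w => leI w t * A w) (by fun_prop) ha] at key
    rw [key, add_assoc]
    congr 1
    rw [← lintegral_add_left (by fun_prop)]
    refine lintegral_congr_ae ?_
    have hne : ∀ᵐ y ∂lam, y ≠ t := by simp [ae_iff, measure_singleton]
    filter_upwards [hne] with s hs
    have : leI s t = ltI s t := by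
      rcases lt_or_gt_of_ne hs with h | h
      · rw [leI_of_le (by exact_mod_cast h.le), ltI_of_lt (by exact_mod_cast h)]
      · rw [leI_of_lt (by exact_mod_cast h), ltI_of_le (by exact_mod_cast h.le)]
    rw [this]
    ring

section

/-! ### The driving sequence -/

/-- Prepend an element to a sequence. -/
def seqCons {X : Type*} (v : X) (u : ℕ → X) : ℕ → X
  | 0 => v
  | k + 1 => u k

theorem measurable_seqCons {X : Type*} [MeasurableSpace X] :
    Measurable fun p : X × (ℕ → X) => seqCons p.1 p.2 := by
  refine measurable_pi_iff.2 fun k => ?_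
  cases k with
  | zero => exact measurable_fst
  | succ k => exact (measurable_pi_apply k).comp measurable_snd

/-- This underlies the restart of the process at its first event: the later driving variables form
an i.i.d. sequence independent of the first. It suffices to compare cylinders, which split into a
condition on coordinate 0 and a shifted cylinder. -/
theorem map_seqCons {X : Type*} [MeasurableSpace X] (ρ : Measure X) [IsProbabilityMeasure ρ] :
    (ρ.prod (Measure.infinitePi fun _ : ℕ => ρ)).map (fun p => seqCons p.1 p.2)
      = Measure.infinitePi fun _ : ℕ => ρ := by
  refine Measure.eq_infinitePi _ fun s t ht => ?_
  obtain ⟨N, hN⟩ : ∃ N, s ⊆ Finset.range (N + 1) := by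
    obtain ⟨N, hN⟩ := s.exists_nat_subset_range
    exact ⟨N, hN.trans (Finset.range_mono (Nat.le_succ N))⟩
  have hpre : (fun p : X × (ℕ → X) => seqCons p.1 p.2) ⁻¹' ((s : Set ℕ).pi t)
      = (if 0 ∈ s then t 0 else Set.univ) ×ˢ
        (((Finset.range N).filter fun i => i + 1 ∈ s : Finset ℕ) : Set ℕ).pi
          fun i => t (i + 1) := by
    ext ⟨v, u⟩
    simp only [Set.mem_preimage, Set.mem_pi, Finset.mem_coe, Set.mem_prod, Finset.mem_filter,
      Finset.mem_range]
    constructor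
    · intro h
      refine ⟨?_, fun i hi => h (i + 1) hi.2⟩
      split_ifs with h0
      · exact h 0 h0
      · trivial
    · rintro ⟨h0, h⟩ i hi
      cases i with
      | zero => simpa [hi, seqCons] using h0
      | succ i => exact h i ⟨by have := hN hi; simpa using this, hi⟩
  have hs : s = (Finset.range (N + 1)).filter fun i => i ∈ s := by
    ext i
    simpa using fun hi => by simpa using hN hi
  have hmeas : MeasurableSet ((s : Set ℕ).pi t) :=
    MeasurableSet.pi s.countable_toSet fun i _ => ht i
  rw [Measure.map_apply measurable_seqCons hmeas, hpre, Measure.prod_prod,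
    Measure.infinitePi_pi _ fun i _ => ht (i + 1)]
  conv_rhs => rw [hs]
  rw [Finset.prod_filter, Finset.prod_filter, Finset.prod_range_succ', mul_comm]
  congr 1
  split_ifs <;> simp

theorem lintegral_infinitePi_seqCons {X : Type*} [MeasurableSpace X] (ρ : Measure X)
    [IsProbabilityMeasure ρ] {f : (ℕ → X) → ℝ≥0∞} (hf : Measurable f) :
    ∫⁻ u, f u ∂(Measure.infinitePi fun _ : ℕ => ρ)
      = ∫⁻ v, ∫⁻ u, f (seqCons v u) ∂(Measure.infinitePi fun _ : ℕ => ρ) ∂ρ := by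
  conv_lhs => rw [← map_seqCons ρ]
  rw [lintegral_map hf measurable_seqCons, lintegral_prod]
  exact (hf.comp measurable_seqCons).aemeasurable

/-! ### Events and the one-step operator -/

namespace Discipline

/-- Measurability of all the data of a discipline. -/
structure IsMeasurable {S : Type*} [MeasurableSpace S] (D : Discipline S) : Prop where
  number : Measurable D.number
  completion : Measurable D.completion
  serve : Measurable fun p : ℝ≥0 × S => D.serve p.1 p.2
  depart : Measurable D.depart
  arrive : Measurable fun p : ℝ≥0 × S => D.arrive p.1 p.2

variable {S : Type*} (D : Discipline S) (α : ℕ → ℝ≥0)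

/-- `eventState` recurses on the last event, while `step` conditions on the first one; this lemma
and the next pass from one to the other. -/
theorem eventState_seqCons (x : S) (v : ℝ≥0 × ℝ≥0) (u : ℕ → ℝ≥0 × ℝ≥0) (k : ℕ) :
    D.eventState α x (seqCons v u) (k + 1) = D.eventState α (D.nextState α x v) u k := by
  induction k with
  | zero => rfl
  | succ k ih =>
    rw [eventState, ih]
    rfl

theorem eventTime_seqCons (x : S) (v : ℝ≥0 × ℝ≥0) (u : ℕ → ℝ≥0 × ℝ≥0) (k : ℕ) :
    D.eventTime α x (seqCons v u) (k + 1)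
      = D.holdingTime α x v.1 + D.eventTime α (D.nextState α x v) u k := by
  induction k with
  | zero => simp [eventTime, eventState, seqCons]
  | succ k ih =>
    rw [eventTime, ih, eventState_seqCons, add_assoc]
    rfl

variable {D}
variable [MeasurableSpace S]

theorem IsMeasurable.arrivalTime (hD : D.IsMeasurable) :
    Measurable fun p : S × ℝ≥0 => D.arrivalTime α p.1 p.2 := by
  have h : Measurable fun p : S × ℝ≥0 => α (D.number p.1) :=
    (measurable_of_countable α).comp (hD.number.comp measurable_fst)
  unfold Discipline.arrivalTime
  exact Measurable.ite (h (measurableSet_singleton 0)) measurable_const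
    (measurable_snd.div h).coe_nnreal_ennreal

theorem IsMeasurable.holdingTime (hD : D.IsMeasurable) :
    Measurable fun p : S × ℝ≥0 => D.holdingTime α p.1 p.2 :=
  (hD.arrivalTime α).min (hD.completion.comp measurable_fst)

theorem IsMeasurable.nextState (hD : D.IsMeasurable) :
    Measurable fun p : S × (ℝ≥0 × ℝ≥0) => D.nextState α p.1 p.2 := by
  have ha : Measurable fun p : S × (ℝ≥0 × ℝ≥0) => D.arrivalTime α p.1 p.2.1 :=
    (hD.arrivalTime α).comp (measurable_fst.prodMk measurable_snd.fst)
  have hc : Measurable fun p : S × (ℝ≥0 × ℝ≥0) => D.completion p.1 :=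
    hD.completion.comp measurable_fst
  unfold Discipline.nextState
  refine Measurable.ite (measurableSet_le hc ha) ?_ ?_
  · exact hD.depart.comp (hD.serve.comp (hc.ennreal_toNNReal.prodMk measurable_fst))
  · exact hD.arrive.comp (measurable_snd.snd.prodMk
      (hD.serve.comp (ha.ennreal_toNNReal.prodMk measurable_fst)))

theorem IsMeasurable.eventState (hD : D.IsMeasurable) (k : ℕ) :
    Measurable fun p : S × (ℕ → ℝ≥0 × ℝ≥0) => D.eventState α p.1 p.2 k := by
  induction k with
  | zero => exact measurable_fst
  | succ k ih =>
    exact (hD.nextState α).comp (ih.prodMk ((measurable_pi_apply k).comp measurable_snd))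

theorem IsMeasurable.eventTime (hD : D.IsMeasurable) (k : ℕ) :
    Measurable fun p : S × (ℕ → ℝ≥0 × ℝ≥0) => D.eventTime α p.1 p.2 k := by
  induction k with
  | zero => exact measurable_const
  | succ k ih =>
    exact ih.add ((hD.holdingTime α).comp ((hD.eventState α k).prodMk
      ((measurable_pi_apply k).comp measurable_snd).fst))

theorem IsMeasurable.eventCount (hD : D.IsMeasurable) (t : ℝ≥0) :
    Measurable fun p : S × (ℕ → ℝ≥0 × ℝ≥0) => D.eventCount α p.1 p.2 t := by
  have hm : ∀ k, MeasurableSet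
      {p : S × (ℕ → ℝ≥0 × ℝ≥0) | (t : ℝ≥0∞) < D.eventTime α p.1 p.2 (k + 1)} :=
    fun k => measurableSet_lt measurable_const (hD.eventTime α (k + 1))
  refine measurable_to_countable' fun k => ?_
  -- The second alternative is the default value `sInf ∅ = 0`, taken when infinitely many events
  -- occur up to `t`.
  have : (fun p : S × (ℕ → ℝ≥0 × ℝ≥0) => D.eventCount α p.1 p.2 t) ⁻¹' {k}
      = {p | ((t : ℝ≥0∞) < D.eventTime α p.1 p.2 (k + 1) ∧
          ∀ j < k, ¬ (t : ℝ≥0∞) < D.eventTime α p.1 p.2 (j + 1)) ∨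
          (k = 0 ∧ ∀ j, ¬ (t : ℝ≥0∞) < D.eventTime α p.1 p.2 (j + 1))} := by
    ext p
    simp only [Set.mem_preimage, Set.mem_singleton_iff, Set.mem_ofPred_eq, Discipline.eventCount]
    constructor
    · rintro rfl
      by_cases hne : {k : ℕ | (t : ℝ≥0∞) < D.eventTime α p.1 p.2 (k + 1)}.Nonempty
      · exact Or.inl ⟨Nat.sInf_mem hne, fun j hj => Nat.notMem_of_lt_sInf hj⟩
      · rw [Set.not_nonempty_iff_eq_empty] at hne
        refine Or.inr ⟨by rw [hne, Nat.sInf_empty], fun j hj => ?_⟩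
        have : j ∈ {k : ℕ | (t : ℝ≥0∞) < D.eventTime α p.1 p.2 (k + 1)} := hj
        rw [hne] at this
        exact this
    · rintro (⟨h1, h2⟩ | ⟨rfl, h⟩)
      · refine le_antisymm (Nat.sInf_le h1) ?_
        by_contra! hlt
        have hne : {k : ℕ | (t : ℝ≥0∞) < D.eventTime α p.1 p.2 (k + 1)}.Nonempty := ⟨k, h1⟩
        exact h2 _ hlt (Nat.sInf_mem hne)
      · have : {k : ℕ | (t : ℝ≥0∞) < D.eventTime α p.1 p.2 (k + 1)} = ∅ :=
          Set.eq_empty_of_forall_notMem h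
        rw [this, Nat.sInf_empty]
  rw [this]
  have h1 : MeasurableSet {p : S × (ℕ → ℝ≥0 × ℝ≥0) |
      ∀ j < k, ¬ (t : ℝ≥0∞) < D.eventTime α p.1 p.2 (j + 1)} := by
    convert MeasurableSet.iInter fun j => MeasurableSet.iInter fun _ : j < k => (hm j).compl using 1
    ext p
    simp
  have h2 : MeasurableSet {p : S × (ℕ → ℝ≥0 × ℝ≥0) |
      ∀ j, ¬ (t : ℝ≥0∞) < D.eventTime α p.1 p.2 (j + 1)} := by
    convert MeasurableSet.iInter fun j => (hm j).compl using 1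
    ext p
    simp
  exact ((hm k).inter h1).union ((MeasurableSet.const _).inter h2)

theorem IsMeasurable.state (hD : D.IsMeasurable) (t : ℝ≥0) :
    Measurable fun p : S × (ℕ → ℝ≥0 × ℝ≥0) => D.state α p.1 p.2 t := by
  -- The event index is made a separate countable coordinate, into which the random count is then
  -- substituted.
  have h : Measurable fun q : (S × (ℕ → ℝ≥0 × ℝ≥0)) × ℕ =>
      D.serve ((t : ℝ≥0∞) - D.eventTime α q.1.1 q.1.2 q.2).toNNReal
        (D.eventState α q.1.1 q.1.2 q.2) :=
    measurable_from_prod_countable_left fun k =>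
      hD.serve.comp (((measurable_const.sub (hD.eventTime α k)).ennreal_toNNReal).prodMk
        (hD.eventState α k))
  exact h.comp (measurable_id.prodMk (hD.eventCount α t))

variable (D)

/-- The expected value of `Φ` at the time and state of the next event, starting at time `s`
in state `x`. -/
def step (μ : Measure ℝ≥0) (Φ : ℝ≥0∞ → S → ℝ≥0∞) (s : ℝ≥0∞) (x : S) : ℝ≥0∞ :=
  ∫⁻ v, Φ (s + D.holdingTime α x v.1) (D.nextState α x v) ∂(expUnit.prod μ)

/-- The expected value of `F` at the time and state of the `k`-th event and the variables
driving the next one, starting at time `s` in state `x`. -/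
def afterEvents (μ : Measure ℝ≥0) (F : ℝ≥0∞ → S → ℝ≥0 × ℝ≥0 → ℝ≥0∞) (k : ℕ) (s : ℝ≥0∞) (x : S) :
    ℝ≥0∞ :=
  ∫⁻ u, F (s + D.eventTime α x u k) (D.eventState α x u k) (u k)
    ∂(Measure.infinitePi fun _ : ℕ => expUnit.prod μ)

variable {D}
variable {μ : Measure ℝ≥0} [IsProbabilityMeasure μ] {F : ℝ≥0∞ → S → ℝ≥0 × ℝ≥0 → ℝ≥0∞}

theorem IsMeasurable.afterEvents_integrand (hD : D.IsMeasurable)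
    (hF : Measurable fun q : ℝ≥0∞ × S × (ℝ≥0 × ℝ≥0) => F q.1 q.2.1 q.2.2) (k : ℕ) :
    Measurable fun q : (ℝ≥0∞ × S) × (ℕ → ℝ≥0 × ℝ≥0) =>
      F (q.1.1 + D.eventTime α q.1.2 q.2 k) (D.eventState α q.1.2 q.2 k) (q.2 k) := by
  have h : Measurable fun q : (ℝ≥0∞ × S) × (ℕ → ℝ≥0 × ℝ≥0) => (q.1.2, q.2) := by fun_prop
  exact hF.comp ((measurable_fst.fst.add ((hD.eventTime α k).comp h)).prodMk
    (((hD.eventState α k).comp h).prodMk ((measurable_pi_apply k).comp measurable_snd)))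

theorem IsMeasurable.afterEvents (hD : D.IsMeasurable)
    (hF : Measurable fun q : ℝ≥0∞ × S × (ℝ≥0 × ℝ≥0) => F q.1 q.2.1 q.2.2) (k : ℕ) :
    Measurable fun p : ℝ≥0∞ × S => D.afterEvents α μ F k p.1 p.2 :=
  (hD.afterEvents_integrand α hF k).lintegral_prod_right'

/-- Conditioning on the first event: the variables driving it are split off, and the rest is the
process restarted at the time and state of that event. -/
theorem IsMeasurable.afterEvents_succ (hD : D.IsMeasurable)
    (hF : Measurable fun q : ℝ≥0∞ × S × (ℝ≥0 × ℝ≥0) => F q.1 q.2.1 q.2.2) (k : ℕ)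
    (s : ℝ≥0∞) (x : S) :
    D.afterEvents α μ F (k + 1) s x = D.step α μ (D.afterEvents α μ F k) s x := by
  rw [Discipline.afterEvents, lintegral_infinitePi_seqCons]
  · simp only [eventTime_seqCons, eventState_seqCons, ← add_assoc]
    rfl
  · exact (hD.afterEvents_integrand α hF (k + 1)).comp (measurable_prodMk_left (x := (s, x)))

theorem IsMeasurable.afterEvents_zero
    (hF : Measurable fun q : ℝ≥0∞ × S × (ℝ≥0 × ℝ≥0) => F q.1 q.2.1 q.2.2) (s : ℝ≥0∞) (x : S) :
    D.afterEvents α μ F 0 s x = ∫⁻ v, F s x v ∂(expUnit.prod μ) := by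
  have h : Measurable fun v : ℝ≥0 × ℝ≥0 => F s x v :=
    hF.comp (measurable_const.prodMk (measurable_const.prodMk measurable_id))
  conv_rhs => rw [← Measure.infinitePi_map_eval (fun _ : ℕ => expUnit.prod μ) 0]
  rw [lintegral_map h (measurable_pi_apply 0)]
  simp only [Discipline.afterEvents, Discipline.eventTime, Discipline.eventState, add_zero]

end Discipline

end

/-! ### Stationarity from the balance of events -/

section

namespace Discipline

variable {S : Type*} (D : Discipline S) (α : ℕ → ℝ≥0)

/-- The indicator that, for the process started at time `s` in state `x`, time `t` is before the
next event and the state at time `t` is in `A`. -/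
def noEventInd (t : ℝ≥0) (A : Set S) (s : ℝ≥0∞) (x : S) (v : ℝ≥0 × ℝ≥0) : ℝ≥0∞ :=
  leI s t * ltI t (s + D.holdingTime α x v.1)
    * A.indicator 1 (D.serve ((t : ℝ≥0∞) - s).toNNReal x)

variable {D}

/-- Divergence of the event times makes the set defining `eventCount` nonempty: its infimum is
attained, and minimality gives the first inequality. -/
theorem eventCount_spec {x : S} {u : ℕ → ℝ≥0 × ℝ≥0} (t : ℝ≥0)
    (h : Tendsto (D.eventTime α x u) atTop (𝓝 ⊤)) :
    D.eventTime α x u (D.eventCount α x u t) ≤ t ∧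
      (t : ℝ≥0∞) < D.eventTime α x u (D.eventCount α x u t + 1) := by
  have hne : {k : ℕ | (t : ℝ≥0∞) < D.eventTime α x u (k + 1)}.Nonempty := by
    have := (h.comp (tendsto_add_atTop_nat 1)).eventually
      (lt_mem_nhds (ENNReal.coe_lt_top (r := t)))
    exact this.exists
  refine ⟨?_, Nat.sInf_mem hne⟩
  rcases hk : D.eventCount α x u t with _ | k
  · exact zero_le
  · have : k ∉ {k : ℕ | (t : ℝ≥0∞) < D.eventTime α x u (k + 1)} :=
      Nat.notMem_of_lt_sInf (by rw [eventCount] at hk; omega)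
    exact not_lt.1 this

variable [MeasurableSpace S]

theorem IsMeasurable.noEventInd (hD : D.IsMeasurable) (t : ℝ≥0) {A : Set S}
    (hA : MeasurableSet A) :
    Measurable fun q : ℝ≥0∞ × S × (ℝ≥0 × ℝ≥0) => D.noEventInd α t A q.1 q.2.1 q.2.2 := by
  have h1 : Measurable fun q : ℝ≥0∞ × S × (ℝ≥0 × ℝ≥0) => D.holdingTime α q.2.1 q.2.2.1 :=
    (hD.holdingTime α).comp
      (f := fun q : ℝ≥0∞ × S × (ℝ≥0 × ℝ≥0) => (q.2.1, q.2.2.1)) (by fun_prop)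
  have h2 : Measurable fun q : ℝ≥0∞ × S × (ℝ≥0 × ℝ≥0) =>
      D.serve ((t : ℝ≥0∞) - q.1).toNNReal q.2.1 :=
    hD.serve.comp (f := fun q : ℝ≥0∞ × S × (ℝ≥0 × ℝ≥0) => (((t : ℝ≥0∞) - q.1).toNNReal, q.2.1))
      (by fun_prop)
  have h3 := (measurable_one (α := ℝ≥0∞)).indicator hA |>.comp h2
  unfold Discipline.noEventInd
  exact Measurable.mul (by fun_prop) h3

variable {μ : Measure ℝ≥0} [IsProbabilityMeasure μ] {ν η : Measure S}

/-- The balance of events between times `0` and `∞`: `η` is the intensity of the states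
just after events, in equilibrium. -/
def EventBalance (D : Discipline S) (α : ℕ → ℝ≥0) (μ : Measure ℝ≥0) (ν η : Measure S) : Prop :=
  ∀ Φ : ℝ≥0∞ → S → ℝ≥0∞, Measurable (fun p : ℝ≥0∞ × S => Φ p.1 p.2) → (∀ x, Φ ⊤ x = 0) →
    ∫⁻ s : ℝ≥0, ∫⁻ x, Φ s x ∂η ∂lam = ∫⁻ x, D.step α μ Φ 0 x ∂ν
      + ∫⁻ s : ℝ≥0, ∫⁻ x, D.step α μ Φ s x ∂η ∂lam

/-- The decomposition of the law of the state at time `t` according to the last event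
before `t`, in equilibrium. -/
def LastEventDecomposition (D : Discipline S) (α : ℕ → ℝ≥0) (μ : Measure ℝ≥0)
    (ν η : Measure S) : Prop :=
  ∀ (t : ℝ≥0) (A : Set S), MeasurableSet A →
    ν A = ∫⁻ x, ∫⁻ v, D.noEventInd α t A 0 x v ∂(expUnit.prod μ) ∂ν
      + ∫⁻ s : ℝ≥0, ∫⁻ x, ∫⁻ v, D.noEventInd α t A s x v ∂(expUnit.prod μ) ∂η ∂lam

/-- The balance is applied to `afterEvents m`: it splits off the contribution of ν, and `step` turns
`m` into `m + 1` in the remainder. Vanishing at time `⊤` persists because `⊤` plus any duration is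
`⊤`. -/
theorem EventBalance.sum_afterEvents (hD : D.IsMeasurable) (h : EventBalance D α μ ν η)
    {F : ℝ≥0∞ → S → ℝ≥0 × ℝ≥0 → ℝ≥0∞}
    (hF : Measurable fun q : ℝ≥0∞ × S × (ℝ≥0 × ℝ≥0) => F q.1 q.2.1 q.2.2)
    (hF0 : ∀ x v, F ⊤ x v = 0) (m : ℕ) :
    ∫⁻ s : ℝ≥0, ∫⁻ x, D.afterEvents α μ F 0 s x ∂η ∂lam
      = ∑ k ∈ Finset.range m, ∫⁻ x, D.afterEvents α μ F (k + 1) 0 x ∂ν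
        + ∫⁻ s : ℝ≥0, ∫⁻ x, D.afterEvents α μ F m s x ∂η ∂lam := by
  induction m with
  | zero => simp
  | succ m ih =>
    have h0 : ∀ x, D.afterEvents α μ F m ⊤ x = 0 := by
      intro x
      simp [Discipline.afterEvents, hF0]
    rw [ih, Finset.sum_range_succ, h _ (hD.afterEvents α hF m) h0, ← add_assoc]
    simp_rw [hD.afterEvents_succ α hF m]

/-- The remainder is nonnegative and is discarded; that it tends to zero is never needed. -/
theorem EventBalance.tsum_afterEvents_le (hD : D.IsMeasurable) (h : EventBalance D α μ ν η)
    {F : ℝ≥0∞ → S → ℝ≥0 × ℝ≥0 → ℝ≥0∞}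
    (hF : Measurable fun q : ℝ≥0∞ × S × (ℝ≥0 × ℝ≥0) => F q.1 q.2.1 q.2.2)
    (hF0 : ∀ x v, F ⊤ x v = 0) :
    ∑' k, ∫⁻ x, D.afterEvents α μ F (k + 1) 0 x ∂ν
      ≤ ∫⁻ s : ℝ≥0, ∫⁻ x, D.afterEvents α μ F 0 s x ∂η ∂lam := by
  rw [ENNReal.tsum_eq_iSup_nat]
  refine iSup_le fun m => ?_
  rw [h.sum_afterEvents α hD hF hF0 m]
  exact le_self_add

theorem IsMeasurable.lintegral_drivingLaw [SFinite ν] (hD : D.IsMeasurable)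
    {F : ℝ≥0∞ → S → ℝ≥0 × ℝ≥0 → ℝ≥0∞}
    (hF : Measurable fun q : ℝ≥0∞ × S × (ℝ≥0 × ℝ≥0) => F q.1 q.2.1 q.2.2) (k : ℕ) :
    ∫⁻ p, F (D.eventTime α p.1 p.2 k) (D.eventState α p.1 p.2 k) (p.2 k) ∂drivingLaw μ ν
      = ∫⁻ x, D.afterEvents α μ F k 0 x ∂ν := by
  have hm := (hD.afterEvents_integrand α hF k).comp
    (f := fun p : S × (ℕ → ℝ≥0 × ℝ≥0) => (((0 : ℝ≥0∞), p.1), p.2)) (by fun_prop)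
  simp only [Function.comp_def, zero_add] at hm
  rw [drivingLaw, lintegral_prod _ hm.aemeasurable]
  simp [Discipline.afterEvents]

/-- Borel–Cantelli: the expected number of events up to time `N` is at most `N` times the finite
mass of η. -/
theorem EventBalance.tendsto_eventTime [IsProbabilityMeasure ν] [IsFiniteMeasure η]
    (hD : D.IsMeasurable) (h : EventBalance D α μ ν η) :
    ∀ᵐ p ∂drivingLaw μ ν, Tendsto (D.eventTime α p.1 p.2) atTop (𝓝 ⊤) := by
  have key : ∀ N : ℕ, ∀ᵐ p ∂drivingLaw μ ν, ∀ᶠ k in atTop,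
      ¬ D.eventTime α p.1 p.2 (k + 1) ≤ (N : ℝ≥0) := by
    intro N
    refine ae_eventually_notMem (s := fun k =>
      {p : S × (ℕ → ℝ≥0 × ℝ≥0) | D.eventTime α p.1 p.2 (k + 1) ≤ (N : ℝ≥0)}) ?_
    have hF : Measurable fun q : ℝ≥0∞ × S × (ℝ≥0 × ℝ≥0) => leI q.1 (N : ℝ≥0) := by fun_prop
    have hle := h.tsum_afterEvents_le α hD (F := fun s _ _ => leI s (N : ℝ≥0)) hF
      fun _ _ => leI_of_lt ENNReal.coe_lt_top
    have hs : ∀ k, drivingLaw μ ν {p | D.eventTime α p.1 p.2 (k + 1) ≤ (N : ℝ≥0)}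
        = ∫⁻ x, D.afterEvents α μ (fun s _ _ => leI s (N : ℝ≥0)) (k + 1) 0 x ∂ν := by
      intro k
      rw [← hD.lintegral_drivingLaw α hF (k + 1), ← lintegral_indicator_one
        (measurableSet_le (hD.eventTime α (k + 1)) measurable_const)]
      congr 1
      ext p
      simp only [leI, Set.indicator, Set.mem_ofPred_eq, Pi.one_apply]
    simp_rw [hs]
    refine ne_top_of_le_ne_top ?_ hle
    simp_rw [IsMeasurable.afterEvents_zero (F := fun s _ _ => leI s (N : ℝ≥0)) α hF]
    simp only [lintegral_const, measure_univ, mul_one]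
    rw [lintegral_mul_const _ (by fun_prop)]
    refine ENNReal.mul_ne_top ?_ (measure_ne_top _ _)
    have : ∀ᵐ s ∂lam, leI (s : ℝ≥0) (N : ℝ≥0) = ltI (s : ℝ≥0) (N : ℝ≥0) := by
      have hne : ∀ᵐ y ∂lam, y ≠ (N : ℝ≥0) := by simp [ae_iff, measure_singleton]
      filter_upwards [hne] with s hs
      simp only [leI, ltI, ENNReal.coe_le_coe, ENNReal.coe_lt_coe]
      simp [le_iff_lt_or_eq, hs]
    rw [lintegral_congr_ae this, lintegral_lam_ltI]
    exact ENNReal.coe_ne_top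
  filter_upwards [ae_all_iff.2 key] with p hp
  refine ENNReal.tendsto_nhds_top fun N => ?_
  have := hp N
  rw [← eventually_map (m := fun k => k + 1) (P := fun k => ¬ D.eventTime α p.1 p.2 k ≤ (N : ℝ≥0)),
    map_add_atTop_eq_nat] at this
  filter_upwards [this] with k hk
  simpa using hk

/-- Only an upper bound on the law at time `t` has to be shown, since an inequality between two
probability measures is an equality. -/
theorem EventBalance.isStationary [IsProbabilityMeasure ν] [IsFiniteMeasure η]
    (hD : D.IsMeasurable) (h : EventBalance D α μ ν η) (h' : LastEventDecomposition D α μ ν η) :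
    IsStationary D α μ ν := by
  have hT := h.tendsto_eventTime α hD
  have : IsProbabilityMeasure (drivingLaw μ ν) := by unfold drivingLaw; infer_instance
  refine ⟨hT, fun t => ⟨(hD.state α t).aemeasurable, ?_⟩⟩
  have : IsProbabilityMeasure ((drivingLaw μ ν).map fun p => D.state α p.1 p.2 t) :=
    Measure.isProbabilityMeasure_map (hD.state α t).aemeasurable
  refine Measure.eq_of_le_of_measure_univ_eq (Measure.le_iff.2 fun A hA => ?_) (by simp)
  have hF := hD.noEventInd α t hA
  have hF0 : ∀ x v, D.noEventInd α t A ⊤ x v = 0 := by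
    intro x v
    rw [Discipline.noEventInd, leI_of_lt ENNReal.coe_lt_top, zero_mul, zero_mul]
  rw [Measure.map_apply (hD.state α t) hA]
  calc drivingLaw μ ν ((fun p => D.state α p.1 p.2 t) ⁻¹' A)
      = ∫⁻ p, A.indicator 1 (D.state α p.1 p.2 t) ∂drivingLaw μ ν := by
        rw [← lintegral_indicator_one (hD.state α t hA)]
        rfl
    _ ≤ ∫⁻ p, ∑' k, D.noEventInd α t A (D.eventTime α p.1 p.2 k) (D.eventState α p.1 p.2 k)
          (p.2 k) ∂drivingLaw μ ν := by
        -- The term of index `eventCount` equals the indicator of `A` at the current state; the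
        -- other terms need only be nonnegative.
        refine lintegral_mono_ae ?_
        filter_upwards [hT] with p hp
        obtain ⟨h1, h2⟩ := eventCount_spec α t hp
        refine le_trans (le_of_eq ?_) (ENNReal.le_tsum (D.eventCount α p.1 p.2 t))
        rw [Discipline.eventTime] at h2
        rw [Discipline.noEventInd, leI_of_le h1, ltI_of_lt h2, one_mul, one_mul]
        rfl
    _ = ∑' k, ∫⁻ x, D.afterEvents α μ (D.noEventInd α t A) k 0 x ∂ν := by
        rw [lintegral_tsum]
        · simp_rw [hD.lintegral_drivingLaw α hF]
        · intro k
          have hm := (hD.afterEvents_integrand α hF k).comp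
            (f := fun p : S × (ℕ → ℝ≥0 × ℝ≥0) => (((0 : ℝ≥0∞), p.1), p.2)) (by fun_prop)
          simp only [Function.comp_def, zero_add] at hm
          exact hm.aemeasurable
    _ = ∫⁻ x, D.afterEvents α μ (D.noEventInd α t A) 0 0 x ∂ν
        + ∑' k, ∫⁻ x, D.afterEvents α μ (D.noEventInd α t A) (k + 1) 0 x ∂ν :=
        tsum_eq_zero_add' ENNReal.summable
    _ ≤ ∫⁻ x, D.afterEvents α μ (D.noEventInd α t A) 0 0 x ∂ν
        + ∫⁻ s : ℝ≥0, ∫⁻ x, D.afterEvents α μ (D.noEventInd α t A) 0 s x ∂η ∂lam := by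
        gcongr
        exact h.tsum_afterEvents_le α hD hF hF0
    _ = ν A := by
        simp_rw [IsMeasurable.afterEvents_zero α hF]
        exact (h' t A hA).symm

end Discipline

end

/-! ### Conditioning on the next event: arrival or completion -/

section

instance : NullSingletonClass expUnit := by
  refine ⟨fun x => ?_⟩
  rw [← lintegral_indicator_one (measurableSet_singleton x),
    lintegral_expUnit (measurable_one.indicator (measurableSet_singleton x)),
    lintegral_eq_zero_iff']
  · have : ∀ᵐ y ∂lam, y ≠ x := by simp [ae_iff, measure_singleton]
    filter_upwards [this] with y hy
    simp [hy]
  · exact (measurable_expTail.mul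
      (measurable_one.indicator (measurableSet_singleton x))).aemeasurable

theorem leI_ae_eq_ltI (m : Measure ℝ≥0) [NullSingletonClass m] (t : ℝ≥0) :
    ∀ᵐ s : ℝ≥0 ∂m, leI s t = ltI s t := by
  have hne : ∀ᵐ y ∂m, y ≠ t := by simp [ae_iff, measure_singleton]
  filter_upwards [hne] with s hs
  simp only [leI, ltI, ENNReal.coe_le_coe, ENNReal.coe_lt_coe]
  simp [le_iff_lt_or_eq, hs]

/-- A clock of rate `a` rings before `c` or not. This is `average_exponential` for the constants 1
and 0, followed by a reflection of the interval. -/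
theorem expTail_add_lintegral (a c : ℝ≥0) :
    expTail (a * c) + ∫⁻ s : ℝ≥0, ltI s c * (a * expTail (a * (c - s))) ∂lam = 1 := by
  have h := average_exponential a (A := fun _ => 1) (B := fun _ => 0) (C := 1)
    measurable_const measurable_const (by simp) c
  rw [lintegral_lam_sub (f := fun s => a * expTail (a * s)) (by fun_prop)]
  conv_rhs => rw [h]
  simp only [mul_one, add_zero]
  congr 2
  ext s
  ring

namespace Discipline

variable {S : Type*} {D : Discipline S} (α : ℕ → ℝ≥0)

theorem lintegral_ltI_arrivalTime (x : S) (h : ℝ≥0) :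
    ∫⁻ e, ltI h (D.arrivalTime α x e) ∂expUnit = expTail (α (D.number x) * h) := by
  rcases eq_or_ne (α (D.number x)) 0 with ha | ha
  · simp [arrivalTime, ha, ltI_of_lt, expTail]
  · simp only [arrivalTime, ha, if_false]
    rw [← tail_expUnit, ← lintegral_ltI]
    congr 1
    ext e
    simp only [ltI, ENNReal.coe_lt_coe, lt_div_iff₀ (pos_iff_ne_zero.2 ha), mul_comm]

theorem lintegral_leI_arrivalTime (x : S) (h : ℝ≥0) :
    ∫⁻ e, leI h (D.arrivalTime α x e) ∂expUnit = expTail (α (D.number x) * h) := by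
  rw [← lintegral_ltI_arrivalTime]
  rcases eq_or_ne (α (D.number x)) 0 with ha | ha
  · simp [arrivalTime, ha, ltI_of_lt, leI_of_le]
  · simp only [arrivalTime, ha, if_false]
    have hne : ∀ᵐ y ∂expUnit, y ≠ α (D.number x) * h := by simp [ae_iff, measure_singleton]
    refine lintegral_congr_ae ?_
    filter_upwards [hne] with e he
    simp only [leI, ltI, ENNReal.coe_le_coe, ENNReal.coe_lt_coe]
    have : e / α (D.number x) ≠ h := by
      rintro rfl
      exact he (mul_div_cancel₀ e ha).symm
    simp [le_iff_lt_or_eq, this.symm]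

variable [MeasurableSpace S]

theorem IsMeasurable.arrivalTime_right (hD : D.IsMeasurable) (x : S) :
    Measurable fun e => D.arrivalTime α x e :=
  (hD.arrivalTime α).comp (measurable_prodMk_left (x := x))

/-- The completion time is determined by the state, so the only chance lies in the arrival clock,
which outlasts `t - s` with probability `expTail`. -/
theorem IsMeasurable.lintegral_noEventInd (hD : D.IsMeasurable) {μ : Measure ℝ≥0}
    [IsProbabilityMeasure μ] (t s : ℝ≥0) (A : Set S) (x : S) :
    ∫⁻ v, D.noEventInd α t A s x v ∂(expUnit.prod μ)
      = leI s t * (expTail (α (D.number x) * (t - s))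
        * (ltI (t - s : ℝ≥0) (D.completion x) * A.indicator 1 (D.serve (t - s) x))) := by
  have hm := hD.arrivalTime_right α x
  rcases lt_or_ge t s with hts | hts
  · simp [Discipline.noEventInd, leI_of_lt (ENNReal.coe_lt_coe.2 hts)]
  have key : ∀ v, D.noEventInd α t A s x v = (ltI (t - s : ℝ≥0) (D.completion x)
      * A.indicator 1 (D.serve (t - s) x)) * ltI (t - s : ℝ≥0) (D.arrivalTime α x v.1) := by
    intro v
    have h1 : ltI t (s + D.holdingTime α x v.1)
        = ltI (t - s : ℝ≥0) (D.holdingTime α x v.1) := by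
      simp only [ltI, ENNReal.coe_sub]
      congr 1
      rw [ENNReal.sub_lt_iff_lt_left ENNReal.coe_ne_top (ENNReal.coe_le_coe.2 hts)]
    rw [Discipline.noEventInd, leI_of_le (ENNReal.coe_le_coe.2 hts), h1, Discipline.holdingTime,
      ltI_min, ← ENNReal.coe_sub, ENNReal.toNNReal_coe]
    ring
  simp_rw [key]
  rw [lintegral_const_mul _ (by fun_prop), lintegral_prod _ (by fun_prop)]
  simp only [lintegral_const, measure_univ, mul_one]
  rw [lintegral_ltI_arrivalTime, leI_of_le (ENNReal.coe_le_coe.2 hts)]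
  ring

/-- The law of the state just after an arrival in a state with law `ρ`. -/
def arriveLaw (D : Discipline S) (μ : Measure ℝ≥0) (ρ : Measure S) : Measure S :=
  (μ.prod ρ).map fun p => D.arrive p.1 p.2

theorem IsMeasurable.lintegral_arriveLaw (hD : D.IsMeasurable) {μ : Measure ℝ≥0} {ρ : Measure S}
    [SFinite ρ] {f : S → ℝ≥0∞} (hf : Measurable f) :
    ∫⁻ y, f y ∂D.arriveLaw μ ρ = ∫⁻ w, ∫⁻ x, f (D.arrive w x) ∂ρ ∂μ := by
  rw [arriveLaw, lintegral_map hf hD.arrive, lintegral_prod]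
  exact (hf.comp hD.arrive).aemeasurable

theorem IsMeasurable.isProbabilityMeasure_arriveLaw (hD : D.IsMeasurable) (μ : Measure ℝ≥0)
    [IsProbabilityMeasure μ] (ρ : Measure S) [IsProbabilityMeasure ρ] :
    IsProbabilityMeasure (D.arriveLaw μ ρ) :=
  Measure.isProbabilityMeasure_map hD.arrive.aemeasurable

/-- The expected value of `Φ` just after an arrival at time `s` in state `x`. -/
def afterArrival (D : Discipline S) (μ : Measure ℝ≥0) (Φ : ℝ≥0∞ → S → ℝ≥0∞) (s : ℝ≥0∞) (x : S) :
    ℝ≥0∞ :=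
  ∫⁻ w, Φ s (D.arrive w x) ∂μ

/-- The value of `Φ` just after a completion, without arrivals, starting at time `s`
in state `x`. -/
def afterCompletion (D : Discipline S) (Φ : ℝ≥0∞ → S → ℝ≥0∞) (s : ℝ≥0∞) (x : S) : ℝ≥0∞ :=
  Φ (s + D.completion x) (D.depart (D.serve (D.completion x).toNNReal x))

theorem IsMeasurable.afterArrival (hD : D.IsMeasurable) {μ : Measure ℝ≥0} [SFinite μ]
    {Φ : ℝ≥0∞ → S → ℝ≥0∞} (hΦ : Measurable fun p : ℝ≥0∞ × S => Φ p.1 p.2) :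
    Measurable fun p : ℝ≥0∞ × S => D.afterArrival μ Φ p.1 p.2 := by
  have h : Measurable fun q : (ℝ≥0∞ × S) × ℝ≥0 => D.arrive q.2 q.1.2 :=
    hD.arrive.comp (f := fun q : (ℝ≥0∞ × S) × ℝ≥0 => (q.2, q.1.2)) (by fun_prop)
  exact (hΦ.comp (measurable_fst.fst.prodMk h)).lintegral_prod_right'

theorem IsMeasurable.afterCompletion (hD : D.IsMeasurable)
    {Φ : ℝ≥0∞ → S → ℝ≥0∞} (hΦ : Measurable fun p : ℝ≥0∞ × S => Φ p.1 p.2) :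
    Measurable fun p : ℝ≥0∞ × S => D.afterCompletion Φ p.1 p.2 := by
  have hc : Measurable fun q : ℝ≥0∞ × S => D.completion q.2 := hD.completion.comp measurable_snd
  exact hΦ.comp ((measurable_fst.add hc).prodMk
    (hD.depart.comp (hD.serve.comp (hc.ennreal_toNNReal.prodMk measurable_snd))))

theorem IsMeasurable.serve' (hD : D.IsMeasurable) {X : Type*} [MeasurableSpace X] {f : X → ℝ≥0}
    {g : X → S} (hf : Measurable f) (hg : Measurable g) :
    Measurable fun p => D.serve (f p) (g p) :=
  hD.serve.comp (hf.prodMk hg)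

/-- With a the arrival rate, the next event is an arrival at age h before the completion, with
density a exp(-a h), or the completion itself, if the clock outlasts it. -/
theorem IsMeasurable.step_eq (hD : D.IsMeasurable) {μ : Measure ℝ≥0} [IsProbabilityMeasure μ]
    {Φ : ℝ≥0∞ → S → ℝ≥0∞} (hΦ : Measurable fun p : ℝ≥0∞ × S => Φ p.1 p.2)
    (hΦ0 : ∀ x, Φ ⊤ x = 0) (s : ℝ≥0∞) (x : S) :
    D.step α μ Φ s x
      = ∫⁻ h : ℝ≥0, α (D.number x) * expTail (α (D.number x) * h)
          * (ltI h (D.completion x) * D.afterArrival μ Φ (s + h) (D.serve h x)) ∂lam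
        + expTail (α (D.number x) * (D.completion x).toNNReal) * D.afterCompletion Φ s x := by
  set a := α (D.number x) with ha
  have hm := hD.arrivalTime_right α x
  have hAA := hD.afterArrival (μ := μ) hΦ
  have key : ∀ v : ℝ≥0 × ℝ≥0, Φ (s + D.holdingTime α x v.1) (D.nextState α x v)
      = ltI (D.arrivalTime α x v.1) (D.completion x) * Φ (s + D.arrivalTime α x v.1)
          (D.arrive v.2 (D.serve (D.arrivalTime α x v.1).toNNReal x))
        + leI (D.completion x) (D.arrivalTime α x v.1) * D.afterCompletion Φ s x := by
    intro v
    rw [Discipline.nextState, Discipline.holdingTime]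
    split_ifs with h
    · rw [min_eq_right h, ltI_of_le h, leI_of_le h, zero_mul, zero_add, one_mul]
      rfl
    · rw [not_le] at h
      rw [min_eq_left h.le, ltI_of_lt h, leI_of_lt h, zero_mul, add_zero, one_mul]
  have hm2 : Measurable fun v : ℝ≥0 × ℝ≥0 =>
      D.arrive v.2 (D.serve (D.arrivalTime α x v.1).toNNReal x) :=
    hD.arrive.comp (measurable_snd.prodMk (hD.serve' (by fun_prop) measurable_const))
  have hm3 : Measurable fun v : ℝ≥0 × ℝ≥0 => Φ (s + D.arrivalTime α x v.1)
      (D.arrive v.2 (D.serve (D.arrivalTime α x v.1).toNNReal x)) :=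
    hΦ.comp (Measurable.prodMk (by fun_prop) hm2)
  simp_rw [step, key]
  rw [lintegral_add_left (by fun_prop)]
  congr 1
  · rw [lintegral_prod _ (by fun_prop)]
    have h1 : ∀ e : ℝ≥0, ∫⁻ w, ltI (D.arrivalTime α x e) (D.completion x)
        * Φ (s + D.arrivalTime α x e) (D.arrive w (D.serve (D.arrivalTime α x e).toNNReal x)) ∂μ
        = ltI (D.arrivalTime α x e) (D.completion x) * D.afterArrival μ Φ
          (s + D.arrivalTime α x e) (D.serve (D.arrivalTime α x e).toNNReal x) := by
      intro e
      rw [lintegral_const_mul]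
      · rfl
      · exact hm3.comp (measurable_prodMk_left (x := e))
    simp_rw [h1]
    rcases eq_or_ne a 0 with h0 | h0
    · have : ∀ e, D.arrivalTime α x e = ⊤ := fun e => by
        rw [Discipline.arrivalTime, ← ha, if_pos h0]
      simp [this, ltI_of_le, h0]
    · have : ∀ e, D.arrivalTime α x e = (e / a : ℝ≥0) := fun e => by
        rw [Discipline.arrivalTime, ← ha, if_neg h0]
      simp_rw [this, ENNReal.toNNReal_coe]
      have hm4 : Measurable fun h : ℝ≥0 => D.afterArrival μ Φ (s + h) (D.serve h x) :=
        hAA.comp (Measurable.prodMk (by fun_prop) (hD.serve' measurable_id measurable_const))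
      exact lintegral_expUnit_div (f := fun h : ℝ≥0 => ltI h (D.completion x)
        * D.afterArrival μ Φ (s + h) (D.serve h x)) (by fun_prop) h0
  · rw [lintegral_mul_const _ (by fun_prop), lintegral_prod _ (by fun_prop)]
    simp only [lintegral_const, measure_univ, mul_one]
    -- Without a completion, `toNNReal` takes the default value 0 and the exponential factor is
    -- meaningless; `Φ` vanishes at `⊤`.
    rcases eq_or_ne (D.completion x) ⊤ with h | h
    · simp [Discipline.afterCompletion, h, hΦ0]
    · lift D.completion x to ℝ≥0 using h with c
      rw [lintegral_leI_arrivalTime, ← ha, ENNReal.toNNReal_coe]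

end Discipline

end

/-! ### Balance at a fixed number of individuals -/

section

namespace Discipline

variable {S : Type*} [MeasurableSpace S] {D : Discipline S}

/-- Balance properties, in the absence of arrivals during service, of a family of laws `ρ n` for
the state when `n` individuals are present: the arrivals in states with law `ρ (n - 1)`, at rate
`β n`, compensate for the service of a state with law `ρ n`, and the completions then occur
at rate `β n`, leaving a state with law `ρ (n - 1)`. -/
structure LevelBalance (D : Discipline S) (β : ℕ → ℝ≥0) (μ : Measure ℝ≥0) (ρ : ℕ → Measure S) :
    Prop where
  number_ae : ∀ n, ∀ᵐ x ∂ρ n, D.number x = n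
  number_arrive : ∀ w x, D.number (D.arrive w x) = D.number x + 1
  depart_arrive_zero : ∀ n, ∀ᵐ x ∂ρ n, D.depart (D.arrive 0 x) = x
  completion_serve : ∀ (t : ℝ≥0) x, (t : ℝ≥0∞) < D.completion x →
    D.completion (D.serve t x) = D.completion x - t
  serve_serve : ∀ (t : ℝ≥0) x, (t : ℝ≥0∞) < D.completion x → D.completion x ≠ ⊤ →
    D.serve ((D.completion x).toNNReal - t) (D.serve t x) = D.serve (D.completion x).toNNReal x
  service : ∀ n (f : S → ℝ≥0∞), Measurable f → ∀ t : ℝ≥0,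
    ∫⁻ x, f x ∂ρ n = ∫⁻ x, ltI t (D.completion x) * f (D.serve t x) ∂ρ n
      + ∫⁻ s : ℝ≥0, ltI s t * (β n * ∫⁻ x, ltI s (D.completion x) * f (D.serve s x)
          ∂D.arriveLaw μ (ρ (n - 1))) ∂lam
  completions : ∀ n (g : ℝ≥0∞ → S → ℝ≥0∞), Measurable (fun p : ℝ≥0∞ × S => g p.1 p.2) →
    (∀ x, g ⊤ x = 0) →
    ∫⁻ x, g (D.completion x) (D.serve (D.completion x).toNNReal x) ∂ρ n
      + β n * ∫⁻ s : ℝ≥0, ∫⁻ x, g (s + D.completion x) (D.serve (D.completion x).toNNReal x)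
          ∂D.arriveLaw μ (ρ (n - 1)) ∂lam
      = β n * ∫⁻ s : ℝ≥0, ∫⁻ x, g s (D.arrive 0 x) ∂ρ (n - 1) ∂lam

variable {β : ℕ → ℝ≥0} {μ : Measure ℝ≥0} {ρ : ℕ → Measure S}

/-- The intensity of the states just after arrivals and departures, relative to the
probability that `n` individuals are present, where the departures counted are those
from which `n` individuals remain, and the arrivals those after which `n` are present. -/
def eventLaw (D : Discipline S) (α β : ℕ → ℝ≥0) (μ : Measure ℝ≥0) (ρ : ℕ → Measure S) (n : ℕ) :
    Measure S :=
  α n • ρ n + β n • D.arriveLaw μ (ρ (n - 1))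

variable (α : ℕ → ℝ≥0)

theorem lintegral_eventLaw (n : ℕ) (f : S → ℝ≥0∞) :
    ∫⁻ x, f x ∂D.eventLaw α β μ ρ n
      = α n * ∫⁻ x, f x ∂ρ n + β n * ∫⁻ x, f x ∂D.arriveLaw μ (ρ (n - 1)) := by
  rw [eventLaw, lintegral_add_measure, lintegral_smul_measure, lintegral_smul_measure]
  rfl

theorem IsMeasurable.number_arriveLaw [SFinite μ] (hD : D.IsMeasurable)
    (harr : ∀ w x, D.number (D.arrive w x) = D.number x + 1) {m : Measure S} [SFinite m] {n : ℕ}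
    (hm : ∀ᵐ x ∂m, D.number x = n) : ∀ᵐ x ∂D.arriveLaw μ m, D.number x = n + 1 := by
  have hs : MeasurableSet {x | D.number x = n + 1} := hD.number (measurableSet_singleton (n + 1))
  rw [arriveLaw, ae_map_iff hD.arrive.aemeasurable hs]
  filter_upwards [(Measure.quasiMeasurePreserving_snd (μ := μ) (ν := m)).ae hm] with p hp
  rw [harr, hp]

/-- A state reached at time `s` after service for a time `u` has the completion, in time and in
state, of the original state started at `s - u`. -/
theorem LevelBalance.afterCompletion_serve (h : LevelBalance D β μ ρ) (a : ℝ≥0)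
    {Φ : ℝ≥0∞ → S → ℝ≥0∞} (hΦ0 : ∀ x, Φ ⊤ x = 0) {s u : ℝ≥0} (hus : u ≤ s) {x : S}
    (hu : (u : ℝ≥0∞) < D.completion x) :
    expTail (a * (D.completion (D.serve u x)).toNNReal) * D.afterCompletion Φ s (D.serve u x)
      = expTail (a * ((D.completion x).toNNReal - u)) * D.afterCompletion Φ (s - u : ℝ≥0) x := by
  have h1 := h.completion_serve u x hu
  have h2 := h.serve_serve u x hu
  simp only [Discipline.afterCompletion, h1]
  generalize D.completion x = c at *
  rcases eq_or_ne c ⊤ with rfl | hc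
  · simp [hΦ0]
  · lift c to ℝ≥0 using hc
    have huc : u ≤ c := by exact_mod_cast hu.le
    rw [← ENNReal.coe_sub, ENNReal.toNNReal_coe, ENNReal.toNNReal_coe,
      ← ENNReal.coe_add, ← ENNReal.coe_add, tsub_add_eq_add_tsub hus, add_tsub_assoc_of_le huc]
    have h3 := h2 ENNReal.coe_ne_top
    rw [ENNReal.toNNReal_coe] at h3
    rw [h3]

variable [IsProbabilityMeasure μ] [∀ n, IsProbabilityMeasure (ρ n)]

theorem IsMeasurable.isFiniteMeasure_eventLaw (hD : D.IsMeasurable) (n : ℕ) :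
    IsFiniteMeasure (D.eventLaw α β μ ρ n) := by
  have := hD.isProbabilityMeasure_arriveLaw μ (ρ (n - 1))
  unfold eventLaw
  infer_instance

/-- The identity `service` is averaged over an exponential time of rate `α n`. Arrivals remove
states from level `n` at that rate, and the part `α n • ρ n` of `eventLaw`, produced as the term `a
* A s` of `average_exponential`, restores them. -/
theorem LevelBalance.service_arrivals (hD : D.IsMeasurable) (h : LevelBalance D β μ ρ) (n : ℕ)
    {f : S → ℝ≥0∞} (hf : Measurable f) (t : ℝ≥0) :
    ∫⁻ x, f x ∂ρ n
      = expTail (α n * t) * ∫⁻ x, ltI t (D.completion x) * f (D.serve t x) ∂ρ n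
        + ∫⁻ s : ℝ≥0, ltI s t * (expTail (α n * s) *
          ∫⁻ x, ltI s (D.completion x) * f (D.serve s x) ∂D.eventLaw α β μ ρ n) ∂lam := by
  have := hD.isProbabilityMeasure_arriveLaw μ (ρ (n - 1))
  have hm : Measurable fun p : ℝ≥0 × S => ltI p.1 (D.completion p.2) * f (D.serve p.1 p.2) := by
    have := hD.completion
    exact Measurable.mul (by fun_prop) (hf.comp hD.serve)
  simp_rw [lintegral_eventLaw]
  exact average_exponential (α n)
    (A := fun t => ∫⁻ x, ltI t (D.completion x) * f (D.serve t x) ∂ρ n)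
    (B := fun s => β n * ∫⁻ x, ltI s (D.completion x) * f (D.serve s x)
      ∂D.arriveLaw μ (ρ (n - 1))) hm.lintegral_prod_right'
    (hm.lintegral_prod_right'.const_mul _) (h.service n f hf) t

/-- For a fixed time t of the arrival, `service_arrivals` says that the states coming from time 0
and from the events before t add up to `ρ n`; arrivals see them at rate `α n`. -/
theorem LevelBalance.arrivals (hD : D.IsMeasurable) (h : LevelBalance D β μ ρ) (n : ℕ)
    {Ψ : ℝ≥0∞ → S → ℝ≥0∞} (hΨ : Measurable fun p : ℝ≥0∞ × S => Ψ p.1 p.2) :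
    ∫⁻ x, ∫⁻ h : ℝ≥0, α n * expTail (α n * h)
          * (ltI h (D.completion x) * Ψ h (D.serve h x)) ∂lam ∂ρ n
      + ∫⁻ s : ℝ≥0, ∫⁻ x, ∫⁻ h : ℝ≥0, α n * expTail (α n * h)
          * (ltI h (D.completion x) * Ψ (s + h) (D.serve h x)) ∂lam ∂D.eventLaw α β μ ρ n ∂lam
      = α n * ∫⁻ t : ℝ≥0, ∫⁻ x, Ψ t x ∂ρ n ∂lam := by
  have := hD.isFiniteMeasure_eventLaw (μ := μ) (ρ := ρ) (β := β) α n
  have hm : Measurable fun p : (ℝ≥0 × ℝ≥0) × S =>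
      ltI p.1.2 (D.completion p.2) * Ψ p.1.1 (D.serve p.1.2 p.2) := by
    have h1 := hD.completion
    have h2 : Measurable fun p : (ℝ≥0 × ℝ≥0) × S => D.serve p.1.2 p.2 :=
      hD.serve' (by fun_prop) (by fun_prop)
    exact Measurable.mul (by fun_prop) (hΨ.comp (measurable_fst.fst.coe_nnreal_ennreal.prodMk h2))
  have e1 : ∫⁻ x, ∫⁻ h : ℝ≥0, α n * expTail (α n * h)
          * (ltI h (D.completion x) * Ψ h (D.serve h x)) ∂lam ∂ρ n
      = ∫⁻ t : ℝ≥0, α n * expTail (α n * t)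
          * ∫⁻ x, ltI t (D.completion x) * Ψ t (D.serve t x) ∂ρ n ∂lam := by
    rw [lintegral_lintegral_swap]
    · congr 1
      ext t
      rw [lintegral_const_mul]
      exact hm.comp (measurable_prodMk_left (x := (t, t)))
    · have := hm.comp (f := fun p : S × ℝ≥0 => ((p.2, p.2), p.1)) (by fun_prop)
      simp only [Function.comp_def] at this
      exact Measurable.aemeasurable (by unfold Function.uncurry; fun_prop)
  -- The pair (time of the last event, age) is replaced by (time of the arrival, age).
  have e2 : ∫⁻ s : ℝ≥0, ∫⁻ x, ∫⁻ h : ℝ≥0, α n * expTail (α n * h)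
          * (ltI h (D.completion x) * Ψ (s + h) (D.serve h x)) ∂lam ∂D.eventLaw α β μ ρ n ∂lam
      = ∫⁻ t : ℝ≥0, ∫⁻ s : ℝ≥0, ltI s t * (α n * expTail (α n * s)
          * ∫⁻ x, ltI s (D.completion x) * Ψ t (D.serve s x) ∂D.eventLaw α β μ ρ n) ∂lam ∂lam := by
    rw [← lintegral_lam_lam_add (F := fun t s => α n * expTail (α n * s)
          * ∫⁻ x, ltI s (D.completion x) * Ψ t (D.serve s x) ∂D.eventLaw α β μ ρ n)]
    · congr 1
      ext s
      rw [lintegral_lintegral_swap]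
      · congr 1
        ext t
        rw [lintegral_const_mul, ENNReal.coe_add]
        exact hm.comp (measurable_prodMk_left (x := (s + t, t)))
      · have := hm.comp (f := fun p : S × ℝ≥0 => ((s + p.2, p.2), p.1)) (by fun_prop)
        simp only [Function.comp_def, ENNReal.coe_add] at this
        exact Measurable.aemeasurable (by unfold Function.uncurry; fun_prop)
    · have := hm.lintegral_prod_right' (ν := D.eventLaw α β μ ρ n)
      unfold Function.uncurry
      fun_prop
  have hm1 : Measurable fun t : ℝ≥0 => ∫⁻ x, ltI t (D.completion x) * Ψ t (D.serve t x) ∂ρ n :=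
    (hm.comp (f := fun p : ℝ≥0 × S => ((p.1, p.1), p.2)) (by fun_prop)).lintegral_prod_right'
  have hm2 : Measurable fun t : ℝ≥0 => ∫⁻ x, Ψ t x ∂ρ n :=
    (hΨ.comp (f := fun p : ℝ≥0 × S => ((p.1 : ℝ≥0∞), p.2)) (by fun_prop)).lintegral_prod_right'
  rw [e1, e2, ← lintegral_add_left (by fun_prop), ← lintegral_const_mul _ hm2]
  congr 1
  ext t
  have hf : Measurable fun x => Ψ t x := hΨ.comp (measurable_prodMk_left (x := (t : ℝ≥0∞)))
  have hm3 : Measurable fun s : ℝ≥0 =>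
      ∫⁻ x, ltI s (D.completion x) * Ψ t (D.serve s x) ∂D.eventLaw α β μ ρ n :=
    (hm.lintegral_prod_right' (ν := D.eventLaw α β μ ρ n)).comp (measurable_prodMk_left (x := t))
  rw [h.service_arrivals α hD n hf t, mul_add, mul_assoc, ← lintegral_const_mul (α n : ℝ≥0∞)
    (f := fun s : ℝ≥0 => ltI s t * (expTail (α n * s) *
      ∫⁻ x, ltI s (D.completion x) * Ψ t (D.serve s x) ∂D.eventLaw α β μ ρ n)) (by fun_prop)]
  congr 2
  ext s
  ring

/-- Arrivals cancel out. The part `α n • ρ n` of `eventLaw` restarts states at rate a = `α n`, and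
`service` traces each of them back to an earlier state with completion time C, at an age u < C. The
contributions a exp(-a (C - u)), integrated over u, and the contribution exp(-a C) of the absence of
arrivals add up to 1. What remains is `completions`. -/
theorem LevelBalance.departures (hD : D.IsMeasurable) (h : LevelBalance D β μ ρ) (n : ℕ)
    {Φ : ℝ≥0∞ → S → ℝ≥0∞} (hΦ : Measurable fun p : ℝ≥0∞ × S => Φ p.1 p.2)
    (hΦ0 : ∀ x, Φ ⊤ x = 0) :
    ∫⁻ x, expTail (α n * (D.completion x).toNNReal) * D.afterCompletion Φ 0 x ∂ρ n
      + ∫⁻ s : ℝ≥0, ∫⁻ x, expTail (α n * (D.completion x).toNNReal) * D.afterCompletion Φ s x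
        ∂D.eventLaw α β μ ρ n ∂lam
      = β n * ∫⁻ t : ℝ≥0, ∫⁻ x, Φ t x ∂ρ (n - 1) ∂lam := by
  have := hD.isProbabilityMeasure_arriveLaw μ (ρ (n - 1))
  set σ := D.arriveLaw μ (ρ (n - 1)) with hσ
  set a := α n
  have hc := hD.completion
  have hΓ : Measurable fun p : ℝ≥0 × S => D.afterCompletion Φ p.1 p.2 :=
    (hD.afterCompletion hΦ).comp (f := fun p : ℝ≥0 × S => ((p.1 : ℝ≥0∞), p.2)) (by fun_prop)
  have hΓ' : ∀ s : ℝ≥0∞, Measurable fun x => D.afterCompletion Φ s x := fun s =>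
    (hD.afterCompletion hΦ).comp (measurable_prodMk_left (x := s))
  -- The state `x` is started at time `v`, restarted at age `u` before its completion, and then
  -- completes without any further arrival.
  let W : ℝ≥0 → ℝ≥0 → S → ℝ≥0∞ := fun u v x => ltI u (D.completion x)
    * (a * expTail (a * ((D.completion x).toNNReal - u))) * D.afterCompletion Φ v x
  have hW : Measurable fun p : (ℝ≥0 × ℝ≥0) × S => W p.1.1 p.1.2 p.2 :=
    Measurable.mul (by fun_prop)
      (hΓ.comp (f := fun p : (ℝ≥0 × ℝ≥0) × S => (p.1.2, p.2)) (by fun_prop))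
  have hWW : ∀ m : Measure S, SFinite m → Measurable fun p : ℝ≥0 × ℝ≥0 => ∫⁻ x, W p.1 p.2 x ∂m :=
    fun m _ => hW.lintegral_prod_right'
  have hq : ∀ (v : ℝ≥0) x, ∫⁻ u, W u v x ∂lam
      + expTail (a * (D.completion x).toNNReal) * D.afterCompletion Φ v x
        = D.afterCompletion Φ v x := by
    intro v x
    rw [lintegral_mul_const _ (by fun_prop), ← add_mul]
    rcases eq_or_ne (D.completion x) ⊤ with h1 | h1
    · simp [Discipline.afterCompletion, h1, hΦ0]
    · lift D.completion x to ℝ≥0 using h1 with c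
      rw [ENNReal.toNNReal_coe, add_comm, expTail_add_lintegral, one_mul]
  -- A state restarted at time `s` comes from time 0, with age `s`, or from an arrival at time `s -
  -- u`, with age `u`.
  have key : ∀ s : ℝ≥0, a * ∫⁻ x, expTail (a * (D.completion x).toNNReal)
        * D.afterCompletion Φ s x ∂ρ n
      = ∫⁻ x, W s 0 x ∂ρ n + ∫⁻ u : ℝ≥0, ltI u s * (β n * ∫⁻ x, W u (s - u) x ∂σ) ∂lam := by
    intro s
    have hE : Measurable fun x =>
        expTail (a * (D.completion x).toNNReal) * D.afterCompletion Φ s x :=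
      Measurable.mul (by fun_prop) (hΓ' s)
    rw [← lintegral_const_mul _ hE, h.service n _ (hE.const_mul _) s]
    congr 1
    · congr 1
      ext x
      simp only [W]
      rw [mul_assoc]
      refine ltI_mul_congr fun hs => ?_
      rw [h.afterCompletion_serve a hΦ0 le_rfl hs, tsub_self, mul_assoc]
    · congr 1
      ext u
      refine ltI_mul_congr fun hu => ?_
      congr 2
      ext x
      simp only [W]
      rw [mul_assoc]
      refine ltI_mul_congr fun hs => ?_
      rw [h.afterCompletion_serve a hΦ0 (ENNReal.coe_le_coe.1 hu.le) hs, mul_assoc]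
  have hE : Measurable fun p : ℝ≥0 × S =>
      expTail (a * (D.completion p.2).toNNReal) * D.afterCompletion Φ p.1 p.2 :=
    Measurable.mul (by fun_prop) hΓ
  have hWρ := hWW (ρ n) inferInstance
  have hWσ := hWW σ inferInstance
  have star : ∫⁻ s : ℝ≥0, a * ∫⁻ x, expTail (a * (D.completion x).toNNReal)
        * D.afterCompletion Φ s x ∂ρ n ∂lam
      = ∫⁻ x, ∫⁻ u, W u 0 x ∂lam ∂ρ n + β n * ∫⁻ v, ∫⁻ x, ∫⁻ u, W u v x ∂lam ∂σ ∂lam := by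
    simp_rw [key]
    rw [lintegral_add_left (by fun_prop)]
    congr 1
    · rw [lintegral_lintegral_swap]
      exact (hW.comp (f := fun p : ℝ≥0 × S => ((p.1, 0), p.2)) (by fun_prop)).aemeasurable
    · rw [← lintegral_lam_lam_add (F := fun s u => β n * ∫⁻ x, W u (s - u) x ∂σ)]
      · rw [← lintegral_const_mul]
        · congr 1
          ext v
          rw [lintegral_lintegral_swap (μ := σ), ← lintegral_const_mul]
          · simp_rw [add_tsub_cancel_right]
          · exact hWσ.comp (measurable_prodMk_right (y := v))
          · exact (hW.comp (f := fun p : S × ℝ≥0 => ((p.2, v), p.1)) (by fun_prop)).aemeasurable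
        · have h1 : Measurable fun q : ℝ≥0 × S => ∫⁻ u, W u q.1 q.2 ∂lam :=
            (hW.comp (f := fun p : (ℝ≥0 × S) × ℝ≥0 => ((p.2, p.1.1), p.1.2))
              (by fun_prop)).lintegral_prod_right'
          exact h1.lintegral_prod_right'
      · exact (hWσ.comp (f := fun p : ℝ≥0 × ℝ≥0 => (p.2, p.1 - p.2)) (by fun_prop)).const_mul _
  have hEρ : Measurable fun s : ℝ≥0 => ∫⁻ x, expTail (a * (D.completion x).toNNReal)
      * D.afterCompletion Φ s x ∂ρ n := hE.lintegral_prod_right'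
  have hEσ : Measurable fun s : ℝ≥0 => ∫⁻ x, expTail (a * (D.completion x).toNNReal)
      * D.afterCompletion Φ s x ∂σ := hE.lintegral_prod_right'
  have hq1 : Measurable fun q : ℝ≥0 × S => ∫⁻ u, W u q.1 q.2 ∂lam :=
    (hW.comp (f := fun p : (ℝ≥0 × S) × ℝ≥0 => ((p.2, p.1.1), p.1.2))
      (by fun_prop)).lintegral_prod_right'
  have hqσ : Measurable fun s : ℝ≥0 => ∫⁻ x, ∫⁻ u, W u s x ∂lam ∂σ := hq1.lintegral_prod_right'
  have hqv : ∀ v, Measurable fun x => ∫⁻ u, W u v x ∂lam := fun v =>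
    hq1.comp (measurable_prodMk_left (x := v))
  -- The test function includes the removal of the completed individual, which by
  -- `depart_arrive_zero` leaves the law `ρ (n - 1)`.
  have hcomp := h.completions n (fun s x => Φ s (D.depart x))
    (hΦ.comp (measurable_fst.prodMk (hD.depart.comp measurable_snd))) (fun x => hΦ0 _)
  have hdep : ∀ s : ℝ≥0, ∫⁻ x, Φ s (D.depart (D.arrive 0 x)) ∂ρ (n - 1)
      = ∫⁻ x, Φ s x ∂ρ (n - 1) := by
    intro s
    refine lintegral_congr_ae ?_
    filter_upwards [h.depart_arrive_zero (n - 1)] with x hx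
    rw [hx]
  simp_rw [hdep] at hcomp
  rw [← hcomp]
  simp_rw [lintegral_eventLaw]
  rw [lintegral_add_left (by fun_prop), star]
  have hρ : ∫⁻ x, ∫⁻ u, W u 0 x ∂lam ∂ρ n
      + ∫⁻ x, expTail (a * (D.completion x).toNNReal) * D.afterCompletion Φ 0 x ∂ρ n
      = ∫⁻ x, D.afterCompletion Φ 0 x ∂ρ n := by
    rw [← lintegral_add_left (hqv 0)]
    congr 1
    ext x
    exact hq 0 x
  have hσ' : ∫⁻ v : ℝ≥0, ∫⁻ x, ∫⁻ u, W u v x ∂lam ∂σ ∂lam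
      + ∫⁻ v : ℝ≥0, ∫⁻ x, expTail (a * (D.completion x).toNNReal) * D.afterCompletion Φ v x ∂σ ∂lam
      = ∫⁻ v : ℝ≥0, ∫⁻ x, D.afterCompletion Φ v x ∂σ ∂lam := by
    rw [← lintegral_add_left hqσ]
    congr 1
    ext v
    rw [← lintegral_add_left (hqv v)]
    congr 1
    ext x
    exact hq v x
  have hρ0 : ∫⁻ x, Φ (D.completion x) (D.depart (D.serve (D.completion x).toNNReal x)) ∂ρ n
      = ∫⁻ x, D.afterCompletion Φ 0 x ∂ρ n := by
    simp [Discipline.afterCompletion]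
  rw [hρ0, ← hρ]
  change _ = _ + β n * ∫⁻ v : ℝ≥0, ∫⁻ x, D.afterCompletion Φ v x ∂σ ∂lam
  rw [← hσ', lintegral_const_mul _ hEσ]
  ring

end Discipline

end

/-! ### Summation over the number of individuals -/

section

namespace Discipline

variable {S : Type*} [MeasurableSpace S] {D : Discipline S} {β : ℕ → ℝ≥0} {μ : Measure ℝ≥0}
  {ρ : ℕ → Measure S} (α : ℕ → ℝ≥0)

/-- A shift of index. The term of index 0, where `n - 1` truncates to 0, vanishes with `β 0`. -/
theorem tsum_balance {π : ℕ → ℝ≥0∞} (hβ : β 0 = 0)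
    (hbal : ∀ n, π (n + 1) * (β (n + 1) : ℝ≥0∞) = π n * (α n : ℝ≥0∞)) (Z : ℕ → ℝ≥0∞) :
    ∑' n, π n * (β n * Z (n - 1)) = ∑' n, π n * (α n * Z n) := by
  rw [tsum_eq_zero_add' ENNReal.summable]
  simp [hβ, ← mul_assoc, hbal]

variable [IsProbabilityMeasure μ] [∀ n, IsProbabilityMeasure (ρ n)]

theorem LevelBalance.number_eventLaw (hD : D.IsMeasurable) (h : LevelBalance D β μ ρ)
    (hβ : β 0 = 0) (n : ℕ) : ∀ᵐ x ∂D.eventLaw α β μ ρ n, D.number x = n := by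
  rw [eventLaw, ae_add_measure_iff]
  refine ⟨Measure.ae_smul_measure (h.number_ae n) _, ?_⟩
  cases n with
  | zero => simp [hβ]
  | succ n => exact Measure.ae_smul_measure (hD.number_arriveLaw h.number_arrive (h.number_ae n)) _

theorem IsMeasurable.step (hD : D.IsMeasurable)
    {Φ : ℝ≥0∞ → S → ℝ≥0∞} (hΦ : Measurable fun p : ℝ≥0∞ × S => Φ p.1 p.2) :
    Measurable fun p : ℝ≥0∞ × S => D.step α μ Φ p.1 p.2 := by
  have h1 : Measurable fun q : (ℝ≥0∞ × S) × (ℝ≥0 × ℝ≥0) => D.holdingTime α q.1.2 q.2.1 :=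
    (hD.holdingTime α).comp (f := fun q : (ℝ≥0∞ × S) × (ℝ≥0 × ℝ≥0) => (q.1.2, q.2.1))
      (by fun_prop)
  have h2 : Measurable fun q : (ℝ≥0∞ × S) × (ℝ≥0 × ℝ≥0) => D.nextState α q.1.2 q.2 :=
    (hD.nextState α).comp (f := fun q : (ℝ≥0∞ × S) × (ℝ≥0 × ℝ≥0) => (q.1.2, q.2))
      (by fun_prop)
  exact (hΦ.comp ((measurable_fst.fst.add h1).prodMk h2)).lintegral_prod_right'

theorem IsMeasurable.lintegral_step (hD : D.IsMeasurable) {n : ℕ} {m : Measure S} [SFinite m]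
    (hm : ∀ᵐ x ∂m, D.number x = n)
    {Φ : ℝ≥0∞ → S → ℝ≥0∞} (hΦ : Measurable fun p : ℝ≥0∞ × S => Φ p.1 p.2)
    (hΦ0 : ∀ x, Φ ⊤ x = 0) (s : ℝ≥0∞) :
    ∫⁻ x, D.step α μ Φ s x ∂m
      = ∫⁻ x, ∫⁻ h : ℝ≥0, α n * expTail (α n * h)
          * (ltI h (D.completion x) * D.afterArrival μ Φ (s + h) (D.serve h x)) ∂lam ∂m
        + ∫⁻ x, expTail (α n * (D.completion x).toNNReal) * D.afterCompletion Φ s x ∂m := by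
  have hc := hD.completion
  have h1 : Measurable fun x =>
      expTail (α n * (D.completion x).toNNReal) * D.afterCompletion Φ s x :=
    Measurable.mul (by fun_prop)
      ((hD.afterCompletion hΦ).comp (measurable_prodMk_left (x := s)))
  rw [← lintegral_add_right _ h1]
  refine lintegral_congr_ae ?_
  filter_upwards [hm] with x hx
  rw [hD.step_eq α hΦ hΦ0, hx]

theorem LevelBalance.step_balance (hD : D.IsMeasurable) (h : LevelBalance D β μ ρ)
    (hβ : β 0 = 0) (n : ℕ)
    {Φ : ℝ≥0∞ → S → ℝ≥0∞} (hΦ : Measurable fun p : ℝ≥0∞ × S => Φ p.1 p.2)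
    (hΦ0 : ∀ x, Φ ⊤ x = 0) :
    ∫⁻ x, D.step α μ Φ 0 x ∂ρ n
      + ∫⁻ s : ℝ≥0, ∫⁻ x, D.step α μ Φ s x ∂D.eventLaw α β μ ρ n ∂lam
      = α n * ∫⁻ s : ℝ≥0, ∫⁻ x, Φ s x ∂D.arriveLaw μ (ρ n) ∂lam
        + β n * ∫⁻ s : ℝ≥0, ∫⁻ x, Φ s x ∂ρ (n - 1) ∂lam := by
  have := hD.isFiniteMeasure_eventLaw (μ := μ) (ρ := ρ) (β := β) α n
  have hc := hD.completion
  have hΨ := hD.afterArrival (μ := μ) hΦ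
  have hm : Measurable fun p : ℝ≥0 × S =>
      expTail (α n * (D.completion p.2).toNNReal) * D.afterCompletion Φ p.1 p.2 :=
    Measurable.mul (by fun_prop) ((hD.afterCompletion hΦ).comp
      (f := fun p : ℝ≥0 × S => ((p.1 : ℝ≥0∞), p.2)) (by fun_prop))
  have harr : ∫⁻ s : ℝ≥0, ∫⁻ x, Φ s x ∂D.arriveLaw μ (ρ n) ∂lam
      = ∫⁻ s : ℝ≥0, ∫⁻ x, D.afterArrival μ Φ s x ∂ρ n ∂lam := by
    congr 1
    ext s
    have hs : Measurable fun x => Φ s x := hΦ.comp (measurable_prodMk_left (x := (s : ℝ≥0∞)))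
    rw [hD.lintegral_arriveLaw hs, lintegral_lintegral_swap]
    · rfl
    · exact (hs.comp hD.arrive).aemeasurable
  simp_rw [hD.lintegral_step α (h.number_eventLaw α hD hβ n) hΦ hΦ0,
    hD.lintegral_step α (h.number_ae n) hΦ hΦ0]
  rw [lintegral_add_right _ hm.lintegral_prod_right', harr, ← h.arrivals α hD n hΨ,
    ← h.departures α hD n hΦ hΦ0]
  simp only [zero_add]
  ring

/-- This is `service_arrivals` for the indicator of `A`, with the age of the state replaced by the
time `t - s` elapsed since the last event. -/
theorem LevelBalance.lastEvent (hD : D.IsMeasurable) (h : LevelBalance D β μ ρ)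
    (hβ : β 0 = 0) (n : ℕ) (t : ℝ≥0) {A : Set S} (hA : MeasurableSet A) :
    ρ n A = ∫⁻ x, ∫⁻ v, D.noEventInd α t A 0 x v ∂(expUnit.prod μ) ∂ρ n
      + ∫⁻ s : ℝ≥0, ∫⁻ x, ∫⁻ v, D.noEventInd α t A s x v ∂(expUnit.prod μ)
        ∂D.eventLaw α β μ ρ n ∂lam := by
  have := hD.isFiniteMeasure_eventLaw (μ := μ) (ρ := ρ) (β := β) α n
  have hf : Measurable (A.indicator (1 : S → ℝ≥0∞)) := measurable_one.indicator hA
  have hm : Measurable fun p : ℝ≥0 × S =>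
      ltI p.1 (D.completion p.2) * A.indicator 1 (D.serve p.1 p.2) := by
    have := hD.completion
    exact Measurable.mul (by fun_prop) (hf.comp hD.serve)
  have hlevel : ∀ (m : Measure S), SFinite m → (∀ᵐ x ∂m, D.number x = n) → ∀ s : ℝ≥0,
      ∫⁻ x, ∫⁻ v, D.noEventInd α t A s x v ∂(expUnit.prod μ) ∂m
        = leI s t * (expTail (α n * (t - s)) * ∫⁻ x, ltI (t - s : ℝ≥0) (D.completion x)
          * A.indicator 1 (D.serve (t - s) x) ∂m) := by
    intro m _ hnum s
    simp_rw [hD.lintegral_noEventInd α]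
    have h1 := hm.comp (measurable_prodMk_left (x := t - s))
    simp only [Function.comp_def] at h1
    rw [← lintegral_const_mul _ h1, ← lintegral_const_mul _ (h1.const_mul _)]
    refine lintegral_congr_ae ?_
    filter_upwards [hnum] with x hx
    rw [hx]
  have h0 := hlevel (ρ n) inferInstance (h.number_ae n) 0
  rw [ENNReal.coe_zero, tsub_zero, leI_of_le zero_le, one_mul] at h0
  have hE : Measurable fun s : ℝ≥0 => ∫⁻ x, ltI s (D.completion x)
      * A.indicator 1 (D.serve s x) ∂D.eventLaw α β μ ρ n := hm.lintegral_prod_right'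
  rw [h0]
  simp_rw [hlevel _ inferInstance (h.number_eventLaw α hD hβ n)]
  rw [← lintegral_indicator_one hA, h.service_arrivals α hD n hf t,
    ← lintegral_lam_sub (f := fun s => expTail (α n * s) * ∫⁻ x, ltI s (D.completion x)
      * A.indicator 1 (D.serve s x) ∂D.eventLaw α β μ ρ n) (by fun_prop)]
  congr 1
  refine lintegral_congr_ae ?_
  filter_upwards [leI_ae_eq_ltI lam t] with s hs
  rw [hs]

theorem LevelBalance.isStationary (hD : D.IsMeasurable) (h : LevelBalance D β μ ρ)
    {π : PMF ℕ} (hβ : β 0 = 0)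
    (hbal : ∀ n, π (n + 1) * (β (n + 1) : ℝ≥0∞) = π n * (α n : ℝ≥0∞))
    (hfin : ∑' n, π n * (α n : ℝ≥0∞) < ⊤) :
    IsStationary D α μ (Measure.sum fun n => π n • ρ n) := by
  have hprob : ∀ n, IsProbabilityMeasure (D.arriveLaw μ (ρ n)) := fun n =>
    hD.isProbabilityMeasure_arriveLaw μ (ρ n)
  have hν : IsProbabilityMeasure (Measure.sum fun n => π n • ρ n) := by
    constructor
    rw [Measure.sum_apply _ MeasurableSet.univ]
    simp [π.tsum_coe]
  -- By `tsum_balance`, departures and arrivals have the same total rate, so the mass is twice the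
  -- sum in `hfin`.
  have hη : IsFiniteMeasure (Measure.sum fun n => π n • D.eventLaw α β μ ρ n) := by
    constructor
    rw [Measure.sum_apply _ MeasurableSet.univ]
    have : ∀ n, (π n • D.eventLaw α β μ ρ n) Set.univ
        = π n * (α n * 1) + π n * (β n * (fun _ => 1) (n - 1)) := by
      intro n
      rw [Measure.smul_apply, ← lintegral_one, lintegral_eventLaw]
      simp [mul_add]
    simp_rw [this]
    rw [ENNReal.tsum_add, tsum_balance α hβ hbal (fun _ => 1)]
    simpa using hfin
  refine EventBalance.isStationary (η := Measure.sum fun n => π n • D.eventLaw α β μ ρ n)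
    α hD ?_ ?_
  · intro Φ hΦ hΦ0
    have hΦm : ∀ m : Measure S, SFinite m → Measurable fun s : ℝ≥0 => ∫⁻ x, Φ s x ∂m :=
      fun m _ => (hΦ.comp (f := fun p : ℝ≥0 × S => ((p.1 : ℝ≥0∞), p.2))
        (by fun_prop)).lintegral_prod_right'
    have hstep : Measurable fun p : ℝ≥0∞ × S => D.step α μ Φ p.1 p.2 := hD.step α hΦ
    have hstepm : ∀ n, Measurable fun s : ℝ≥0 => ∫⁻ x, D.step α μ Φ s x ∂D.eventLaw α β μ ρ n := by
      intro n
      have := hD.isFiniteMeasure_eventLaw (μ := μ) (ρ := ρ) (β := β) α n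
      exact (hstep.comp (f := fun p : ℝ≥0 × S => ((p.1 : ℝ≥0∞), p.2))
        (by fun_prop)).lintegral_prod_right'
    have hΦe : ∀ n, Measurable fun s : ℝ≥0 => ∫⁻ x, Φ s x ∂D.eventLaw α β μ ρ n := by
      intro n
      have := hD.isFiniteMeasure_eventLaw (μ := μ) (ρ := ρ) (β := β) α n
      exact hΦm _ inferInstance
    simp_rw [lintegral_sum_measure, lintegral_smul_measure, smul_eq_mul]
    rw [lintegral_tsum (fun n => ((hΦe n).const_mul _).aemeasurable),
      lintegral_tsum (fun n => ((hstepm n).const_mul _).aemeasurable), ← ENNReal.tsum_add]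
    have e1 : ∀ n, ∫⁻ s : ℝ≥0, π n * ∫⁻ x, Φ s x ∂D.eventLaw α β μ ρ n ∂lam
        = π n * (α n * ∫⁻ s : ℝ≥0, ∫⁻ x, Φ s x ∂ρ n ∂lam)
          + π n * (β n * ∫⁻ s : ℝ≥0, ∫⁻ x, Φ s x ∂D.arriveLaw μ (ρ (n - 1)) ∂lam) := by
      intro n
      rw [lintegral_const_mul _ (hΦe n)]
      simp_rw [lintegral_eventLaw]
      rw [lintegral_add_left ((hΦm _ inferInstance).const_mul _),
        lintegral_const_mul _ (hΦm _ inferInstance), lintegral_const_mul _ (hΦm _ inferInstance),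
        mul_add]
    have e2 : ∀ n, π n * ∫⁻ x, D.step α μ Φ 0 x ∂ρ n
        + ∫⁻ s : ℝ≥0, π n * ∫⁻ x, D.step α μ Φ s x ∂D.eventLaw α β μ ρ n ∂lam
        = π n * (α n * ∫⁻ s : ℝ≥0, ∫⁻ x, Φ s x ∂D.arriveLaw μ (ρ n) ∂lam)
          + π n * (β n * ∫⁻ s : ℝ≥0, ∫⁻ x, Φ s x ∂ρ (n - 1) ∂lam) := by
      intro n
      rw [lintegral_const_mul _ (hstepm n), ← mul_add, h.step_balance α hD hβ n hΦ hΦ0, mul_add]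
    simp_rw [e1, e2]
    -- Arrivals out of level `n` are arrivals into level `n + 1`, and departures into level `n` are
    -- departures out of level `n + 1`; the balance equations match their weights.
    rw [ENNReal.tsum_add, ENNReal.tsum_add,
      tsum_balance α hβ hbal (fun n => ∫⁻ s : ℝ≥0, ∫⁻ x, Φ s x ∂D.arriveLaw μ (ρ n) ∂lam),
      tsum_balance α hβ hbal (fun n => ∫⁻ s : ℝ≥0, ∫⁻ x, Φ s x ∂ρ n ∂lam), add_comm]
  · intro t A hA
    have hm : Measurable fun p : ℝ≥0 × S =>
        ∫⁻ v, D.noEventInd α t A p.1 p.2 v ∂(expUnit.prod μ) :=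
      ((hD.noEventInd α t hA).comp (f := fun q : (ℝ≥0 × S) × (ℝ≥0 × ℝ≥0) =>
        ((q.1.1 : ℝ≥0∞), q.1.2, q.2)) (by fun_prop)).lintegral_prod_right'
    have hme : ∀ n, Measurable fun s : ℝ≥0 => ∫⁻ x, ∫⁻ v, D.noEventInd α t A s x v
        ∂(expUnit.prod μ) ∂D.eventLaw α β μ ρ n := by
      intro n
      have := hD.isFiniteMeasure_eventLaw (μ := μ) (ρ := ρ) (β := β) α n
      exact hm.lintegral_prod_right'
    simp_rw [lintegral_sum_measure, lintegral_smul_measure, smul_eq_mul]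
    rw [lintegral_tsum (fun n => ((hme n).const_mul _).aemeasurable), ← ENNReal.tsum_add,
      Measure.sum_apply _ hA]
    congr 1
    ext n
    rw [lintegral_const_mul _ (hme n), ← mul_add, ← h.lastEvent α hD hβ n t hA]
    rfl

end Discipline

end

/-! ### Measurability on finite unordered families -/

theorem measurable_multiset_iff {Y : Type*} [MeasurableSpace Y] {f : Multiset ℝ≥0 → Y} :
    Measurable f ↔ ∀ n, Measurable fun v => f (unordered n v) := by
  constructor
  · intro h n B hB
    have := h hB
    rw [MeasurableSpace.measurableSet_iInf] at this
    exact this n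
  · intro h B hB
    rw [MeasurableSpace.measurableSet_iInf]
    exact fun n => h n hB

theorem measurable_unordered (n : ℕ) : Measurable (unordered n) :=
  measurable_multiset_iff.1 measurable_id n

@[simp]
theorem card_unordered (n : ℕ) (v : Fin n → ℝ≥0) : (unordered n v).card = n := by
  simp [unordered]

theorem unordered_succ (n : ℕ) (v : Fin (n + 1) → ℝ≥0) :
    unordered (n + 1) v = v 0 ::ₘ unordered n fun i => v i.succ := by
  simp [unordered, Fin.univ_succ, Function.comp_def]

theorem exists_unordered_eq (x : Multiset ℝ≥0) : ∃ v, unordered x.card v = x := by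
  induction x using Multiset.induction with
  | empty => exact ⟨fun _ => 0, rfl⟩
  | cons r x ih =>
    obtain ⟨v, hv⟩ := ih
    rw [Multiset.card_cons]
    exact ⟨Fin.cons r v, by simp [unordered_succ, hv]⟩

theorem measurable_card : Measurable (Multiset.card : Multiset ℝ≥0 → ℕ) :=
  measurable_multiset_iff.2 fun n => by simp

/-- The space is covered by finitely many measurable pieces, on each of which a fixed permutation
sorts the tuple. In case of ties this permutation may differ from `Tuple.sort v`, but the sorted
tuple is the same. -/
theorem measurable_comp_sort (n : ℕ) :
    Measurable fun v : Fin n → ℝ≥0 => v ∘ Tuple.sort v := by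
  intro B hB
  have : (fun v : Fin n → ℝ≥0 => v ∘ Tuple.sort v) ⁻¹' B
      = ⋃ σ : Equiv.Perm (Fin n), (⋂ i, ⋂ j, ⋂ _ : i ≤ j, {v | v (σ i) ≤ v (σ j)})
        ∩ (fun v => v ∘ σ) ⁻¹' B := by
    ext v
    simp only [Set.mem_preimage, Set.mem_iUnion, Set.mem_inter_iff, Set.mem_iInter,
      Set.mem_ofPred_eq]
    constructor
    · intro hv
      exact ⟨Tuple.sort v, fun i j hij => Tuple.monotone_sort v hij, hv⟩
    · rintro ⟨σ, hσ, hv⟩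
      rwa [Tuple.comp_sort_eq_comp_iff_monotone.2 (fun i j hij => hσ i j hij)] at hv
  rw [this]
  refine MeasurableSet.iUnion fun σ => MeasurableSet.inter ?_ ?_
  · exact MeasurableSet.iInter fun i => MeasurableSet.iInter fun j => MeasurableSet.iInter
      fun _ => measurableSet_le (measurable_pi_apply _) (measurable_pi_apply _)
  · exact measurable_pi_iff.2 (fun i => measurable_pi_apply (σ i)) hB

theorem unordered_eq_coe_ofFn (n : ℕ) (v : Fin n → ℝ≥0) :
    unordered n v = (List.ofFn v : Multiset ℝ≥0) := by
  rw [unordered, Fin.univ_val_map]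

theorem unordered_comp_perm (n : ℕ) (v : Fin n → ℝ≥0) (σ : Equiv.Perm (Fin n)) :
    unordered n (v ∘ σ) = unordered n v := by
  rw [unordered_eq_coe_ofFn, unordered_eq_coe_ofFn, Multiset.coe_eq_coe]
  exact σ.ofFn_comp_perm v

/-- The increasing rearrangement of an unordered family of `n` workloads. -/
def sortedTuple (n : ℕ) (x : Multiset ℝ≥0) : Fin n → ℝ≥0 :=
  open Classical in
  if h : ∃ v, unordered n v = x then h.choose ∘ Tuple.sort h.choose else 0

theorem sortedTuple_unordered (n : ℕ) (v : Fin n → ℝ≥0) :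
    sortedTuple n (unordered n v) = v ∘ Tuple.sort v := by
  have h : ∃ v', unordered n v' = unordered n v := ⟨v, rfl⟩
  rw [sortedTuple, dif_pos h]
  refine List.ofFn_injective (List.Perm.eq_of_sortedLE
    (Tuple.monotone_sort h.choose).sortedLE_ofFn (Tuple.monotone_sort v).sortedLE_ofFn ?_)
  rw [← Multiset.coe_eq_coe, ← unordered_eq_coe_ofFn, ← unordered_eq_coe_ofFn,
    unordered_comp_perm, unordered_comp_perm, h.choose_spec]

theorem unordered_sortedTuple (x : Multiset ℝ≥0) : unordered x.card (sortedTuple x.card x) = x := by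
  obtain ⟨v, hv⟩ := exists_unordered_eq x
  conv_lhs => rw [← hv]
  rw [card_unordered, sortedTuple_unordered, unordered_comp_perm, hv]

/-- A measurable section of `unordered n` is wanted because the σ-algebra on families is a quotient
one: measurability of a function of a parameter and a family is not directly, by definition, a
matter of tuples. -/
theorem measurable_sortedTuple (n : ℕ) : Measurable (sortedTuple n) := by
  refine measurable_multiset_iff.2 fun k => ?_
  by_cases hk : k = n
  · subst hk
    simp_rw [sortedTuple_unordered]
    exact measurable_comp_sort k
  · have : ∀ v, sortedTuple n (unordered k v) = 0 := by
      intro v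
      rw [sortedTuple, dif_neg]
      rintro ⟨v', hv'⟩
      have := congrArg Multiset.card hv'
      simp at this
      exact hk this.symm
    simp_rw [this]
    exact measurable_const

/-- A function of a variable and an unordered family is measurable if it is so as a function
of the variable and a tuple. -/
theorem measurable_prod_multiset {T Y : Type*} [MeasurableSpace T] [MeasurableSpace Y]
    {f : T × Multiset ℝ≥0 → Y}
    (h : ∀ n, Measurable fun p : T × (Fin n → ℝ≥0) => f (p.1, unordered n p.2)) :
    Measurable f := by
  intro B hB
  have : f ⁻¹' B = ⋃ n, {p | p.2.card = n} ∩
      (fun p => f (p.1, unordered n (sortedTuple n p.2))) ⁻¹' B := by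
    ext ⟨t, x⟩
    simp only [Set.mem_preimage, Set.mem_iUnion, Set.mem_inter_iff, Set.mem_ofPred_eq]
    constructor
    · intro hx
      exact ⟨x.card, rfl, by rwa [unordered_sortedTuple]⟩
    · rintro ⟨n, rfl, hx⟩
      rwa [unordered_sortedTuple] at hx
  rw [this]
  refine MeasurableSet.iUnion fun n => MeasurableSet.inter ?_ ?_
  · exact (measurable_card.comp measurable_snd) (measurableSet_singleton n)
  · exact (h n).comp (measurable_fst.prodMk ((measurable_sortedTuple n).comp measurable_snd)) hB

theorem measurable_cons : Measurable fun p : ℝ≥0 × Multiset ℝ≥0 => p.1 ::ₘ p.2 := by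
  refine measurable_prod_multiset fun n => ?_
  have : ∀ p : ℝ≥0 × (Fin n → ℝ≥0), p.1 ::ₘ unordered n p.2
      = unordered (n + 1) (Fin.cons p.1 p.2) := fun p => by simp [unordered_succ]
  simp_rw [this]
  refine (measurable_unordered (n + 1)).comp (measurable_pi_iff.2 fun i => ?_)
  refine Fin.cases ?_ (fun i => ?_) i
  · simpa using measurable_fst
  · simpa [Function.comp_def] using (measurable_pi_apply i).comp measurable_snd

theorem measurable_filter_pos : Measurable fun x : Multiset ℝ≥0 => x.filter fun r => 0 < r := by
  refine measurable_multiset_iff.2 fun n => ?_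
  induction n with
  | zero => simp [unordered]
  | succ n ih =>
    simp_rw [unordered_succ, Multiset.filter_cons]
    have hd : Measurable fun v : Fin (n + 1) → ℝ≥0 =>
        (unordered n fun i => v i.succ).filter fun r => 0 < r := ih.comp (by fun_prop)
    have : ∀ v : Fin (n + 1) → ℝ≥0, ((if 0 < v 0 then {v 0} else 0)
        + (unordered n fun i => v i.succ).filter fun r => 0 < r)
        = if 0 < v 0 then v 0 ::ₘ ((unordered n fun i => v i.succ).filter fun r => 0 < r)
          else ((unordered n fun i => v i.succ).filter fun r => 0 < r) := by
      intro v
      split_ifs <;> simp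
    simp_rw [this]
    exact Measurable.ite (measurableSet_lt measurable_const (measurable_pi_apply 0))
      (measurable_cons.comp ((measurable_pi_apply 0).prodMk hd)) hd

section

/-! ### Evolution of laws under service at rate one -/

section Flow

variable {X Y : Type*} [MeasurableSpace X] [MeasurableSpace Y]

/-- The law at time `v` of a flow `φ` started with law `m`, restricted to the event that the
lifetime `w` exceeds `v`. -/
def flowKernel (m : Measure X) [SFinite m] {w : X → ℝ≥0∞} (hw : Measurable w)
    {φ : ℝ≥0 → X → X} (hφ : Measurable fun p : ℝ≥0 × X => φ p.1 p.2) : Kernel ℝ≥0 X where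
  toFun v := (m.restrict {x | (v : ℝ≥0∞) < w x}).map (φ v)
  measurable' := by
    refine Measure.measurable_of_measurable_coe _ fun B hB => ?_
    have hφv : ∀ v, Measurable (φ v) := fun v => hφ.comp (measurable_prodMk_left (x := v))
    have : ∀ v : ℝ≥0, (m.restrict {x | (v : ℝ≥0∞) < w x}).map (φ v) B
        = m (Prod.mk v ⁻¹' {p : ℝ≥0 × X | φ p.1 p.2 ∈ B ∧ (p.1 : ℝ≥0∞) < w p.2}) := by
      intro v
      rw [Measure.map_apply (hφv v) hB, Measure.restrict_apply (hφv v hB)]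
      rfl
    simp_rw [this]
    exact measurable_measure_prodMk_left
      ((hφ hB).inter (measurableSet_lt measurable_fst.coe_nnreal_ennreal (hw.comp measurable_snd)))

variable {m : Measure X} {w : X → ℝ≥0∞} (hw : Measurable w)
    {φ : ℝ≥0 → X → X} (hφ : Measurable fun p : ℝ≥0 × X => φ p.1 p.2)

theorem lintegral_flowKernel [SFinite m] {f : X → ℝ≥0∞} (hf : Measurable f) (v : ℝ≥0) :
    ∫⁻ x, f x ∂flowKernel m hw hφ v = ∫⁻ x, ltI v (w x) * f (φ v x) ∂m := by
  have hφv : Measurable (φ v) := hφ.comp (measurable_prodMk_left (x := v))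
  change ∫⁻ x, f x ∂(m.restrict {x | (v : ℝ≥0∞) < w x}).map (φ v) = _
  rw [lintegral_map hf hφv, ← lintegral_indicator (measurableSet_lt measurable_const hw)]
  congr 1
  ext x
  by_cases h : (v : ℝ≥0∞) < w x <;> simp [ltI, h]

instance [IsFiniteMeasure m] : IsFiniteKernel (flowKernel m hw hφ) := by
  refine ⟨m Set.univ, measure_lt_top _ _, fun v => ?_⟩
  have hφv : Measurable (φ v) := hφ.comp (measurable_prodMk_left (x := v))
  change (m.restrict {x | (v : ℝ≥0∞) < w x}).map (φ v) Set.univ ≤ _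
  rw [Measure.map_apply hφv MeasurableSet.univ]
  exact Measure.restrict_apply_le _ _

theorem ltI_congr {a b c d : ℝ≥0∞} (h : a < b ↔ c < d) : ltI a b = ltI c d := by
  simp only [ltI, h]

theorem leI_congr {a b c d : ℝ≥0∞} (h : a ≤ b ↔ c ≤ d) : leI a b = leI c d := by
  simp only [leI, h]

/-- The indicator of `z < v ≤ u`. -/
def window (z u v : ℝ≥0∞) : ℝ≥0∞ := ltI z v * leI v u

@[fun_prop]
theorem measurable_window {f g h : X → ℝ≥0∞} (hf : Measurable f) (hg : Measurable g)
    (hh : Measurable h) : Measurable fun x => window (f x) (g x) (h x) := by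
  unfold window; fun_prop

theorem window_mul_congr {z u v x y : ℝ≥0∞} (h : z < v → v ≤ u → x = y) :
    window z u v * x = window z u v * y := by
  rcases lt_or_ge z v with h1 | h1
  · rcases le_or_gt v u with h2 | h2
    · rw [h h1 h2]
    · rw [window, leI_of_lt h2]; simp
  · rw [window, ltI_of_le h1]; simp

/-- Off the diagonal both products are the indicator of z < w < v ≤ u. -/
theorem window_mul_window {z u v w : ℝ≥0∞} (h : v ≠ w) :
    window z u v * window z v w = window z u w * window w u v := by
  simp only [window, ltI, leI]
  split_ifs with h1 h2 h3 h4 h5 <;> simp_all <;> order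

/-- `P' v` is the rate at which `P` decreases at time `v`. -/
def DecreasesAt (P P' : Kernel ℝ≥0 X) : Prop :=
  ∀ z u : ℝ≥0, z ≤ u → ∀ f : X → ℝ≥0∞, Measurable f →
    ∫⁻ x, f x ∂P z = ∫⁻ x, f x ∂P u + ∫⁻ v : ℝ≥0, window z u v * ∫⁻ x, f x ∂P' v ∂lam

/-- The product rule. -/
theorem DecreasesAt.prod {P P' : Kernel ℝ≥0 X} {Q Q' : Kernel ℝ≥0 Y} [IsSFiniteKernel P]
    [IsSFiniteKernel P'] [IsSFiniteKernel Q] [IsSFiniteKernel Q'] (hP : DecreasesAt P P')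
    (hQ : DecreasesAt Q Q') {z u : ℝ≥0} (hzu : z ≤ u) {F : X → Y → ℝ≥0∞}
    (hF : Measurable (Function.uncurry F)) :
    ∫⁻ x, ∫⁻ y, F x y ∂Q z ∂P z = ∫⁻ x, ∫⁻ y, F x y ∂Q u ∂P u
      + ∫⁻ v : ℝ≥0, window z u v * (∫⁻ x, ∫⁻ y, F x y ∂Q v ∂P' v
        + ∫⁻ x, ∫⁻ y, F x y ∂Q' v ∂P v) ∂lam := by
  have hFx : ∀ x, Measurable (F x) := fun x => hF.comp (measurable_prodMk_left (x := x))
  have hg : ∀ (V : Kernel ℝ≥0 Y) [IsSFiniteKernel V], Measurable fun p : ℝ≥0 × X =>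
      ∫⁻ y, F p.2 y ∂V p.1 := by
    intro V _
    have : Measurable fun q : (ℝ≥0 × X) × Y => F q.1.2 q.2 :=
      hF.comp (f := fun q : (ℝ≥0 × X) × Y => (q.1.2, q.2)) (by fun_prop)
    exact this.lintegral_kernel_prod_right' (κ := V.comap Prod.fst measurable_fst)
  have hgQ := hg Q
  have hgQ' := hg Q'
  have hgx : ∀ (V : Kernel ℝ≥0 Y) [IsSFiniteKernel V] (v : ℝ≥0), Measurable fun x =>
      ∫⁻ y, F x y ∂V v := fun V _ v => (hg V).comp (measurable_prodMk_left (x := v))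
  have hI : ∀ (V : Kernel ℝ≥0 Y) (T : Kernel ℝ≥0 X) [IsSFiniteKernel V] [IsSFiniteKernel T],
      Measurable fun p : ℝ≥0 × ℝ≥0 => ∫⁻ x, ∫⁻ y, F x y ∂V p.1 ∂T p.2 := by
    intro V T _ _
    have : Measurable fun q : (ℝ≥0 × ℝ≥0) × X => ∫⁻ y, F q.2 y ∂V q.1.1 :=
      (hg V).comp (f := fun q : (ℝ≥0 × ℝ≥0) × X => (q.1.1, q.2)) (by fun_prop)
    exact this.lintegral_kernel_prod_right' (κ := T.comap Prod.snd measurable_snd)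
  have hsplit : ∀ (m : Measure X) [SFinite m] (a b : ℝ≥0), a ≤ b →
      ∫⁻ x, ∫⁻ y, F x y ∂Q a ∂m = ∫⁻ x, ∫⁻ y, F x y ∂Q b ∂m
        + ∫⁻ v : ℝ≥0, window a b v * ∫⁻ x, ∫⁻ y, F x y ∂Q' v ∂m ∂lam := by
    intro m _ a b hab
    simp_rw [fun x => hQ a b hab (F x) (hFx x)]
    rw [lintegral_add_left (hgx Q b)]
    congr 1
    rw [lintegral_lintegral_swap]
    · congr 1
      ext v
      rw [lintegral_const_mul _ (hgx Q' v)]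
    · have := hgQ'.comp measurable_swap
      exact Measurable.aemeasurable (Measurable.mul (by fun_prop) this)
  -- First `Q` moves with `P` frozen at `z`, then `P` with `Q` frozen at `u`. To evaluate the frozen
  -- kernel at the current time instead, `e1` and `e2` introduce double integrals of `Q'` and `P'`,
  -- which are equal by Fubini (`e3`); nothing is subtracted.
  rw [hsplit (P z) z u hzu, hP z u hzu _ (hgx Q u), add_assoc]
  congr 1
  have hPu : Measurable fun v : ℝ≥0 => ∫⁻ x, ∫⁻ y, F x y ∂Q u ∂P' v :=
    (hI Q P').comp (measurable_prodMk_left (x := u))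
  have hPP : Measurable fun v : ℝ≥0 => ∫⁻ x, ∫⁻ y, F x y ∂Q v ∂P' v :=
    (hI Q P').comp (f := fun v : ℝ≥0 => (v, v)) (by fun_prop)
  have hPQ : Measurable fun v : ℝ≥0 => ∫⁻ x, ∫⁻ y, F x y ∂Q' v ∂P v :=
    (hI Q' P).comp (f := fun v : ℝ≥0 => (v, v)) (by fun_prop)
  have hI' := hI Q' P'
  have e1 : ∫⁻ v : ℝ≥0, window z u v * ∫⁻ x, ∫⁻ y, F x y ∂Q' v ∂P z ∂lam
      = ∫⁻ v : ℝ≥0, window z u v * ∫⁻ x, ∫⁻ y, F x y ∂Q' v ∂P v ∂lam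
        + ∫⁻ v : ℝ≥0, ∫⁻ w : ℝ≥0, window z u v * window z v w
          * ∫⁻ x, ∫⁻ y, F x y ∂Q' v ∂P' w ∂lam ∂lam := by
    rw [← lintegral_add_left (by fun_prop)]
    congr 1
    ext v
    have hIw : Measurable fun w => ∫⁻ x, ∫⁻ y, F x y ∂Q' v ∂P' w :=
      hI'.comp (measurable_prodMk_left (x := v))
    simp_rw [mul_assoc]
    rw [lintegral_const_mul _ (by fun_prop), ← mul_add]
    refine window_mul_congr fun h1 _ => ?_
    exact hP z v (by exact_mod_cast h1.le) _ (hgx Q' v)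
  have e2 : ∫⁻ w : ℝ≥0, window z u w * ∫⁻ x, ∫⁻ y, F x y ∂Q w ∂P' w ∂lam
      = ∫⁻ w : ℝ≥0, window z u w * ∫⁻ x, ∫⁻ y, F x y ∂Q u ∂P' w ∂lam
        + ∫⁻ w : ℝ≥0, ∫⁻ v : ℝ≥0, window z u w * window w u v
          * ∫⁻ x, ∫⁻ y, F x y ∂Q' v ∂P' w ∂lam ∂lam := by
    rw [← lintegral_add_left (by fun_prop)]
    congr 1
    ext w
    have hIw : Measurable fun v => ∫⁻ x, ∫⁻ y, F x y ∂Q' v ∂P' w :=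
      hI'.comp (measurable_prodMk_right (y := w))
    simp_rw [mul_assoc]
    rw [lintegral_const_mul _ (by fun_prop), ← mul_add]
    refine window_mul_congr fun _ h2 => ?_
    exact hsplit (P' w) w u (by exact_mod_cast h2)
  have e3 : ∫⁻ v : ℝ≥0, ∫⁻ w : ℝ≥0, window z u v * window z v w
          * ∫⁻ x, ∫⁻ y, F x y ∂Q' v ∂P' w ∂lam ∂lam
      = ∫⁻ w : ℝ≥0, ∫⁻ v : ℝ≥0, window z u w * window w u v
          * ∫⁻ x, ∫⁻ y, F x y ∂Q' v ∂P' w ∂lam ∂lam := by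
    rw [lintegral_lintegral_swap]
    · congr 1
      ext w
      refine lintegral_congr_ae ?_
      have hne : ∀ᵐ y ∂lam, y ≠ w := by simp [ae_iff, measure_singleton]
      filter_upwards [hne] with v hv
      rw [window_mul_window (by exact_mod_cast hv)]
    · exact Measurable.aemeasurable (Measurable.mul (by fun_prop) hI')
  simp_rw [mul_add]
  rw [lintegral_add_left (by fun_prop), e1, e2, e3]
  ring

/-- From a window to a half-open interval. -/
theorem window_ae_eq_ltI (t : ℝ≥0) : ∀ᵐ v : ℝ≥0 ∂lam, window 0 t v = ltI v t := by
  have hne : ∀ᵐ y ∂lam, y ≠ 0 := by simp [ae_iff, measure_singleton]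
  filter_upwards [hne, leI_ae_eq_ltI lam t] with v hv hv'
  rw [window, hv', ltI_of_lt (by exact_mod_cast pos_iff_ne_zero.2 hv), one_mul]

end Flow

/-- Service at rate one of a single residual workload. -/
def serveOne (v r : ℝ≥0) : ℝ≥0 := r - v

theorem measurable_serveOne : Measurable fun p : ℝ≥0 × ℝ≥0 => serveOne p.1 p.2 := by
  unfold serveOne; fun_prop

/-- Evolution of a law of a residual workload under service at rate one. -/
def serveKernel (m : Measure ℝ≥0) [SFinite m] : Kernel ℝ≥0 ℝ≥0 :=
  flowKernel m measurable_coe_nnreal_ennreal measurable_serveOne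

instance (m : Measure ℝ≥0) [IsFiniteMeasure m] : IsFiniteKernel (serveKernel m) := by
  unfold serveKernel; infer_instance

theorem lintegral_serveKernel {m : Measure ℝ≥0} [SFinite m] {f : ℝ≥0 → ℝ≥0∞} (hf : Measurable f)
    (v : ℝ≥0) : ∫⁻ r, f r ∂serveKernel m v = ∫⁻ r, ltI v r * f (r - v) ∂m :=
  lintegral_flowKernel _ _ hf v

/-- The difference is the mass of (y + z, y + u], where w - y is the service after which the
workload w is reduced to y. The factor `ltI y w` is implied by the window and prepares the use of
`lintegral_lam_sub`. -/
theorem tail_add_window (μ : Measure ℝ≥0) (y : ℝ≥0) {z u : ℝ≥0} (h : z ≤ u) :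
    tail μ (y + z) = tail μ (y + u)
      + ∫⁻ w : ℝ≥0, ltI y w * window z u (w - y : ℝ≥0) ∂μ := by
  rw [← lintegral_ltI, ← lintegral_ltI, ← lintegral_add_left (by fun_prop)]
  congr 1
  ext w
  have h1 : ltI z (w - y : ℝ≥0) = ltI (y + z : ℝ≥0) w :=
    ltI_congr (by rw [ENNReal.coe_lt_coe, ENNReal.coe_lt_coe]; exact lt_tsub_iff_left)
  have h2 : leI (w - y : ℝ≥0) u = leI w (y + u : ℝ≥0) :=
    leI_congr (by rw [ENNReal.coe_le_coe, ENNReal.coe_le_coe]; exact tsub_le_iff_left)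
  rw [window, h1, h2]
  simp only [ltI, leI, ENNReal.coe_lt_coe, ENNReal.coe_le_coe]
  rcases lt_or_ge (y + z) w with ha | ha
  · have : y < w := le_self_add.trans_lt ha
    rcases lt_or_ge (y + u) w with hb | hb
    · simp [ha, hb, this, not_le.2 hb]
    · simp [ha, hb, this, not_lt.2 hb]
  · have : w ≤ y + u := ha.trans (by gcongr)
    simp [not_lt.2 ha, not_lt.2 this]

/-- The residual law has density `tail μ`, which service for a time v translates to y ↦ `tail μ (y +
v)`. What is lost as v grows is the mass of μ at y + v, that is, of workloads reduced to y by
service for a time v. -/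
theorem decreasesAt_residual (μ : Measure ℝ≥0) [IsFiniteMeasure μ] [IsFiniteMeasure (residual μ)] :
    DecreasesAt (serveKernel (residual μ)) (serveKernel μ) := by
  intro z u hzu f hf
  have h1 : ∀ t : ℝ≥0, ∫⁻ r, f r ∂serveKernel (residual μ) t
      = ∫⁻ y, tail μ (y + t) * f y ∂lam := by
    intro t
    rw [lintegral_serveKernel hf, lintegral_residual _ (by fun_prop)]
    have := lintegral_lam_add (f := fun y => tail μ y * f (y - t)) (by fun_prop) t
    simp only [add_tsub_cancel_right] at this
    rw [this]
    congr 1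
    ext y
    ring
  have h2 : ∫⁻ v : ℝ≥0, window z u v * ∫⁻ r, f r ∂serveKernel μ v ∂lam
      = ∫⁻ y : ℝ≥0, (∫⁻ w : ℝ≥0, ltI y w * window z u (w - y : ℝ≥0) ∂μ) * f y ∂lam := by
    have e1 : ∀ v : ℝ≥0, window z u v * ∫⁻ r, f r ∂serveKernel μ v
        = ∫⁻ w : ℝ≥0, window z u v * (ltI v w * f (w - v)) ∂μ := by
      intro v
      rw [lintegral_serveKernel hf, lintegral_const_mul _ (by fun_prop)]
    have e2 : ∀ y : ℝ≥0, (∫⁻ w : ℝ≥0, ltI y w * window z u (w - y : ℝ≥0) ∂μ) * f y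
        = ∫⁻ w : ℝ≥0, ltI y w * (window z u (w - y : ℝ≥0) * f y) ∂μ := by
      intro y
      rw [← lintegral_mul_const _ (by fun_prop)]
      simp_rw [mul_assoc]
    simp_rw [e1, e2]
    rw [lintegral_lintegral_swap (f := fun v w : ℝ≥0 => window z u v * (ltI v w * f (w - v)))
      (by fun_prop), lintegral_lintegral_swap
      (f := fun y w : ℝ≥0 => ltI y w * (window z u (w - y : ℝ≥0) * f y)) (by fun_prop)]
    congr 1
    ext w
    -- For a fixed workload `w`, reflection exchanges the service received with the work remaining.
    rw [← lintegral_lam_sub (f := fun y => window z u (w - y : ℝ≥0) * f y) (by fun_prop)]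
    congr 1
    ext v
    rw [mul_left_comm]
    refine ltI_mul_congr fun hv => ?_
    rw [tsub_tsub_cancel_of_le (by exact_mod_cast hv.le)]
  rw [h1, h1, h2, ← lintegral_add_left (by fun_prop)]
  congr 1
  ext y
  rw [tail_add_window μ y hzu, add_mul]

/-! ### Change of the rate of service -/

section Rescale

variable {S : Type*} [MeasurableSpace S] {w : S → ℝ≥0∞} {φ : ℝ≥0 → S → S} {ρ ρ' σ : Measure S}
  {κ c : ℝ≥0}

theorem ltI_div (hc : 0 < c) (s : ℝ≥0) (x : ℝ≥0∞) : ltI s (x / c) = ltI (c * s : ℝ≥0) x := by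
  refine ltI_congr ?_
  rw [ENNReal.lt_div_iff_mul_lt (Or.inl (by exact_mod_cast hc.ne'))
    (Or.inl ENNReal.coe_ne_top), ENNReal.coe_mul, mul_comm]

theorem service_rescale [SFinite σ] (hc : 0 < c) (hw : Measurable w)
    (hφ : Measurable fun p : ℝ≥0 × S => φ p.1 p.2)
    {f : S → ℝ≥0∞} (hf : Measurable f)
    (h : ∀ t : ℝ≥0, ∫⁻ x, f x ∂ρ = ∫⁻ x, ltI t (w x) * f (φ t x) ∂ρ
      + ∫⁻ s : ℝ≥0, ltI s t * (κ * ∫⁻ x, ltI s (w x) * f (φ s x) ∂σ) ∂lam) (t : ℝ≥0) :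
    ∫⁻ x, f x ∂ρ = ∫⁻ x, ltI t (w x / c) * f (φ (c * t) x) ∂ρ
      + ∫⁻ s : ℝ≥0, ltI s t * ((κ * c : ℝ≥0)
        * ∫⁻ x, ltI s (w x / c) * f (φ (c * s) x) ∂σ) ∂lam := by
  have hm : Measurable fun s : ℝ≥0 => ∫⁻ x, ltI s (w x) * f (φ s x) ∂σ := by
    have : Measurable fun p : ℝ≥0 × S => ltI p.1 (w p.2) * f (φ p.1 p.2) :=
      Measurable.mul (by fun_prop) (hf.comp hφ)
    exact this.lintegral_prod_right'
  simp_rw [ltI_div hc]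
  rw [h (c * t), ← lintegral_lam_mul (by fun_prop) hc, ← lintegral_const_mul _ (by fun_prop)]
  congr 2
  ext s
  have : ltI (c * s : ℝ≥0) (c * t : ℝ≥0) = ltI s t := by
    simp only [ltI, ENNReal.coe_lt_coe, mul_lt_mul_iff_right₀ hc]
  rw [this, ENNReal.coe_mul κ c]
  ring

theorem completions_rescale [SFinite σ] [SFinite ρ'] (hc : 0 < c) (hw : Measurable w)
    (hφ : Measurable fun p : ℝ≥0 × S => φ p.1 p.2) {a : S → S} (ha : Measurable a)
    {g : ℝ≥0∞ → S → ℝ≥0∞} (hg : Measurable fun p : ℝ≥0∞ × S => g p.1 p.2) (hg0 : ∀ x, g ⊤ x = 0)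
    (h : ∀ g : ℝ≥0∞ → S → ℝ≥0∞, Measurable (fun p : ℝ≥0∞ × S => g p.1 p.2) → (∀ x, g ⊤ x = 0) →
      ∫⁻ x, g (w x) (φ (w x).toNNReal x) ∂ρ
        + κ * ∫⁻ s : ℝ≥0, ∫⁻ x, g (s + w x) (φ (w x).toNNReal x) ∂σ ∂lam
        = κ * ∫⁻ s : ℝ≥0, ∫⁻ x, g s (a x) ∂ρ' ∂lam) :
    ∫⁻ x, g (w x / c) (φ (c * (w x / c).toNNReal) x) ∂ρ
        + (κ * c : ℝ≥0) * ∫⁻ s : ℝ≥0, ∫⁻ x, g (s + w x / c) (φ (c * (w x / c).toNNReal) x) ∂σ ∂lam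
        = (κ * c : ℝ≥0) * ∫⁻ s : ℝ≥0, ∫⁻ x, g s (a x) ∂ρ' ∂lam := by
  have hc0 : (c : ℝ≥0∞) ≠ 0 := by exact_mod_cast hc.ne'
  have key := h (fun s x => g (s / c) x) (hg.comp (f := fun p : ℝ≥0∞ × S => (p.1 / c, p.2))
    (by fun_prop)) (fun x => by rw [ENNReal.top_div_of_ne_top ENNReal.coe_ne_top, hg0])
  have e0 : ∀ x, c * (w x / c).toNNReal = (w x).toNNReal := by
    intro x
    rw [ENNReal.toNNReal_div, ENNReal.toNNReal_coe, mul_div_cancel₀ _ hc.ne']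
  have hm1 : Measurable fun s : ℝ≥0 => ∫⁻ x, g ((s + w x) / c) (φ (w x).toNNReal x) ∂σ := by
    have h1 : Measurable fun p : ℝ≥0 × S => φ (w p.2).toNNReal p.2 :=
      hφ.comp (f := fun p : ℝ≥0 × S => ((w p.2).toNNReal, p.2)) (by fun_prop)
    have : Measurable fun p : ℝ≥0 × S => g ((p.1 + w p.2) / c) (φ (w p.2).toNNReal p.2) :=
      hg.comp (Measurable.prodMk (by fun_prop) h1)
    exact this.lintegral_prod_right'
  have hm2 : Measurable fun s : ℝ≥0 => ∫⁻ x, g (s / c) (a x) ∂ρ' := by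
    have : Measurable fun p : ℝ≥0 × S => g (p.1 / c) (a p.2) := hg.comp
      (f := fun p : ℝ≥0 × S => ((p.1 : ℝ≥0∞) / c, a p.2)) (by fun_prop)
    exact this.lintegral_prod_right'
  have e1 : ∀ s : ℝ≥0, ((c * s : ℝ≥0) : ℝ≥0∞) / c = s := by
    intro s
    rw [ENNReal.coe_mul, mul_comm, ENNReal.mul_div_cancel_right hc0 ENNReal.coe_ne_top]
  rw [← lintegral_lam_mul hm1 hc, ← lintegral_lam_mul hm2 hc, ← mul_assoc, ← mul_assoc,
    ← ENNReal.coe_mul] at key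
  simp_rw [ENNReal.add_div, e1] at key
  simp_rw [e0]
  exact key

end Rescale

end

/-! ### Renewal identities for one workload, and reduction to unit rate -/

section

/-- This is `decreasesAt_residual` from time 0, where the kernel discards only the null set of zero
workloads. -/
theorem residual_service (μ : Measure ℝ≥0) [IsFiniteMeasure μ] [IsFiniteMeasure (residual μ)]
    {f : ℝ≥0 → ℝ≥0∞} (hf : Measurable f) (t : ℝ≥0) :
    ∫⁻ r, f r ∂residual μ = ∫⁻ r, ltI t r * f (r - t) ∂residual μ
      + ∫⁻ s : ℝ≥0, ltI s t * ∫⁻ w, ltI s w * f (w - s) ∂μ ∂lam := by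
  have h := decreasesAt_residual μ 0 t zero_le f hf
  simp_rw [lintegral_serveKernel hf] at h
  have h0 : ∫⁻ r, ltI (0 : ℝ≥0) r * f (r - 0) ∂residual μ = ∫⁻ r, f r ∂residual μ := by
    have hne : ∀ᵐ y ∂residual μ, y ≠ 0 := by simp [ae_iff, measure_singleton]
    refine lintegral_congr_ae ?_
    filter_upwards [hne] with r hr
    rw [ltI_of_lt (by exact_mod_cast pos_iff_ne_zero.2 hr), one_mul, tsub_zero]
  rw [← h0, h]
  congr 1
  refine lintegral_congr_ae ?_
  filter_upwards [window_ae_eq_ltI t] with s hs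
  rw [ENNReal.coe_zero, hs]

/-- The change of variables `(s, w) ↦ (s + w, w)`. -/
theorem lintegral_lam_add_leI (m : Measure ℝ≥0) [SFinite m] {F : ℝ≥0 → ℝ≥0 → ℝ≥0∞}
    (hF : Measurable (Function.uncurry F)) :
    ∫⁻ s, ∫⁻ w, F (s + w) w ∂m ∂lam = ∫⁻ s : ℝ≥0, ∫⁻ w : ℝ≥0, leI w s * F s w ∂m ∂lam := by
  rw [lintegral_lintegral_swap (f := fun s w => F (s + w) w) (by fun_prop),
    lintegral_lintegral_swap (f := fun s w : ℝ≥0 => leI w s * F s w) (by fun_prop)]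
  congr 1
  ext w
  rw [lintegral_lam_add (f := fun s => F s w) (by fun_prop)]
  refine lintegral_congr_ae ?_
  have hne : ∀ᵐ y ∂lam, y ≠ w := by simp [ae_iff, measure_singleton]
  filter_upwards [hne] with s hs
  congr 1
  simp only [leI, ltI, ENNReal.coe_le_coe, ENNReal.coe_lt_coe]
  simp [le_iff_lt_or_eq, hs.symm]

/-- At time s the initial workload contributes the density `tail μ s`, and the workloads started
before s contribute the mass of [0, s]; together they make 1, the rate of a stationary renewal
process. -/
theorem residual_completions (μ : Measure ℝ≥0) [IsProbabilityMeasure μ]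
    {f : ℝ≥0 → ℝ≥0∞} (hf : Measurable f) :
    ∫⁻ r, f r ∂residual μ + ∫⁻ s, ∫⁻ w, f (s + w) ∂μ ∂lam = ∫⁻ s, f s ∂lam := by
  rw [lintegral_residual μ hf, lintegral_lam_add_leI μ (F := fun s _ => f s) (by fun_prop),
    ← lintegral_add_left (by fun_prop)]
  congr 1
  ext s
  rw [← lintegral_ltI, ← lintegral_mul_const _ (by fun_prop), ← lintegral_add_left (by fun_prop)]
  simp_rw [← add_mul, ltI_add_leI]
  simp

namespace Discipline

variable {S : Type*} [MeasurableSpace S] {D : Discipline S}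

theorem IsMeasurable.lintegral_arriveLaw_swap (hD : D.IsMeasurable) {m : Measure ℝ≥0} [SFinite m]
    {ρ : Measure S} [SFinite ρ] {f : S → ℝ≥0∞} (hf : Measurable f) :
    ∫⁻ y, f y ∂D.arriveLaw m ρ = ∫⁻ x, ∫⁻ w, f (D.arrive w x) ∂m ∂ρ := by
  rw [hD.lintegral_arriveLaw hf, lintegral_lintegral_swap]
  exact (hf.comp hD.arrive).aemeasurable

/-- Level balance from the balance properties for service at rate one: `w` is the
work required until the next completion, `φ` the flow at rate one and `c n` the rate at which
it is followed when `n` individuals are present. -/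
theorem LevelBalance.of_unit_rate {β c : ℕ → ℝ≥0} {κ : ℕ → ℝ≥0} {μ : Measure ℝ≥0}
    [IsProbabilityMeasure μ] {ρ : ℕ → Measure S} [∀ n, IsProbabilityMeasure (ρ n)]
    (hD : D.IsMeasurable) (hβ : β 0 = 0) (hc : ∀ n, 0 < c (n + 1))
    (hκ : ∀ n, κ (n + 1) * c (n + 1) = β (n + 1))
    {w : S → ℝ≥0∞} {φ : ℝ≥0 → S → S} (hw : Measurable w)
    (hφ : Measurable fun p : ℝ≥0 × S => φ p.1 p.2)
    (hcompletion : ∀ x, D.completion x = w x / c (D.number x))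
    (hserve : ∀ t x, D.serve t x = φ (c (D.number x) * t) x)
    (hnumber : ∀ t x, D.number (φ t x) = D.number x)
    (hwφ : ∀ (t : ℝ≥0) x, w (φ t x) = w x - t)
    (hφφ : ∀ s t x, φ s (φ t x) = φ (t + s) x)
    (hw0 : ∀ x, D.number x = 0 → w x = ⊤)
    (hφ0 : ∀ t x, D.number x = 0 → φ t x = x)
    (number_ae : ∀ n, ∀ᵐ x ∂ρ n, D.number x = n)
    (number_arrive : ∀ w x, D.number (D.arrive w x) = D.number x + 1)
    (depart_arrive_zero : ∀ n, ∀ᵐ x ∂ρ n, D.depart (D.arrive 0 x) = x)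
    (service : ∀ n (f : S → ℝ≥0∞), Measurable f → ∀ t : ℝ≥0,
      ∫⁻ x, f x ∂ρ (n + 1) = ∫⁻ x, ltI t (w x) * f (φ t x) ∂ρ (n + 1)
        + ∫⁻ s : ℝ≥0, ltI s t * (κ (n + 1) * ∫⁻ x, ltI s (w x) * f (φ s x)
            ∂D.arriveLaw μ (ρ n)) ∂lam)
    (completions : ∀ n (g : ℝ≥0∞ → S → ℝ≥0∞), Measurable (fun p : ℝ≥0∞ × S => g p.1 p.2) →
      (∀ x, g ⊤ x = 0) →
      ∫⁻ x, g (w x) (φ (w x).toNNReal x) ∂ρ (n + 1)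
        + κ (n + 1) * ∫⁻ s : ℝ≥0, ∫⁻ x, g (s + w x) (φ (w x).toNNReal x)
            ∂D.arriveLaw μ (ρ n) ∂lam
        = κ (n + 1) * ∫⁻ s : ℝ≥0, ∫⁻ x, g s (D.arrive 0 x) ∂ρ n ∂lam) :
    LevelBalance D β μ ρ where
  number_ae := number_ae
  number_arrive := number_arrive
  depart_arrive_zero := depart_arrive_zero
  completion_serve t x ht := by
    rw [hserve, hcompletion, hcompletion, hnumber, hwφ]
    rcases hn : D.number x with _ | n
    · rw [hw0 x hn, ENNReal.top_sub ENNReal.coe_ne_top,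
        ENNReal.top_div_of_ne_top ENNReal.coe_ne_top,
        ENNReal.top_sub ENNReal.coe_ne_top]
    · have h0 : (c (n + 1) : ℝ≥0∞) ≠ 0 := by exact_mod_cast (hc n).ne'
      rw [ENNReal.sub_div (fun _ _ => h0), ENNReal.coe_mul, mul_comm,
        ENNReal.mul_div_cancel_right h0 ENNReal.coe_ne_top]
  serve_serve t x ht htop := by
    rw [hserve, hserve, hserve, hnumber, hφφ, ← mul_add]
    congr 2
    lift D.completion x to ℝ≥0 using htop with C
    rw [ENNReal.toNNReal_coe, add_tsub_cancel_of_le (by exact_mod_cast ht.le)]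
  service n f hf t := by
    -- At level 0, `n - 1` is 0 and `c 0` is unconstrained, but there is nothing to serve and `β 0 =
    -- 0` removes the arrival term.
    rcases n with _ | n
    · have h : ∀ᵐ x ∂ρ 0, ltI t (D.completion x) * f (D.serve t x) = f x := by
        filter_upwards [number_ae 0] with x hx
        rw [hcompletion, hserve, hφ0 _ x hx, hw0 x hx,
          ENNReal.top_div_of_ne_top ENNReal.coe_ne_top, ltI_of_lt ENNReal.coe_lt_top, one_mul]
      rw [lintegral_congr_ae h]
      simp [hβ]
    · have := hD.isProbabilityMeasure_arriveLaw μ (ρ n)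
      have key := service_rescale (hc n) hw hφ hf (service n f hf) t
      rw [hκ] at key
      have hE : ∀ (m : Measure S), (∀ᵐ x ∂m, D.number x = n + 1) → ∀ s : ℝ≥0,
          ∫⁻ x, ltI s (D.completion x) * f (D.serve s x) ∂m
            = ∫⁻ x, ltI s (w x / c (n + 1)) * f (φ (c (n + 1) * s) x) ∂m := by
        intro m hm s
        refine lintegral_congr_ae ?_
        filter_upwards [hm] with x hx
        rw [hcompletion, hserve, hx]
      simp_rw [Nat.add_sub_cancel, hE _ (number_ae (n + 1)),
        hE _ (hD.number_arriveLaw number_arrive (number_ae n))]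
      exact key
  completions n g hg hg0 := by
    rcases n with _ | n
    · have h : ∀ᵐ x ∂ρ 0, g (D.completion x) (D.serve (D.completion x).toNNReal x) = 0 := by
        filter_upwards [number_ae 0] with x hx
        rw [hcompletion, hw0 x hx, ENNReal.top_div_of_ne_top ENNReal.coe_ne_top, hg0]
      rw [lintegral_congr_ae h]
      simp [hβ]
    · have := hD.isProbabilityMeasure_arriveLaw μ (ρ n)
      have key := completions_rescale (hc n) hw hφ
        (hD.arrive.comp (measurable_prodMk_left (x := (0 : ℝ≥0)))) hg hg0 (completions n)
      rw [hκ] at key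
      have hE : ∀ (m : Measure S), (∀ᵐ x ∂m, D.number x = n + 1) → ∀ s : ℝ≥0∞,
          ∫⁻ x, g (s + D.completion x) (D.serve (D.completion x).toNNReal x) ∂m
            = ∫⁻ x, g (s + w x / c (n + 1))
                (φ (c (n + 1) * (w x / c (n + 1)).toNNReal) x) ∂m := by
        intro m hm s
        refine lintegral_congr_ae ?_
        filter_upwards [hm] with x hx
        rw [hcompletion, hserve, hx]
      have hE0 := hE _ (number_ae (n + 1)) 0
      simp only [zero_add] at hE0
      simp_rw [Nat.add_sub_cancel, hE0, hE _ (hD.number_arriveLaw number_arrive (number_ae n))]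
      exact key

end Discipline

end

section

/-! ### Last in, first out, preemptive resume -/

theorem measurable_sigma_iff {Y : Type*} [MeasurableSpace Y] {f : (Σ n : ℕ, Fin n → ℝ≥0) → Y} :
    Measurable f ↔ ∀ n, Measurable fun v => f ⟨n, v⟩ := by
  constructor
  · intro h n B hB
    have := h hB
    rw [MeasurableSpace.measurableSet_iInf] at this
    exact this n
  · intro h B hB
    rw [MeasurableSpace.measurableSet_iInf]
    exact fun n => h n hB

theorem measurable_sigma_mk (n : ℕ) :
    Measurable (Sigma.mk (β := fun n : ℕ => Fin n → ℝ≥0) n) :=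
  measurable_sigma_iff.1 measurable_id n

theorem measurable_sigma_fst : Measurable fun x : Σ n : ℕ, Fin n → ℝ≥0 => x.1 :=
  measurable_sigma_iff.2 fun _ => measurable_const

/-- The tuple of a state with `n` individuals. -/
def tupleOf (n : ℕ) (x : Σ n : ℕ, Fin n → ℝ≥0) : Fin n → ℝ≥0 :=
  if h : x.1 = n then h ▸ x.2 else 0

@[simp]
theorem tupleOf_mk (n : ℕ) (v : Fin n → ℝ≥0) : tupleOf n ⟨n, v⟩ = v := by
  simp [tupleOf]

theorem measurable_tupleOf (n : ℕ) : Measurable (tupleOf n) := by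
  refine measurable_sigma_iff.2 fun k => ?_
  by_cases hk : k = n
  · subst hk
    simpa using measurable_id'
  · simp [tupleOf, hk]

theorem measurable_prod_sigma {T Y : Type*} [MeasurableSpace T] [MeasurableSpace Y]
    {f : T × (Σ n : ℕ, Fin n → ℝ≥0) → Y}
    (h : ∀ n, Measurable fun p : T × (Fin n → ℝ≥0) => f (p.1, ⟨n, p.2⟩)) :
    Measurable f := by
  intro B hB
  have : f ⁻¹' B = ⋃ n, {p | p.2.1 = n} ∩ (fun p => f (p.1, ⟨n, tupleOf n p.2⟩)) ⁻¹' B := by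
    ext ⟨t, ⟨m, v⟩⟩
    simp only [Set.mem_preimage, Set.mem_iUnion, Set.mem_inter_iff, Set.mem_ofPred_eq]
    constructor
    · intro hx
      exact ⟨m, rfl, by rwa [tupleOf_mk]⟩
    · rintro ⟨n, rfl, hx⟩
      rwa [tupleOf_mk] at hx
  rw [this]
  refine MeasurableSet.iUnion fun n => MeasurableSet.inter ?_ ?_
  · exact (measurable_sigma_fst.comp measurable_snd) (measurableSet_singleton n)
  · exact (h n).comp (measurable_fst.prodMk ((measurable_tupleOf n).comp measurable_snd)) hB

/-- The residual workload of the last individual to arrive. -/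
def lastWork : (Σ n : ℕ, Fin n → ℝ≥0) → ℝ≥0∞
  | ⟨0, _⟩ => ⊤
  | ⟨n + 1, v⟩ => v (Fin.last n)

/-- Service at rate one of the last individual to arrive. -/
def serveLast : ℝ≥0 → (Σ n : ℕ, Fin n → ℝ≥0) → Σ n : ℕ, Fin n → ℝ≥0
  | _, ⟨0, v⟩ => ⟨0, v⟩
  | t, ⟨n + 1, v⟩ => ⟨n + 1, Function.update v (Fin.last n) (v (Fin.last n) - t)⟩

theorem measurable_lastWork : Measurable lastWork := by
  refine measurable_sigma_iff.2 fun n => ?_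
  cases n with
  | zero => exact measurable_const
  | succ n => exact (measurable_pi_apply (Fin.last n)).coe_nnreal_ennreal

theorem measurable_update_last {T : Type*} [MeasurableSpace T] {n : ℕ} {g : T → Fin (n + 1) → ℝ≥0}
    {h : T → ℝ≥0} (hg : Measurable g) (hh : Measurable h) :
    Measurable fun t => Function.update (g t) (Fin.last n) (h t) := by
  refine measurable_pi_iff.2 fun i => ?_
  rcases eq_or_ne i (Fin.last n) with rfl | hi
  · simpa using hh
  · simpa [hi, Function.comp_def] using (measurable_pi_apply i).comp hg

theorem measurable_serveLast :
    Measurable fun p : ℝ≥0 × (Σ n : ℕ, Fin n → ℝ≥0) => serveLast p.1 p.2 := by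
  refine measurable_prod_sigma fun n => ?_
  cases n with
  | zero => exact (measurable_sigma_mk 0).comp measurable_snd
  | succ n =>
    exact (measurable_sigma_mk (n + 1)).comp (measurable_update_last measurable_snd (by fun_prop))

variable {β : ℕ → ℝ≥0}

theorem lifo_completion (hβ : ∀ n, 0 < β (n + 1)) (x : Σ n : ℕ, Fin n → ℝ≥0) :
    (lifo β).completion x = lastWork x / β x.1 := by
  rcases x with ⟨_ | n, v⟩
  · simp [lifo, lastWork, ENNReal.top_div]
  · exact ENNReal.coe_div (hβ n).ne'

theorem lifo_serve (t : ℝ≥0) (x : Σ n : ℕ, Fin n → ℝ≥0) :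
    (lifo β).serve t x = serveLast (β x.1 * t) x := by
  rcases x with ⟨_ | n, v⟩
  · rfl
  · simp [lifo, serveLast, mul_comm]

theorem lifo_arrive (w : ℝ≥0) (n : ℕ) (v : Fin n → ℝ≥0) :
    (lifo β).arrive w ⟨n, v⟩ = ⟨n + 1, Fin.snoc (α := fun _ => ℝ≥0) v w⟩ := rfl

theorem measurable_lifo_arrive :
    Measurable fun p : ℝ≥0 × (Σ n : ℕ, Fin n → ℝ≥0) => (lifo β).arrive p.1 p.2 := by
  refine measurable_prod_sigma fun n => ?_
  refine (measurable_sigma_mk (n + 1)).comp (measurable_pi_iff.2 fun i => ?_)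
  refine Fin.lastCases ?_ (fun i => ?_) i
  · simpa using measurable_fst
  · simpa [Function.comp_def] using (measurable_pi_apply i).comp measurable_snd

theorem isMeasurable_lifo (hβ : ∀ n, 0 < β (n + 1)) : (lifo β).IsMeasurable where
  number := measurable_sigma_fst
  completion := by
    have hb : Measurable fun x : Σ n : ℕ, Fin n → ℝ≥0 => β x.1 :=
      (measurable_of_countable β).comp measurable_sigma_fst
    rw [funext (lifo_completion hβ)]
    exact measurable_lastWork.div hb.coe_nnreal_ennreal
  serve := by
    have hb : Measurable fun p : ℝ≥0 × (Σ n : ℕ, Fin n → ℝ≥0) => β p.2.1 :=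
      (measurable_of_countable β).comp (measurable_sigma_fst.comp measurable_snd)
    simp_rw [lifo_serve]
    exact measurable_serveLast.comp ((hb.mul measurable_fst).prodMk measurable_snd)
  depart := by
    refine measurable_sigma_iff.2 fun n => ?_
    cases n with
    | zero => exact measurable_sigma_mk 0
    | succ n => exact (measurable_sigma_mk n).comp (by fun_prop)
  arrive := measurable_lifo_arrive

/-- The law of `n` independent workloads with law `m`, in order of arrival. -/
def tupleLaw (m : Measure ℝ≥0) (n : ℕ) : Measure (Σ n : ℕ, Fin n → ℝ≥0) :=
  (Measure.pi fun _ : Fin n => m).map (Sigma.mk n)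

instance (m : Measure ℝ≥0) [IsProbabilityMeasure m] (n : ℕ) :
    IsProbabilityMeasure (tupleLaw m n) :=
  Measure.isProbabilityMeasure_map (measurable_sigma_mk n).aemeasurable

/-- With `m = residual μ`, this presents level `n + 1` as level `n` with one more last workload, so
that the other workloads can be held fixed. -/
theorem arriveLaw_tupleLaw (m : Measure ℝ≥0) [IsProbabilityMeasure m] (n : ℕ) :
    (lifo β).arriveLaw m (tupleLaw m n) = tupleLaw m (n + 1) := by
  have h := (measurePreserving_piFinSuccAbove (fun _ : Fin (n + 1) => m) (Fin.last n)).symm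
  rw [tupleLaw, tupleLaw, ← h.map_eq, Measure.map_map (measurable_sigma_mk _) h.measurable,
    Discipline.arriveLaw]
  have h2 : m.prod ((Measure.pi fun _ : Fin n => m).map (Sigma.mk n))
      = (m.prod (Measure.pi fun _ : Fin n => m)).map
        (Prod.map id (Sigma.mk (β := fun n : ℕ => Fin n → ℝ≥0) n)) := by
    rw [← Measure.map_prod_map _ _ measurable_id (measurable_sigma_mk n), Measure.map_id]
  rw [h2, Measure.map_map measurable_lifo_arrive
    (measurable_id.prodMap (measurable_sigma_mk n))]
  congr 1
  ext1 p
  simp [lifo_arrive, MeasurableEquiv.piFinSuccAbove, Fin.insertNthEquiv, Fin.insertNth_last']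

theorem lastWork_arrive (w : ℝ≥0) (x : Σ n : ℕ, Fin n → ℝ≥0) :
    lastWork ((lifo β).arrive w x) = w := by
  rcases x with ⟨n, v⟩
  simp [lifo_arrive, lastWork]

theorem serveLast_arrive (t w : ℝ≥0) (x : Σ n : ℕ, Fin n → ℝ≥0) :
    serveLast t ((lifo β).arrive w x) = (lifo β).arrive (w - t) x := by
  rcases x with ⟨n, v⟩
  simp [lifo_arrive, serveLast, Fin.update_snoc_last]

/-- Only the last workload is served. With the others fixed, the two balance properties are
`residual_service` and `residual_completions`. -/
theorem levelBalance_lifo (hβ0 : β 0 = 0) (hβ : ∀ n, 0 < β (n + 1)) (μ : Measure ℝ≥0)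
    [IsProbabilityMeasure μ] [IsProbabilityMeasure (residual μ)] :
    (lifo β).LevelBalance β μ (tupleLaw (residual μ)) := by
  have hD := isMeasurable_lifo hβ
  refine Discipline.LevelBalance.of_unit_rate hD hβ0 (c := β) (κ := fun _ => 1) hβ
    (fun n => one_mul _) measurable_lastWork measurable_serveLast (lifo_completion hβ) lifo_serve
    ?_ ?_ ?_ ?_ ?_ ?_ (fun _ _ => rfl) ?_ ?_ ?_
  · rintro t ⟨_ | n, v⟩ <;> rfl
  · rintro t ⟨_ | n, v⟩
    · simp [serveLast, lastWork]
    · simp [serveLast, lastWork]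
  · rintro s t ⟨_ | n, v⟩
    · rfl
    · simp [serveLast, tsub_tsub]
  · rintro ⟨_ | n, v⟩ h
    · rfl
    · simp [lifo] at h
  · rintro t ⟨_ | n, v⟩ h
    · rfl
    · simp [lifo] at h
  · intro n
    have hs : MeasurableSet {x | (lifo β).number x = n} := hD.number (measurableSet_singleton n)
    rw [tupleLaw, ae_map_iff (measurable_sigma_mk n).aemeasurable hs]
    exact Eventually.of_forall fun _ => rfl
  · refine fun n => Eventually.of_forall ?_
    rintro ⟨n, v⟩
    simp [lifo]
  · intro n f hf t
    have hm : ∀ s : ℝ≥0, Measurable fun x : Σ n : ℕ, Fin n → ℝ≥0 =>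
        ltI s (lastWork x) * f (serveLast s x) := fun s =>
      Measurable.mul (by have := measurable_lastWork; fun_prop)
        (hf.comp (measurable_serveLast.comp (measurable_prodMk_left (x := s))))
    have hfa : Measurable fun p : ℝ≥0 × (Σ n : ℕ, Fin n → ℝ≥0) => f ((lifo β).arrive p.1 p.2) :=
      hf.comp hD.arrive
    have hq : Measurable fun q : (ℝ≥0 × (Σ n : ℕ, Fin n → ℝ≥0)) × ℝ≥0 =>
        ltI q.1.1 q.2 * f ((lifo β).arrive (q.2 - q.1.1) q.1.2) :=
      Measurable.mul (by fun_prop) (hfa.comp (f := fun q : (ℝ≥0 × (Σ n : ℕ, Fin n → ℝ≥0)) × ℝ≥0 =>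
        (q.2 - q.1.1, q.1.2)) (by fun_prop))
    rw [← arriveLaw_tupleLaw (β := β), hD.lintegral_arriveLaw_swap hf,
      hD.lintegral_arriveLaw_swap (hm t)]
    simp_rw [fun s => hD.lintegral_arriveLaw_swap (m := μ) (ρ := tupleLaw (residual μ) n) (hm s),
      lastWork_arrive, serveLast_arrive]
    have key : ∀ x, _ := fun x => residual_service μ
      (f := fun r => f ((lifo β).arrive r x)) (hfa.comp (measurable_prodMk_right (y := x))) t
    simp_rw [key]
    rw [lintegral_add_left]
    · congr 1
      rw [lintegral_lintegral_swap]
      · congr 1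
        ext s
        rw [ENNReal.coe_one, one_mul, lintegral_const_mul]
        exact hq.lintegral_prod_right'.comp (measurable_prodMk_left (x := s))
      · have := hq.lintegral_prod_right' (ν := μ)
        exact Measurable.aemeasurable (Measurable.mul (by fun_prop) (this.comp measurable_swap))
    · exact hq.lintegral_prod_right'.comp (measurable_prodMk_left (x := t))
  · intro n g hg hg0
    have hga : Measurable fun p : ℝ≥0 × (Σ n : ℕ, Fin n → ℝ≥0) =>
        g p.1 ((lifo β).arrive 0 p.2) :=
      hg.comp (measurable_fst.coe_nnreal_ennreal.prodMk
        (hD.arrive.comp (measurable_const.prodMk measurable_snd)))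
    have hm : ∀ s : ℝ≥0, Measurable fun x : Σ n : ℕ, Fin n → ℝ≥0 =>
        g (s + lastWork x) (serveLast (lastWork x).toNNReal x) := fun s =>
      hg.comp (Measurable.prodMk (by have := measurable_lastWork; fun_prop)
        (measurable_serveLast.comp (measurable_lastWork.ennreal_toNNReal.prodMk measurable_id)))
    have hm0 := hm 0
    simp only [ENNReal.coe_zero, zero_add] at hm0
    rw [← arriveLaw_tupleLaw (β := β), hD.lintegral_arriveLaw_swap hm0]
    simp_rw [fun s => hD.lintegral_arriveLaw_swap (m := μ) (ρ := tupleLaw (residual μ) n) (hm s),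
      lastWork_arrive, serveLast_arrive, ENNReal.toNNReal_coe, tsub_self, ENNReal.coe_one, one_mul]
    have hq : Measurable fun q : (ℝ≥0 × (Σ n : ℕ, Fin n → ℝ≥0)) × ℝ≥0 =>
        g ((q.1.1 + q.2 : ℝ≥0) : ℝ≥0∞) ((lifo β).arrive 0 q.1.2) :=
      hga.comp (f := fun q : (ℝ≥0 × (Σ n : ℕ, Fin n → ℝ≥0)) × ℝ≥0 => (q.1.1 + q.2, q.1.2))
        (by fun_prop)
    simp_rw [← ENNReal.coe_add]
    rw [lintegral_lintegral_swap (μ := lam), lintegral_lintegral_swap (μ := lam),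
      ← lintegral_add_left]
    · congr 1
      ext x
      exact residual_completions μ (f := fun r : ℝ≥0 => g r ((lifo β).arrive 0 x))
        (hga.comp (measurable_prodMk_right (y := x)))
    · exact (hga.comp measurable_swap).lintegral_prod_right'
    · exact hga.aemeasurable
    · exact hq.lintegral_prod_right'.aemeasurable

end

section

/-! ### Processor sharing -/

/-- The smallest of a finite family of workloads. -/
def minWork (x : Multiset ℝ≥0) : ℝ≥0∞ := (x.map fun r : ℝ≥0 => (r : ℝ≥0∞)).inf

/-- Service of all individuals at rate one. -/
def serveAll (t : ℝ≥0) (x : Multiset ℝ≥0) : Multiset ℝ≥0 := x.map fun r => r - t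

@[simp]
theorem minWork_zero : minWork 0 = ⊤ := rfl

@[simp]
theorem minWork_cons (r : ℝ≥0) (x : Multiset ℝ≥0) : minWork (r ::ₘ x) = min ↑r (minWork x) := by
  simp [minWork]

@[simp]
theorem serveAll_zero_right (t : ℝ≥0) : serveAll t 0 = 0 := rfl

@[simp]
theorem serveAll_cons (t r : ℝ≥0) (x : Multiset ℝ≥0) :
    serveAll t (r ::ₘ x) = (r - t) ::ₘ serveAll t x := by
  simp [serveAll]

theorem serveAll_zero (x : Multiset ℝ≥0) : serveAll 0 x = x := by
  simp [serveAll]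

@[fun_prop]
theorem measurable_minWork : Measurable minWork := by
  refine measurable_multiset_iff.2 fun n => ?_
  have : ∀ v, minWork (unordered n v) = ⨅ i, (v i : ℝ≥0∞) := by
    intro v
    rw [minWork, unordered, Multiset.map_map, ← Finset.inf_univ_eq_iInf]
    rfl
  simp_rw [this]
  fun_prop

theorem measurable_serveAll :
    Measurable fun p : ℝ≥0 × Multiset ℝ≥0 => serveAll p.1 p.2 := by
  refine measurable_prod_multiset fun n => ?_
  have : ∀ p : ℝ≥0 × (Fin n → ℝ≥0), serveAll p.1 (unordered n p.2)
      = unordered n fun i => p.2 i - p.1 := by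
    intro p
    rw [serveAll, unordered, Multiset.map_map]
    rfl
  simp_rw [this]
  exact (measurable_unordered n).comp (by fun_prop)

theorem minWork_ne_top {x : Multiset ℝ≥0} (hx : x ≠ 0) : minWork x ≠ ⊤ := by
  obtain ⟨r, hr⟩ := Multiset.exists_mem_of_ne_zero hx
  obtain ⟨y, rfl⟩ := Multiset.exists_cons_of_mem hr
  rw [minWork_cons]
  exact ne_top_of_le_ne_top ENNReal.coe_ne_top (min_le_left _ _)

theorem minWork_mem {x : Multiset ℝ≥0} {r : ℝ≥0} (h : minWork x = r) : r ∈ x := by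
  induction x using Multiset.induction with
  | empty => simp at h
  | cons s x ih =>
    rw [minWork_cons] at h
    rcases min_choice (s : ℝ≥0∞) (minWork x) with h' | h'
    · rw [h', ENNReal.coe_inj] at h
      simp [h]
    · rw [h'] at h
      exact Multiset.mem_cons_of_mem (ih h)

theorem minWork_div {c : ℝ≥0} (hc : 0 < c) (x : Multiset ℝ≥0) :
    (x.map fun r => ((r / c : ℝ≥0) : ℝ≥0∞)).inf = minWork x / c := by
  induction x using Multiset.induction with
  | empty => simp [ENNReal.top_div_of_ne_top]
  | cons r x ih =>
    have hmono : Monotone fun a : ℝ≥0∞ => a / c := fun a b h => ENNReal.div_le_div_right h _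
    rw [Multiset.map_cons, Multiset.inf_cons, ih, minWork_cons, hmono.map_min,
      ENNReal.coe_div hc.ne']

theorem minWork_serveAll (t : ℝ≥0) (x : Multiset ℝ≥0) :
    minWork (serveAll t x) = minWork x - t := by
  induction x using Multiset.induction with
  | empty => simp
  | cons r x ih =>
    have hmono : Monotone fun a : ℝ≥0∞ => a - t := fun a b h => tsub_le_tsub_right h _
    rw [serveAll_cons, minWork_cons, minWork_cons, ih, hmono.map_min, ENNReal.coe_sub]

variable {β : ℕ → ℝ≥0}

theorem processorSharing_completion (hβ : ∀ n, 0 < β (n + 1)) (x : Multiset ℝ≥0) :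
    (processorSharing β).completion x = minWork x / (β x.card / x.card : ℝ≥0) := by
  -- For the empty family the rate `β 0 / 0` is 0 by convention, and `⊤` divided by it is still `⊤`.
  rcases eq_or_ne x 0 with rfl | hx
  · rw [minWork_zero, ENNReal.top_div_of_ne_top ENNReal.coe_ne_top]
    simp [processorSharing]
  · refine minWork_div ?_ x
    obtain ⟨n, hn⟩ := Nat.exists_eq_succ_of_ne_zero (Multiset.card_eq_zero.not.2 hx)
    rw [hn]
    exact div_pos (hβ n) (by positivity)

theorem processorSharing_serve (t : ℝ≥0) (x : Multiset ℝ≥0) :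
    (processorSharing β).serve t x = serveAll (β x.card / x.card * t) x := by
  simp [processorSharing, serveAll, mul_comm]

theorem isMeasurable_processorSharing (hβ : ∀ n, 0 < β (n + 1)) :
    (processorSharing β).IsMeasurable where
  number := measurable_card
  completion := by
    have hb : Measurable fun x : Multiset ℝ≥0 => (β x.card / x.card : ℝ≥0) :=
      (measurable_of_countable fun n : ℕ => (β n / n : ℝ≥0)).comp measurable_card
    rw [funext (processorSharing_completion hβ)]
    exact measurable_minWork.div hb.coe_nnreal_ennreal
  serve := by
    have hb : Measurable fun p : ℝ≥0 × Multiset ℝ≥0 => (β p.2.card / p.2.card : ℝ≥0) :=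
      (measurable_of_countable fun n : ℕ => (β n / n : ℝ≥0)).comp
        (measurable_card.comp measurable_snd)
    simp_rw [processorSharing_serve]
    exact measurable_serveAll.comp ((hb.mul measurable_fst).prodMk measurable_snd)
  depart := measurable_filter_pos
  arrive := measurable_cons

/-! ### Laws of families of independent workloads -/

/-- The law of the unordered family of `n` independent workloads with law `m`. -/
def multisetLaw (m : Measure ℝ≥0) (n : ℕ) : Measure (Multiset ℝ≥0) :=
  (Measure.pi fun _ : Fin n => m).map (unordered n)

/-- The law of an unordered family with law `ρ` to which an independent workload with law `m`
is added. -/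
def consLaw (m : Measure ℝ≥0) (ρ : Measure (Multiset ℝ≥0)) : Measure (Multiset ℝ≥0) :=
  (m.prod ρ).map fun p => p.1 ::ₘ p.2

instance (m : Measure ℝ≥0) [IsProbabilityMeasure m] (n : ℕ) :
    IsProbabilityMeasure (multisetLaw m n) :=
  Measure.isProbabilityMeasure_map (measurable_unordered n).aemeasurable

instance (m : Measure ℝ≥0) [IsProbabilityMeasure m] (ρ : Measure (Multiset ℝ≥0))
    [IsProbabilityMeasure ρ] : IsProbabilityMeasure (consLaw m ρ) :=
  Measure.isProbabilityMeasure_map measurable_cons.aemeasurable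

theorem lintegral_consLaw {m : Measure ℝ≥0} {ρ : Measure (Multiset ℝ≥0)} [SFinite ρ]
    {f : Multiset ℝ≥0 → ℝ≥0∞} (hf : Measurable f) :
    ∫⁻ x, f x ∂consLaw m ρ = ∫⁻ r, ∫⁻ x, f (r ::ₘ x) ∂ρ ∂m := by
  rw [consLaw, lintegral_map hf measurable_cons, lintegral_prod]
  exact (hf.comp measurable_cons).aemeasurable

theorem consLaw_multisetLaw (m : Measure ℝ≥0) [IsProbabilityMeasure m] (n : ℕ) :
    consLaw m (multisetLaw m n) = multisetLaw m (n + 1) := by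
  have h := (measurePreserving_piFinSuccAbove (fun _ : Fin (n + 1) => m) 0).symm
  have h2 : m.prod ((Measure.pi fun _ : Fin n => m).map (unordered n))
      = (m.prod (Measure.pi fun _ : Fin n => m)).map (Prod.map id (unordered n)) := by
    rw [← Measure.map_prod_map _ _ measurable_id (measurable_unordered n), Measure.map_id]
  rw [multisetLaw, multisetLaw, ← h.map_eq, Measure.map_map (measurable_unordered _) h.measurable,
    consLaw, h2, Measure.map_map measurable_cons (measurable_id.prodMap (measurable_unordered n))]
  congr 1
  ext1 p
  simp [MeasurableEquiv.piFinSuccAbove, Fin.insertNthEquiv, unordered_succ]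

theorem lintegral_multisetLaw_zero (m : Measure ℝ≥0) [IsProbabilityMeasure m]
    {f : Multiset ℝ≥0 → ℝ≥0∞} (hf : Measurable f) : ∫⁻ x, f x ∂multisetLaw m 0 = f 0 := by
  rw [multisetLaw, lintegral_map hf (measurable_unordered 0)]
  simp [unordered]

theorem multisetLaw_ae (m : Measure ℝ≥0) [IsProbabilityMeasure m] (n : ℕ)
    {p : Multiset ℝ≥0 → Prop} (hp : MeasurableSet {x | p x})
    (h : ∀ᵐ v ∂Measure.pi fun _ : Fin n => m, p (unordered n v)) :
    ∀ᵐ x ∂multisetLaw m n, p x := by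
  rwa [multisetLaw, ae_map_iff (measurable_unordered n).aemeasurable hp]

theorem multisetLaw_ae_card (m : Measure ℝ≥0) [IsProbabilityMeasure m] (n : ℕ) :
    ∀ᵐ x ∂multisetLaw m n, x.card = n :=
  multisetLaw_ae m n (measurable_card (measurableSet_singleton n))
    (Eventually.of_forall fun v => card_unordered n v)

theorem multisetLaw_ae_minWork_ne (m : Measure ℝ≥0) [IsProbabilityMeasure m]
    [NullSingletonClass m] (n : ℕ) (r : ℝ≥0) :
    ∀ᵐ x ∂multisetLaw m n, minWork x ≠ r := by
  refine multisetLaw_ae m n (measurable_minWork (measurableSet_singleton _)).compl ?_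
  have hne : ∀ᵐ s ∂m, s ≠ r := by simp [ae_iff, measure_singleton]
  have : ∀ i : Fin n, ∀ᵐ v ∂Measure.pi fun _ : Fin n => m, v i ≠ r := fun i =>
    (Measure.quasiMeasurePreserving_eval (μ := fun _ : Fin n => m) i).ae hne
  filter_upwards [ae_all_iff.2 this] with v hv h
  have := minWork_mem h
  simp only [unordered, Multiset.mem_map] at this
  obtain ⟨i, _, hi⟩ := this
  exact hv i hi

/-- Evolution of a law of an unordered family when all are served at rate one, up to the first
completion. -/
def allKernel (ρ : Measure (Multiset ℝ≥0)) [SFinite ρ] : Kernel ℝ≥0 (Multiset ℝ≥0) :=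
  flowKernel ρ measurable_minWork measurable_serveAll

instance (ρ : Measure (Multiset ℝ≥0)) [IsFiniteMeasure ρ] : IsFiniteKernel (allKernel ρ) := by
  unfold allKernel; infer_instance

theorem lintegral_allKernel {ρ : Measure (Multiset ℝ≥0)} [SFinite ρ] {f : Multiset ℝ≥0 → ℝ≥0∞}
    (hf : Measurable f) (v : ℝ≥0) :
    ∫⁻ x, f x ∂allKernel ρ v = ∫⁻ x, ltI v (minWork x) * f (serveAll v x) ∂ρ :=
  lintegral_flowKernel _ _ hf v

theorem measurable_serveAll_right (v : ℝ≥0) : Measurable (serveAll v) :=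
  measurable_serveAll.comp (measurable_prodMk_left (x := v))

/-- The first completion is later than `v` exactly when it is so for the added workload and for the
others; hence the flow, cut at the first completion, preserves independence. -/
theorem lintegral_allKernel_consLaw {m : Measure ℝ≥0} [IsFiniteMeasure m]
    {ρ : Measure (Multiset ℝ≥0)} [IsFiniteMeasure ρ] [SFinite (consLaw m ρ)]
    {f : Multiset ℝ≥0 → ℝ≥0∞} (hf : Measurable f) (v : ℝ≥0) :
    ∫⁻ x, f x ∂allKernel (consLaw m ρ) v
      = ∫⁻ r, ∫⁻ x, f (r ::ₘ x) ∂allKernel ρ v ∂serveKernel m v := by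
  have hs := measurable_serveAll_right v
  have hfc : Measurable fun p : ℝ≥0 × Multiset ℝ≥0 => f (p.1 ::ₘ p.2) := hf.comp measurable_cons
  rw [lintegral_allKernel hf, lintegral_consLaw, lintegral_serveKernel]
  · congr 1
    ext r
    have hr : Measurable fun x : Multiset ℝ≥0 => f ((r - v) ::ₘ x) :=
      hfc.comp (measurable_prodMk_left (x := r - v))
    rw [lintegral_allKernel hr, ← lintegral_const_mul]
    · congr 1
      ext x
      rw [minWork_cons, ltI_min, serveAll_cons]
      ring
    · exact Measurable.mul (by fun_prop) (hr.comp hs)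
  · exact hfc.lintegral_prod_right'
  · exact Measurable.mul (by fun_prop) (hf.comp hs)

theorem lintegral_allKernel_smul (k : ℝ≥0) (ρ : Measure (Multiset ℝ≥0)) [SFinite ρ]
    {f : Multiset ℝ≥0 → ℝ≥0∞} (hf : Measurable f) (v : ℝ≥0) :
    ∫⁻ x, f x ∂allKernel (k • ρ) v = k * ∫⁻ x, f x ∂allKernel ρ v := by
  rw [lintegral_allKernel hf, lintegral_allKernel hf, lintegral_smul_measure]
  rfl

/-- The product rule, by induction on `n`: the decrease of the new factor gives one term, that of
the old ones `n` terms. All of them coincide, since in an unordered family it does not matter which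
workload is the fresh one. -/
theorem decreasesAt_multisetLaw (μ : Measure ℝ≥0) [IsProbabilityMeasure μ]
    [IsProbabilityMeasure (residual μ)] (n : ℕ) :
    DecreasesAt (allKernel (multisetLaw (residual μ) n))
      (allKernel ((n : ℝ≥0) • consLaw μ (multisetLaw (residual μ) (n - 1)))) := by
  induction n with
  | zero =>
    intro z u _ f hf
    have hm : ∀ v : ℝ≥0, Measurable fun x => ltI v (minWork x) * f (serveAll v x) := fun v =>
      Measurable.mul (by fun_prop) (hf.comp (measurable_serveAll_right _))
    have h0 : ∀ v : ℝ≥0, ∫⁻ x, f x ∂allKernel (multisetLaw (residual μ) 0) v = f 0 := by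
      intro v
      rw [lintegral_allKernel hf, lintegral_multisetLaw_zero _ (hm v)]
      simp [ltI_of_lt]
    simp_rw [h0, lintegral_allKernel hf]
    simp
  | succ n ih =>
    intro z u hzu f hf
    have hfc : Measurable (Function.uncurry fun (r : ℝ≥0) (x : Multiset ℝ≥0) => f (r ::ₘ x)) :=
      hf.comp measurable_cons
    have hU : ∀ v, ∫⁻ x, f x ∂allKernel (multisetLaw (residual μ) (n + 1)) v
        = ∫⁻ r, ∫⁻ x, f (r ::ₘ x) ∂allKernel (multisetLaw (residual μ) n) v
          ∂serveKernel (residual μ) v := by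
      intro v
      simp_rw [← consLaw_multisetLaw]
      exact lintegral_allKernel_consLaw hf v
    rw [hU, hU, (decreasesAt_residual μ).prod ih hzu hfc]
    congr 2
    ext v
    congr 1
    rw [← lintegral_allKernel_consLaw hf]
    rw [lintegral_allKernel_smul _ _ hf]
    have hfr : ∀ r, Measurable fun x => f (r ::ₘ x) := fun r =>
      hfc.comp (measurable_prodMk_left (x := r))
    simp_rw [fun r => lintegral_allKernel_smul n (consLaw μ (multisetLaw (residual μ) (n - 1)))
      (hfr r) v]
    rcases n with _ | k
    · simp
    · have hswap : ∫⁻ r, ∫⁻ x, f (r ::ₘ x)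
          ∂allKernel (consLaw μ (multisetLaw (residual μ) k)) v ∂serveKernel (residual μ) v
          = ∫⁻ x, f x ∂allKernel (consLaw μ (multisetLaw (residual μ) (k + 1))) v := by
        rw [lintegral_allKernel_consLaw hf]
        simp_rw [← consLaw_multisetLaw (residual μ) k]
        simp_rw [fun r => lintegral_allKernel_consLaw (m := μ)
          (ρ := multisetLaw (residual μ) k) (hfr r) v,
          fun r => lintegral_allKernel_consLaw (m := residual μ)
          (ρ := multisetLaw (residual μ) k) (hfr r) v]
        rw [lintegral_lintegral_swap]
        · simp_rw [Multiset.cons_swap]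
        · have h3 : Measurable fun q : (ℝ≥0 × ℝ≥0) × Multiset ℝ≥0 =>
              f (q.1.1 ::ₘ q.1.2 ::ₘ q.2) :=
            hf.comp (measurable_cons.comp (measurable_fst.fst.prodMk
              (measurable_cons.comp (measurable_fst.snd.prodMk measurable_snd))))
          exact h3.lintegral_prod_right'.aemeasurable
      rw [lintegral_const_mul, Nat.add_sub_cancel, hswap, Nat.add_sub_cancel]
      · push_cast
        ring
      · have : Measurable fun r => ∫⁻ x, f (r ::ₘ x)
            ∂allKernel (consLaw μ (multisetLaw (residual μ) k)) v := hfc.lintegral_prod_right'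
        exact this

end

/-! ### The first completion under processor sharing -/

theorem measurable_lintegral_allKernel {T : Type*} [MeasurableSpace T]
    (ρ : Measure (Multiset ℝ≥0)) [IsFiniteMeasure ρ] {f : T → Multiset ℝ≥0 → ℝ≥0∞}
    (hf : Measurable (Function.uncurry f)) {v : T → ℝ≥0} (hv : Measurable v) :
    Measurable fun t => ∫⁻ x, f t x ∂allKernel ρ (v t) :=
  hf.lintegral_kernel_prod_right' (κ := (allKernel ρ).comap v hv)

theorem lintegral_allKernel_smul_consLaw (m : Measure ℝ≥0) [IsProbabilityMeasure m] (n : ℕ)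
    {f : Multiset ℝ≥0 → ℝ≥0∞} (hf : Measurable f) (v : ℝ≥0) :
    ∫⁻ x, f x ∂allKernel ((n : ℝ≥0) • consLaw m (multisetLaw m (n - 1))) v
      = n * ∫⁻ x, f x ∂allKernel (multisetLaw m n) v := by
  rw [lintegral_allKernel_smul _ _ hf]
  rcases n with _ | n
  · simp
  · simp_rw [Nat.add_sub_cancel, consLaw_multisetLaw]
    rfl

/-- The value of `H` at the time of the first completion, under service of all at rate one, and
at the state at that time. -/
def atFirst (H : ℝ≥0 → Multiset ℝ≥0 → ℝ≥0∞) (x : Multiset ℝ≥0) : ℝ≥0∞ :=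
  H (minWork x).toNNReal (serveAll (minWork x).toNNReal x)

theorem measurable_atFirst {H : ℝ≥0 → Multiset ℝ≥0 → ℝ≥0∞} (hH : Measurable (Function.uncurry H)) :
    Measurable (atFirst H) := by
  have h1 : Measurable fun x => (minWork x).toNNReal := by fun_prop
  exact hH.comp (h1.prodMk (measurable_serveAll.comp (h1.prodMk measurable_id)))

theorem atFirst_cons {H : ℝ≥0 → Multiset ℝ≥0 → ℝ≥0∞} {w : ℝ≥0} {x : Multiset ℝ≥0}
    (h : minWork x ≠ w) :
    atFirst H (w ::ₘ x) = ltI w (minWork x) * H w (0 ::ₘ serveAll w x)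
      + ltI (minWork x) w * atFirst (fun s y => H s ((w - s) ::ₘ y)) x := by
  unfold atFirst
  rcases lt_or_gt_of_ne h with h | h
  · rw [ltI_of_lt h, ltI_of_le h.le, minWork_cons, min_eq_right h.le, serveAll_cons]
    simp
  · rw [ltI_of_lt h, ltI_of_le h.le, minWork_cons, min_eq_left h.le, serveAll_cons]
    simp

/-- The first completion among an individual with workload of law `μ` and `n` independent ones
with workloads of law `m`: either the former or one of the latter completes first. -/
theorem lintegral_atFirst_consLaw (m : Measure ℝ≥0) [IsProbabilityMeasure m] [NullSingletonClass m]
    (n : ℕ) (μ : Measure ℝ≥0) [IsProbabilityMeasure μ] {H : ℝ≥0 → Multiset ℝ≥0 → ℝ≥0∞}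
    (hH : Measurable (Function.uncurry H)) :
    ∫⁻ x, atFirst H x ∂consLaw μ (multisetLaw m n)
      = ∫⁻ w, ∫⁻ y, H w (0 ::ₘ y) ∂allKernel (multisetLaw m n) w ∂μ
        + ∫⁻ s, ∫⁻ y, H s (0 ::ₘ y)
            ∂allKernel ((n : ℝ≥0) • consLaw μ (multisetLaw m (n - 1))) s ∂m := by
  -- `μ` is generalized so that the hypothesis applies with `μ = m`, when workloads that all have
  -- law `m` are seen as one added to the others.
  induction n using Nat.strongRecOn generalizing μ H with | _ n ih
  have hcons : ∀ {H : ℝ≥0 → Multiset ℝ≥0 → ℝ≥0∞}, Measurable (Function.uncurry H) →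
      Measurable (Function.uncurry fun s y => H s (0 ::ₘ y)) := fun {H} hH =>
    hH.comp (measurable_fst.prodMk (measurable_cons.comp (measurable_const.prodMk measurable_snd)))
  have hH0 := hcons hH
  have hH0' : ∀ s, Measurable fun y => H s (0 ::ₘ y) := fun s =>
    hH0.comp (measurable_prodMk_left (x := s))
  have hHw : ∀ w : ℝ≥0, Measurable (Function.uncurry fun s y => H s ((w - s) ::ₘ y)) := fun w =>
    hH.comp (measurable_fst.prodMk (measurable_cons.comp
      ((measurable_const.sub measurable_fst).prodMk measurable_snd)))
  have hsplit : ∀ w, ∫⁻ x, atFirst H (w ::ₘ x) ∂multisetLaw m n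
      = ∫⁻ y, H w (0 ::ₘ y) ∂allKernel (multisetLaw m n) w
        + ∫⁻ x, ltI (minWork x) w * atFirst (fun s y => H s ((w - s) ::ₘ y)) x
            ∂multisetLaw m n := by
    intro w
    rw [lintegral_allKernel (hH0' w), ← lintegral_add_left]
    · refine lintegral_congr_ae ?_
      filter_upwards [multisetLaw_ae_minWork_ne m n w] with x hx
      exact atFirst_cons hx
    · exact Measurable.mul (by fun_prop) ((hH0' w).comp (measurable_serveAll_right w))
  rw [lintegral_consLaw (measurable_atFirst hH)]
  simp_rw [hsplit]
  rw [lintegral_add_left]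
  swap
  · exact measurable_lintegral_allKernel _ hH0 measurable_id
  congr 1
  rcases n with _ | n
  · simp_rw [fun s => lintegral_allKernel_smul ((0 : ℕ) : ℝ≥0)
      (consLaw μ (multisetLaw m (0 - 1))) (hH0' s) s]
    have : ∀ w : ℝ≥0, ∫⁻ x, ltI (minWork x) w * atFirst (fun s y => H s ((w - s) ::ₘ y)) x
        ∂multisetLaw m 0 = 0 := by
      intro w
      rw [lintegral_multisetLaw_zero]
      · simp [ltI_of_le]
      · exact Measurable.mul (by fun_prop) (measurable_atFirst (hHw w))
    simp [this]
  · have hK : Measurable fun q : (ℝ≥0 × ℝ≥0) × Multiset ℝ≥0 =>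
        ltI q.1.2 q.1.1 * H q.1.2 ((q.1.1 - q.1.2) ::ₘ 0 ::ₘ q.2) := by
      refine Measurable.mul (by fun_prop) ?_
      have h1 : Measurable fun q : (ℝ≥0 × ℝ≥0) × Multiset ℝ≥0 => (0 : ℝ≥0) ::ₘ q.2 :=
        measurable_cons.comp (measurable_const.prodMk measurable_snd)
      exact hH.comp (measurable_fst.snd.prodMk (measurable_cons.comp
        ((measurable_fst.fst.sub measurable_fst.snd).prodMk h1)))
    have hKi : Measurable fun p : ℝ≥0 × ℝ≥0 => ∫⁻ y,
        ltI p.2 p.1 * H p.2 ((p.1 - p.2) ::ₘ 0 ::ₘ y) ∂allKernel (multisetLaw m n) p.2 :=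
      measurable_lintegral_allKernel _ hK measurable_snd
    -- Each of the `n + 1` workloads with law `m` may be the first to complete, and by symmetry they
    -- contribute equally. Until then `w` acts as a parameter.
    have hleft : ∀ w : ℝ≥0, ∫⁻ x, ltI (minWork x) w * atFirst (fun s y => H s ((w - s) ::ₘ y)) x
        ∂multisetLaw m (n + 1) = (n + 1) * ∫⁻ s : ℝ≥0, ∫⁻ y,
          ltI s w * H s ((w - s) ::ₘ 0 ::ₘ y) ∂allKernel (multisetLaw m n) s ∂m := by
      intro w
      have h1 : ∫⁻ x, ltI (minWork x) w * atFirst (fun s y => H s ((w - s) ::ₘ y)) x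
          ∂multisetLaw m (n + 1) = ∫⁻ x, atFirst (fun s y => ltI s w * H s ((w - s) ::ₘ y)) x
          ∂multisetLaw m (n + 1) := by
        refine lintegral_congr_ae ?_
        filter_upwards [multisetLaw_ae_card m (n + 1)] with x hx
        have : minWork x ≠ ⊤ := minWork_ne_top (by rintro rfl; simp at hx)
        simp only [atFirst, ENNReal.coe_toNNReal this]
      have hKw : Measurable (Function.uncurry
          fun (s : ℝ≥0) y => ltI s w * H s ((w - s) ::ₘ y)) :=
        Measurable.mul (by fun_prop) (hHw w)
      have hKs : ∀ s : ℝ≥0, Measurable fun y => ltI s w * H s ((w - s) ::ₘ 0 ::ₘ y) := fun s =>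
        (hcons hKw).comp (measurable_prodMk_left (x := s))
      rw [h1, ← consLaw_multisetLaw, ih n (Nat.lt_succ_self n) m hKw]
      simp_rw [fun s => lintegral_allKernel_smul_consLaw m n (hKs s) s]
      rw [lintegral_const_mul]
      · ring
      · exact hKi.comp (measurable_prodMk_left (x := w))
    simp_rw [hleft]
    rw [lintegral_const_mul _ hKi.lintegral_prod_right', lintegral_lintegral_swap hKi.aemeasurable,
      ← lintegral_const_mul _ hKi.lintegral_prod_left']
    congr 1
    ext s
    have hHs : Measurable fun q : ℝ≥0 × Multiset ℝ≥0 => H s (0 ::ₘ q.1 ::ₘ q.2) :=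
      (hH0' s).comp measurable_cons
    rw [lintegral_allKernel_smul _ _ (hH0' s), Nat.add_sub_cancel,
      lintegral_allKernel_consLaw (hH0' s), lintegral_serveKernel hHs.lintegral_prod_right']
    push_cast
    congr 2
    ext w
    rw [← lintegral_const_mul]
    · simp_rw [Multiset.cons_swap (w - s) 0]
    · exact hHs.comp (measurable_prodMk_left (x := w - s))

/-- The first completion among `n + 1` independent workloads. -/
theorem lintegral_atFirst_multisetLaw (m : Measure ℝ≥0) [IsProbabilityMeasure m]
    [NullSingletonClass m] (n : ℕ) {H : ℝ≥0 → Multiset ℝ≥0 → ℝ≥0∞}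
    (hH : Measurable (Function.uncurry H)) :
    ∫⁻ x, atFirst H x ∂multisetLaw m (n + 1)
      = (n + 1) * ∫⁻ s, ∫⁻ y, H s (0 ::ₘ y) ∂allKernel (multisetLaw m n) s ∂m := by
  have hH0 : Measurable (Function.uncurry fun s y => H s (0 ::ₘ y)) :=
    hH.comp (measurable_fst.prodMk (measurable_cons.comp (measurable_const.prodMk measurable_snd)))
  have hH0' : ∀ s, Measurable fun y => H s (0 ::ₘ y) := fun s =>
    hH0.comp (measurable_prodMk_left (x := s))
  rw [← consLaw_multisetLaw, lintegral_atFirst_consLaw m n m hH]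
  simp_rw [fun s => lintegral_allKernel_smul_consLaw m n (hH0' s) s]
  have hm : Measurable fun s => ∫⁻ y, H s (0 ::ₘ y) ∂allKernel (multisetLaw m n) s :=
    measurable_lintegral_allKernel _ hH0 measurable_id
  rw [lintegral_const_mul _ hm]
  ring

theorem lintegral_multisetLaw_service (μ : Measure ℝ≥0) [IsProbabilityMeasure μ]
    [IsProbabilityMeasure (residual μ)] (n : ℕ) {f : Multiset ℝ≥0 → ℝ≥0∞} (hf : Measurable f)
    (t : ℝ≥0) :
    ∫⁻ x, f x ∂multisetLaw (residual μ) n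
      = ∫⁻ x, f x ∂allKernel (multisetLaw (residual μ) n) t
        + ∫⁻ s : ℝ≥0, ltI s t * ∫⁻ x, f x
          ∂allKernel ((n : ℝ≥0) • consLaw μ (multisetLaw (residual μ) (n - 1))) s ∂lam := by
  have h := decreasesAt_multisetLaw μ n 0 t zero_le f hf
  have h0 : ∫⁻ x, f x ∂allKernel (multisetLaw (residual μ) n) 0
      = ∫⁻ x, f x ∂multisetLaw (residual μ) n := by
    rw [lintegral_allKernel hf]
    refine lintegral_congr_ae ?_
    filter_upwards [multisetLaw_ae_minWork_ne (residual μ) n 0] with x hx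
    rw [ltI_of_lt (by exact_mod_cast pos_iff_ne_zero.2 hx), one_mul, serveAll_zero]
  rw [← h0, h]
  congr 1
  refine lintegral_congr_ae ?_
  filter_upwards [window_ae_eq_ltI t] with s hs
  rw [ENNReal.coe_zero, hs]

/-- Each of the `n + 1` individuals may be the one that completes at time s; the `n` others must
then have the equilibrium law. In `hpoint` their service identity is averaged over a workload with
law μ truncated at s. The three terms correspond to no arrival before s, to the last arrival being
that of the completing individual, and to its being that of another one; in this last case the
completing workload has the residual density `tail μ`. -/
theorem lintegral_multisetLaw_completions (μ : Measure ℝ≥0) [IsProbabilityMeasure μ]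
    [IsProbabilityMeasure (residual μ)] (n : ℕ) {g : ℝ≥0 → Multiset ℝ≥0 → ℝ≥0∞}
    (hg : Measurable (Function.uncurry g)) :
    ∫⁻ x, atFirst g x ∂multisetLaw (residual μ) (n + 1)
      + (n + 1) * ∫⁻ s : ℝ≥0, ∫⁻ x, atFirst (fun r => g (s + r)) x
          ∂consLaw μ (multisetLaw (residual μ) n) ∂lam
      = (n + 1) * ∫⁻ s : ℝ≥0, ∫⁻ x, g s (0 ::ₘ x) ∂multisetLaw (residual μ) n ∂lam := by
  have hg0 : Measurable (Function.uncurry fun s y => g s (0 ::ₘ y)) :=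
    hg.comp (measurable_fst.prodMk (measurable_cons.comp (measurable_const.prodMk measurable_snd)))
  have hg0' : ∀ s, Measurable fun y => g s (0 ::ₘ y) := fun s =>
    hg0.comp (measurable_prodMk_left (x := s))
  have hgs : ∀ s, Measurable (Function.uncurry fun r => g (s + r)) := fun s =>
    hg.comp ((measurable_const.add measurable_fst).prodMk measurable_snd)
  have hjoint : ∀ (ρ : Measure (Multiset ℝ≥0)) [IsFiniteMeasure ρ], Measurable
      (Function.uncurry fun s v : ℝ≥0 => ∫⁻ y, g s (0 ::ₘ y) ∂allKernel ρ v) := by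
    intro ρ _
    have : Measurable fun q : (ℝ≥0 × ℝ≥0) × Multiset ℝ≥0 => g q.1.1 (0 ::ₘ q.2) :=
      hg0.comp (f := fun q : (ℝ≥0 × ℝ≥0) × Multiset ℝ≥0 => (q.1.1, q.2)) (by fun_prop)
    exact measurable_lintegral_allKernel ρ this measurable_snd
  rw [lintegral_atFirst_multisetLaw _ n hg, ← mul_add]
  congr 1
  simp_rw [fun s => lintegral_atFirst_consLaw (residual μ) n μ (hgs s)]
  set Λ := allKernel (multisetLaw (residual μ) n) with hΛ
  set Q := allKernel ((n : ℝ≥0) • consLaw μ (multisetLaw (residual μ) (n - 1))) with hQ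
  have hmΛ : Measurable (Function.uncurry fun s v : ℝ≥0 => ∫⁻ y, g s (0 ::ₘ y) ∂Λ v) := hjoint _
  have hmQ : Measurable (Function.uncurry fun s v : ℝ≥0 => ∫⁻ y, g s (0 ::ₘ y) ∂Q v) := hjoint _
  have hpoint : ∀ s : ℝ≥0, ∫⁻ x, g s (0 ::ₘ x) ∂multisetLaw (residual μ) n
      = tail μ s * ∫⁻ y, g s (0 ::ₘ y) ∂Λ s
        + ∫⁻ w : ℝ≥0, leI w s * ∫⁻ y, g s (0 ::ₘ y) ∂Λ w ∂μ
        + ∫⁻ v : ℝ≥0, ltI v s * (tail μ v * ∫⁻ y, g s (0 ::ₘ y) ∂Q v) ∂lam := fun s =>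
    average_truncated μ (hmΛ.comp (measurable_prodMk_left (x := s)))
      (hmQ.comp (measurable_prodMk_left (x := s)))
      (fun t => lintegral_multisetLaw_service μ n (hg0' s) t) s
  simp_rw [hpoint]
  have hΛ1 : Measurable fun s : ℝ≥0 => ∫⁻ y, g s (0 ::ₘ y) ∂Λ s :=
    hmΛ.comp (f := fun s : ℝ≥0 => (s, s)) (by fun_prop)
  have hΛ2 : Measurable fun p : ℝ≥0 × ℝ≥0 => ∫⁻ y, g (p.1 + p.2) (0 ::ₘ y) ∂Λ p.2 :=
    hmΛ.comp (f := fun p : ℝ≥0 × ℝ≥0 => (p.1 + p.2, p.2)) (by fun_prop)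
  have hQ1 : ∀ s, Measurable fun r => ∫⁻ y, g (s + r) (0 ::ₘ y) ∂Q r := fun s =>
    hmQ.comp (f := fun r : ℝ≥0 => (s + r, r)) (by fun_prop)
  have hΛ3 : Measurable fun p : ℝ≥0 × ℝ≥0 => leI p.2 p.1 * ∫⁻ y, g p.1 (0 ::ₘ y) ∂Λ p.2 :=
    Measurable.mul (by fun_prop) hmΛ
  have hQ3 : Measurable (Function.uncurry fun s v : ℝ≥0 =>
      tail μ v * ∫⁻ y, g s (0 ::ₘ y) ∂Q v) := Measurable.mul (by fun_prop) hmQ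
  have hQ4 : ∀ s, ∫⁻ r, ∫⁻ y, g (s + r) (0 ::ₘ y) ∂Q r ∂residual μ
      = ∫⁻ r : ℝ≥0, tail μ r * ∫⁻ y, g (s + r) (0 ::ₘ y) ∂Q r ∂lam := fun s =>
    lintegral_residual μ (hQ1 s)
  have hΛ4 : Measurable fun s : ℝ≥0 => tail μ s * ∫⁻ y, g s (0 ::ₘ y) ∂Λ s := by fun_prop
  have hΛ5 : Measurable fun s : ℝ≥0 => ∫⁻ w : ℝ≥0, leI w s * ∫⁻ y, g s (0 ::ₘ y) ∂Λ w ∂μ :=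
    hΛ3.lintegral_prod_right'
  simp_rw [hQ4, add_assoc]
  rw [lintegral_add_left hΛ2.lintegral_prod_right', lintegral_residual μ hΛ1,
    lintegral_lam_add_leI μ hmΛ, lintegral_lam_lam_add hQ3,
    lintegral_add_left hΛ4, lintegral_add_left hΛ5]

/-! ### Level balance under processor sharing, and the law of the number present -/

section

variable {β : ℕ → ℝ≥0}

theorem serveAll_serveAll (s t : ℝ≥0) (x : Multiset ℝ≥0) :
    serveAll s (serveAll t x) = serveAll (t + s) x := by
  simp [serveAll, Multiset.map_map, tsub_tsub]

theorem minWork_eq_zero_of_mem {x : Multiset ℝ≥0} (h : 0 ∈ x) : minWork x = 0 := by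
  obtain ⟨y, rfl⟩ := Multiset.exists_cons_of_mem h
  simp

theorem levelBalance_processorSharing (hβ0 : β 0 = 0) (hβ : ∀ n, 0 < β (n + 1)) (μ : Measure ℝ≥0)
    [IsProbabilityMeasure μ] [IsProbabilityMeasure (residual μ)] :
    (processorSharing β).LevelBalance β μ (multisetLaw (residual μ)) := by
  have hD := isMeasurable_processorSharing hβ
  have harr : ∀ n, (processorSharing β).arriveLaw μ (multisetLaw (residual μ) n)
      = consLaw μ (multisetLaw (residual μ) n) := fun _ => rfl
  -- Each workload is served at rate `β n / n`, and at unit speed the `n` workloads together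
  -- complete at rate `n`; the product is `β n`.
  refine Discipline.LevelBalance.of_unit_rate hD hβ0 (c := fun n => β n / n)
    (κ := fun n => (n : ℝ≥0)) (fun n => div_pos (hβ n) (by positivity))
    (fun n => mul_div_cancel₀ _ (by positivity)) measurable_minWork measurable_serveAll
    (processorSharing_completion hβ) processorSharing_serve
    (fun t x => Multiset.card_map _ x) minWork_serveAll serveAll_serveAll ?_ ?_
    (multisetLaw_ae_card _) (fun w x => Multiset.card_cons w x) ?_ ?_ ?_
  · intro x hx
    rw [Multiset.card_eq_zero.1 hx, minWork_zero]
  · intro t x hx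
    rw [Multiset.card_eq_zero.1 hx, serveAll_zero_right]
  · intro n
    filter_upwards [multisetLaw_ae_minWork_ne (residual μ) n 0] with x hx
    change Multiset.filter (fun r => 0 < r) (0 ::ₘ x) = x
    rw [Multiset.filter_cons_of_neg _ (lt_irrefl 0), Multiset.filter_eq_self]
    intro r hr
    refine pos_iff_ne_zero.2 ?_
    rintro rfl
    exact hx (minWork_eq_zero_of_mem hr)
  · intro n f hf t
    rw [harr, lintegral_multisetLaw_service μ (n + 1) hf t, lintegral_allKernel hf]
    congr 2
    ext s
    rw [lintegral_allKernel_smul _ _ hf, lintegral_allKernel hf, Nat.add_sub_cancel]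
  · intro n g hg hg0
    rw [harr]
    have h := lintegral_multisetLaw_completions μ n (g := fun s x => g s x)
      (hg.comp (f := fun p : ℝ≥0 × Multiset ℝ≥0 => ((p.1 : ℝ≥0∞), p.2)) (by fun_prop))
    have hE : ∀ ρ : Measure (Multiset ℝ≥0), (∀ᵐ x ∂ρ, x.card = n + 1) → ∀ s : ℝ≥0,
        ∫⁻ x, g (s + minWork x) (serveAll (minWork x).toNNReal x) ∂ρ
          = ∫⁻ x, atFirst (fun r => g (s + r : ℝ≥0)) x ∂ρ := by
      intro ρ hρ s
      refine lintegral_congr_ae ?_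
      filter_upwards [hρ] with x hx
      have : minWork x ≠ ⊤ := minWork_ne_top (by rintro rfl; simp at hx)
      simp only [atFirst, ENNReal.coe_add, ENNReal.coe_toNNReal this]
    have h0 := hE _ (multisetLaw_ae_card (residual μ) (n + 1)) 0
    simp only [ENNReal.coe_zero, zero_add] at h0
    have h1 := hE _ (hD.number_arriveLaw (μ := μ) (fun w x => Multiset.card_cons w x)
      (multisetLaw_ae_card (residual μ) n))
    rw [harr] at h1
    simp_rw [h0, h1]
    push_cast
    exact h

/-- The marginal of a distribution on levels. -/
theorem hasLaw_number {S : Type*} [MeasurableSpace S] {D : Discipline S} (hD : D.IsMeasurable)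
    {α : ℕ → ℝ≥0} {μ : Measure ℝ≥0} {π : PMF ℕ} {ρ : ℕ → Measure S}
    [∀ n, IsProbabilityMeasure (ρ n)] (hρ : ∀ n, ∀ᵐ x ∂ρ n, D.number x = n)
    (h : IsStationary D α μ (Measure.sum fun n => π n • ρ n)) (t : ℝ≥0) :
    HasLaw (fun p => D.number (D.state α p.1 p.2 t)) π.toMeasure
      (drivingLaw μ (Measure.sum fun n => π n • ρ n)) := by
  have hmap : (Measure.sum fun n => π n • ρ n).map D.number = π.toMeasure := by
    refine Measure.ext fun s hs => ?_
    rw [Measure.map_apply hD.number hs, Measure.sum_apply _ (hD.number hs),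
      PMF.toMeasure_apply _ hs]
    congr 1
    ext n
    rw [Measure.smul_apply, smul_eq_mul]
    by_cases hn : n ∈ s
    · have : ρ n (D.number ⁻¹' s) = 1 := by
        rw [← mem_ae_iff_prob_eq_one (hD.number hs)]
        filter_upwards [hρ n] with x hx
        simpa [hx] using hn
      simp [this, hn]
    · have : ρ n (D.number ⁻¹' s) = 0 := by
        refine measure_mono_null (t := {x | ¬ D.number x = n}) ?_ (hρ n)
        rintro x hx rfl
        exact hn hx
      simp [this, hn]
  have hlaw : HasLaw D.number π.toMeasure (Measure.sum fun n => π n • ρ n) :=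
    ⟨hD.number.aemeasurable, hmap⟩
  exact hlaw.comp (h.2 t)

end

end Insensitivity

end

theorem theorem1 (α β : ℕ → ℝ≥0) (hβ : ∀ n, 0 < β n ↔ 0 < n)
    (μ : Measure ℝ≥0) [IsProbabilityMeasure μ] (hμ : ∫⁻ w, (w : ℝ≥0∞) ∂μ = 1)
    (π : PMF ℕ)
    (hbal : ∀ n, π (n + 1) * (β (n + 1) : ℝ≥0∞) = π n * (α n : ℝ≥0∞))
    (hfin : ∑' n, π n * (α n : ℝ≥0∞) < ⊤) :
    (Insensitivity.IsStationary (Insensitivity.processorSharing β) α μ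
        (Insensitivity.unorderedLaw μ π) ∧
      ∀ t : ℝ≥0, HasLaw
        (fun p => (Insensitivity.processorSharing β).number
          ((Insensitivity.processorSharing β).state α p.1 p.2 t))
        π.toMeasure (Insensitivity.drivingLaw μ (Insensitivity.unorderedLaw μ π))) ∧
    (Insensitivity.IsStationary (Insensitivity.lifo β) α μ
        (Insensitivity.orderedLaw μ π) ∧
      ∀ t : ℝ≥0, HasLaw
        (fun p => (Insensitivity.lifo β).number
          ((Insensitivity.lifo β).state α p.1 p.2 t))
        π.toMeasure (Insensitivity.drivingLaw μ (Insensitivity.orderedLaw μ π))) := by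
  have := Insensitivity.isProbabilityMeasure_residual μ hμ
  have hβ0 : β 0 = 0 := by simpa using hβ 0
  have hβ1 : ∀ n, 0 < β (n + 1) := fun n => (hβ (n + 1)).2 n.succ_pos
  have hP := Insensitivity.levelBalance_processorSharing hβ0 hβ1 μ
  have hL := Insensitivity.levelBalance_lifo hβ0 hβ1 μ
  have hPS := hP.isStationary α (Insensitivity.isMeasurable_processorSharing hβ1) hβ0 hbal hfin
  have hLS := hL.isStationary α (Insensitivity.isMeasurable_lifo hβ1) hβ0 hbal hfin
  -- `unorderedLaw` and `orderedLaw` are by definition the mixtures of `multisetLaw` and of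
  -- `tupleLaw` with weights `π n`.
  exact ⟨⟨hPS, Insensitivity.hasLaw_number
      (ρ := Insensitivity.multisetLaw (Insensitivity.residual μ))
      (Insensitivity.isMeasurable_processorSharing hβ1) hP.number_ae hPS⟩,
    ⟨hLS, Insensitivity.hasLaw_number
      (ρ := Insensitivity.tupleLaw (Insensitivity.residual μ))
      (Insensitivity.isMeasurable_lifo hβ1) hL.number_ae hLS⟩⟩
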